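/- Let $K$ be an infinite field. A $K$-variety is a separated scheme of finite type over $K$ (not assumed reduced or irreducible), and $V(K)$ is its set of $K$-points. An étale image in $V(K)$ is a set of the form $f(X(K))$, where $f : X \to V$ is an étale morphism of $K$-varieties. The étale images form a basis of a topology on $V(K)$, the étale-open topology. A clopen étale image in $V(K)$ is an étale image which is closed in the étale-open topology. We say that $V(K)$ is étale connected if its only clopen étale images are $\emptyset$ and $V(K)$, and étale totally separated if for all distinct $\alpha,\beta\in V(K)$ there is a clopen étale image $U$ in $V(K)$ with $\alpha\in U$ and $\beta\notin U$. A topological space is totally separated if any two distinct points are separated by a clopen set. A $K$-variety is quasi-projective if it admits an immersion over $K$ into some projective space $\mathbb{P}^n_K$. **Theorem.** Suppose that $K$ is not separably closed. Then the following are equivalent: 1. $\mathbb{A}^1(K)$ is not étale connected; 2. $\mathbb{A}^1(K)$ is étale totally separated; 3. $V(K)$ is étale totally separated for every quasi-projective $K$-variety $V$; 4. $K$ is not real closed. Furthermore, the following are equivalent: 5. the étale-open topology on $\mathbb{A}^1(K)$ is not connected; 6. the étale-open topology on $\mathbb{A}^1(K)$ is totally separated; 7. the étale-open topology on $V(K)$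 is totally separated for every quasi-projective $K$-variety $V$; 8. $K$ is not isomorphic to $\mathbb{R}$. Moreover, for every infinite field $K$ (separably closed or not), the étale-open topology on $\mathbb{A}^1(K)$ is connected if and only if $K$ is separably closed or isomorphic to $\mathbb{R}$. -/

import Mathlib

open CategoryTheory AlgebraicGeometry

universe u

noncomputable section

namespace EtaleOpen

/-- The base scheme `Spec K`. -/
abbrev base (K : Type u) [Field K] : Scheme.{u} := Spec (CommRingCat.of K)

/-- A variety over `K`: a separated scheme of finite type over `K`, not assumed to be reduced
or irreducible. -/
class IsVariety (K : Type u) [Field K] (V : Over (base K)) : Prop where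
  isSeparated : IsSeparated V.hom
  locallyOfFiniteType : LocallyOfFiniteType V.hom
  quasiCompact : QuasiCompact V.hom

/-- The set `V(K)` of `K`-points: morphisms `Spec K ⟶ V` over `Spec K`. -/
def Points (K : Type u) [Field K] (V : Over (base K)) : Type u :=
  Over.mk (𝟙 (base K)) ⟶ V

/-- The map `X(K) → V(K)` induced by a morphism `X ⟶ V` over `K`. -/
def Points.map {K : Type u} [Field K] {X V : Over (base K)} (f : X ⟶ V) :
    Points K X → Points K V :=
  fun p => CategoryStruct.comp (obj := Over (base K)) p f

/-- `U ⊆ V(K)` is an étale image if it is the image of `X(K) → V(K)` for some étale morphism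
`X ⟶ V` of `K`-varieties. -/
def IsEtaleImage {K : Type u} [Field K] {V : Over (base K)} (U : Set (Points K V)) : Prop :=
  ∃ (X : Over (base K)) (f : X ⟶ V), IsVariety K X ∧ Etale f.left ∧ Set.range (Points.map f) = U

/-- The étale-open topology on `V(K)`: the topology generated by the étale images. By
`isTopologicalBasis_isEtaleImage` below, the étale images are a basis of it. -/
instance etaleOpenTopology (K : Type u) [Field K] (V : Over (base K)) :
    TopologicalSpace (Points K V) :=
  TopologicalSpace.generateFrom {U | IsEtaleImage U}

theorem isEtaleImage_univ {K : Type u} [Field K] {V : Over (base K)} [hV : IsVariety K V] :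
    IsEtaleImage (Set.univ : Set (Points K V)) := by
  refine ⟨V, 𝟙 V, hV, ?_, ?_⟩
  · rw [Over.id_left]; infer_instance
  · exact Set.eq_univ_of_forall fun p => ⟨p, Category.comp_id _⟩

theorem IsEtaleImage.inter {K : Type u} [Field K] {V : Over (base K)} [hV : IsVariety K V]
    {U W : Set (Points K V)} (hU : IsEtaleImage U) (hW : IsEtaleImage W) :
    IsEtaleImage (U ∩ W) := by
  obtain ⟨X, f, hX, hf, rfl⟩ := hU
  obtain ⟨Y, g, hY, hg, rfl⟩ := hW
  let P : Over (base K) := Over.mk (Limits.pullback.fst f.left g.left ≫ X.hom)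
  let a : P ⟶ X := Over.homMk (Limits.pullback.fst f.left g.left) rfl
  have hcomp : Limits.pullback.snd f.left g.left ≫ Y.hom = P.hom := by
    change _ = Limits.pullback.fst f.left g.left ≫ X.hom
    rw [← Over.w f, ← Over.w g, Limits.pullback.condition_assoc]
  let b : P ⟶ Y := Over.homMk (Limits.pullback.snd f.left g.left) hcomp
  have hab : a ≫ f = b ≫ g := by
    ext1
    exact Limits.pullback.condition
  have hfs : IsSeparated Y.hom := hY.isSeparated
  have hsg : IsSeparated g.left := by
    have : IsSeparated (g.left ≫ V.hom) := by rw [Over.w g]; exact hfs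
    exact IsSeparated.of_comp g.left V.hom
  have := hV.isSeparated
  have hqc : QuasiCompact g.left := by
    have : QuasiCompact (g.left ≫ V.hom) := by rw [Over.w g]; exact hY.quasiCompact
    exact QuasiCompact.of_comp g.left V.hom
  have := hX.isSeparated
  have := hX.locallyOfFiniteType
  have := hX.quasiCompact
  refine ⟨P, a ≫ f, ⟨?_, ?_, ?_⟩, ?_, ?_⟩
  · change IsSeparated (Limits.pullback.fst f.left g.left ≫ X.hom); infer_instance
  · change LocallyOfFiniteType (Limits.pullback.fst f.left g.left ≫ X.hom); infer_instance
  · change QuasiCompact (Limits.pullback.fst f.left g.left ≫ X.hom); infer_instance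
  · change Etale (Limits.pullback.fst f.left g.left ≫ f.left); infer_instance
  · ext p
    constructor
    · rintro ⟨q, rfl⟩
      refine ⟨⟨Points.map a q, Category.assoc _ _ _⟩, ⟨Points.map b q, ?_⟩⟩
      let q' : Over.mk (𝟙 (base K)) ⟶ P := q
      change (q' ≫ b) ≫ g = q' ≫ a ≫ f
      rw [Category.assoc, hab]
    · rintro ⟨⟨q, hq⟩, ⟨r, hr⟩⟩
      have hqr : CategoryStruct.comp (obj := Over (base K)) q f =
          CategoryStruct.comp (obj := Over (base K)) r g := hq.trans hr.symm
      let q' : Over.mk (𝟙 (base K)) ⟶ X := q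
      let r' : Over.mk (𝟙 (base K)) ⟶ Y := r
      have hl : q'.left ≫ f.left = r'.left ≫ g.left := congrArg CommaMorphism.left hqr
      let t : Over.mk (𝟙 (base K)) ⟶ P :=
        Over.homMk (Limits.pullback.lift q'.left r'.left hl) (by
          change Limits.pullback.lift q'.left r'.left hl ≫ Limits.pullback.fst _ _ ≫ X.hom = _
          rw [Limits.pullback.lift_fst_assoc]
          exact Over.w q')
      refine ⟨t, ?_⟩
      rw [← hq]
      change t ≫ a ≫ f = q' ≫ f
      rw [← Category.assoc]
      congr 1
      ext1
      exact Limits.pullback.lift_fst _ _ _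

theorem isTopologicalBasis_isEtaleImage (K : Type u) [Field K] (V : Over (base K))
    [IsVariety K V] :
    TopologicalSpace.IsTopologicalBasis {U : Set (Points K V) | IsEtaleImage U} where
  exists_subset_inter U hU W hW _ hp := ⟨U ∩ W, IsEtaleImage.inter hU hW, hp, subset_rfl⟩
  sUnion_eq := Set.eq_univ_of_forall fun _ => ⟨Set.univ, isEtaleImage_univ, trivial⟩
  eq_generateFrom := rfl

/-- A clopen étale image: an étale image which is closed in the étale-open topology
(étale images are open by definition of the topology). -/
def IsClopenEtaleImage {K : Type u} [Field K] {V : Over (base K)} (U : Set (Points K V)) : Prop :=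
  IsEtaleImage U ∧ IsClosed U

/-- `V(K)` is étale connected if `∅` and `V(K)` are its only clopen étale images. -/
def EtaleConnected (K : Type u) [Field K] (V : Over (base K)) : Prop :=
  ∀ U : Set (Points K V), IsClopenEtaleImage U → U = ∅ ∨ U = Set.univ

/-- `V(K)` is étale totally separated if distinct points are separated by clopen étale images. -/
def EtaleTotallySeparated (K : Type u) [Field K] (V : Over (base K)) : Prop :=
  ∀ a b : Points K V, a ≠ b → ∃ U : Set (Points K V), IsClopenEtaleImage U ∧ a ∈ U ∧ b ∉ U

/-- The affine line `𝔸¹ = Spec K[x]` over `K`. -/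
def affineLine (K : Type u) [Field K] : Over (base K) :=
  Over.mk (Spec.map (CommRingCat.ofHom (algebraMap K (Polynomial K))))

attribute [local instance] MvPolynomial.gradedAlgebra

/-- Projective space `ℙⁿ = Proj K[x₀, …, xₙ]` over `K`. -/
def projectiveSpace (n : ℕ) (K : Type u) [Field K] : Over (base K) :=
  Over.mk (Proj.toSpecZero (MvPolynomial.homogeneousSubmodule (Fin (n + 1)) K) ≫
    Spec.map (CommRingCat.ofHom
      (algebraMap K (MvPolynomial.homogeneousSubmodule (Fin (n + 1)) K 0))))

/-- A `K`-scheme is quasi-projective if it admits an immersion over `K` (an isomorphism onto a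
locally closed subscheme) into some `ℙⁿ`. -/
def IsQuasiProjective (K : Type u) [Field K] (V : Over (base K)) : Prop :=
  ∃ (n : ℕ) (i : V ⟶ projectiveSpace n K), IsImmersion i.left

end EtaleOpen

end

/-! Everything is reduced to the affine line. If `K` is not separably closed, there is a form `N` of
positive degree in `n + 1` variables without nontrivial zeros over `K`, so all `K`-points of
projective space lie in the affine open set where `N` does not vanish. Distinct `K`-points of a
quasi-projective `V` are therefore separated by a regular function on an open subvariety with the
same `K`-points (`exists_separating_of_isQuasiProjective`). On the line itself, affine maps carry
any pair of distinct points to any other, so a single nontrivial clopen set already separates all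
points.

Suppose the line is étale connected and `K` is not separably closed. For a finite extension `L` of
`K`, the set of `c` in `K` such that `G(y) = α + cβ` has a simple root `y` in `L` is an étale image:
it comes from the Weil restriction of an étale equation. For `G = X ^ m` and `G = X ^ p - X` the
values form a group, and translating by cosets shows that suitable sets of this kind are clopen,
hence all of `K`. So Kummer and Artin–Schreier maps are surjective on every proper finite extension,
and Artin–Schreier maps also on `K`. Kummer and Artin–Schreier theory then make every proper finite
extension separably closed, and the argument of Artin and Schreier shows that `K` is real closed
(`EtaleConnected.isRealClosed`).

Conversely let `K` be real closed. An étale image in the line is a finite union of images of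
standard étale algebras. By Hermite's method, the existence of a rational point in a fibre is read
off from the signature of a trace form; its diagonal entries are polynomials in the parameter, so
the image is constant on intervals avoiding a finite set. The intermediate value theorem for
polynomials makes étale images open for the order topology. A clopen étale image is then locally
constant with finitely many exceptional points, hence trivial (`etaleConnected_of_isRealClosed`).

For the topology, open rays of a real closed field are étale images, so a Dedekind gap gives a
clopen set, and the only ordered field without gaps is `ℝ`. Over `ℝ` étale images are open in the
usual topology, which is connected. Over an infinite separably closed field nonempty étale images in
the line are cofinite, so any two of them meet. -/

namespace EtaleOpen

/-! ### Cyclic extensions of prime degree: Artin–Schreier and Kummer theory. -/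

section FieldTheory

open Polynomial Module

/-- In a Galois extension of prime degree, an element fixed by one nontrivial automorphism lies in
the base field. -/
theorem mem_range_algebraMap_of_fixed {F E : Type*} [Field F] [Field E] [Algebra F E]
    [FiniteDimensional F E] [IsGalois F E] {q : ℕ} [Fact q.Prime] (hdeg : finrank F E = q)
    {σ : Gal(E/F)} (hσ : σ ≠ 1) {x : E} (hx : σ x = x) : x ∈ Set.range (algebraMap F E) := by
  rw [IsGalois.mem_range_algebraMap_iff_fixed]
  have hcard : Nat.card Gal(E/F) = q := by rw [IsGalois.card_aut_eq_finrank, hdeg]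
  intro τ
  have hτ : τ ∈ Subgroup.zpowers σ := mem_zpowers_of_prime_card hcard hσ
  have : Subgroup.zpowers σ ≤ MulAction.stabilizer Gal(E/F) x := by
    rw [Subgroup.zpowers_le]
    exact hx
  exact this hτ

theorem exists_nontrivial_aut {F E : Type*} [Field F] [Field E] [Algebra F E]
    [FiniteDimensional F E] [IsGalois F E] {q : ℕ} [Fact q.Prime] (hdeg : finrank F E = q) :
    ∃ σ : Gal(E/F), σ ≠ 1 := by
  have hcard : Nat.card Gal(E/F) = q := by rw [IsGalois.card_aut_eq_finrank, hdeg]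
  have : Nontrivial Gal(E/F) := by
    rw [← Finite.one_lt_card_iff_nontrivial, hcard]
    exact (Fact.out : q.Prime).one_lt
  exact exists_ne 1

/-- A Galois extension of degree `p` in characteristic `p` contains `α` with `σ α = α + 1` for some
automorphism `σ`. -/
theorem exists_aut_eq_add_one {F E : Type*} [Field F] [Field E] [Algebra F E]
    [FiniteDimensional F E] [IsGalois F E] (p : ℕ) [Fact p.Prime] [CharP F p]
    (hdeg : finrank F E = p) : ∃ (σ : Gal(E/F)) (α : E), σ ≠ 1 ∧ σ α = α + 1 := by
  obtain ⟨σ, hσ⟩ := exists_nontrivial_aut hdeg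
  have hcard : Nat.card Gal(E/F) = p := by rw [IsGalois.card_aut_eq_finrank, hdeg]
  have : CharP E p := charP_of_injective_algebraMap (algebraMap F E).injective p
  have : CharP (Module.End F E) p :=
    charP_of_injective_algebraMap (algebraMap F (Module.End F E)).injective p
  let s : Module.End F E := σ.toLinearMap
  let N : Module.End F E := s - 1
  have hs (n : ℕ) : s ^ n = (σ ^ n : Gal(E/F)).toLinearMap := by
    induction n with
    | zero => rfl
    | succ n ih => rw [pow_succ, pow_succ, ih]; rfl
  -- In characteristic `p` one has `(s - 1) ^ p = s ^ p - 1`, and `s ^ p = 1` because the Galois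
  -- group has order `p`.
  have hN : N ^ p = 0 := by
    rw [sub_pow_char_of_commute p (Commute.one_right s), one_pow, hs, ← hcard, pow_card_eq_one']
    exact sub_self _
  have hex : ∃ n, N ^ n = 0 := ⟨p, hN⟩
  classical
  -- The nilpotency index is at least 2 because `σ ≠ 1`. So there is a Jordan chain of length two: a
  -- fixed vector `w = N ^ (k + 1) v ≠ 0` and `u = N ^ k v` with `σ u = u + w`; then `u / w` is the
  -- required element.
  obtain ⟨k, hk⟩ : ∃ k, Nat.find hex = k + 2 := by
    have h0 : Nat.find hex ≠ 0 := fun h => by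
      have := Nat.find_spec hex
      rw [h, pow_zero] at this
      exact one_ne_zero this
    have h1 : Nat.find hex ≠ 1 := fun h => by
      have := Nat.find_spec hex
      rw [h, pow_one] at this
      apply hσ
      ext x
      exact sub_eq_zero.mp (LinearMap.congr_fun this x)
    exact ⟨Nat.find hex - 2, by omega⟩
  have hk0 : N ^ (k + 2) = 0 := hk ▸ Nat.find_spec hex
  have hk1 : N ^ (k + 1) ≠ 0 := Nat.find_min hex (by omega)
  obtain ⟨v, hv⟩ : ∃ v, (N ^ (k + 1)) v ≠ 0 := by
    by_contra! h
    exact hk1 (LinearMap.ext h)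
  have hw : σ ((N ^ (k + 1)) v) = (N ^ (k + 1)) v := by
    have : N ((N ^ (k + 1)) v) = 0 := by
      rw [← Module.End.mul_apply, ← pow_succ', hk0]; rfl
    exact sub_eq_zero.mp this
  have hu : σ ((N ^ k) v) = (N ^ k) v + (N ^ (k + 1)) v := by
    rw [pow_succ' N k, Module.End.mul_apply]
    exact (add_sub_cancel _ _).symm
  refine ⟨σ, (N ^ k) v / (N ^ (k + 1)) v, hσ, ?_⟩
  rw [map_div₀, hw, hu, add_div, div_self hv]

/-- If `y ^ p - y` is surjective on a field of characteristic `p`, there are no Galois extensions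
of degree `p`. -/
theorem finrank_ne_of_artinSchreier_surjective {F E : Type*} [Field F] [Field E] [Algebra F E]
    [FiniteDimensional F E] [IsGalois F E] (p : ℕ) [Fact p.Prime] [CharP F p]
    (h : ∀ a : F, ∃ b : F, b ^ p - b = a) : finrank F E ≠ p := by
  intro hdeg
  obtain ⟨σ, α, hσ, hα⟩ := exists_aut_eq_add_one p hdeg
  have : CharP E p := charP_of_injective_algebraMap (algebraMap F E).injective p
  obtain ⟨a, ha⟩ := mem_range_algebraMap_of_fixed hdeg hσ (x := α ^ p - α) (by
    rw [map_sub, map_pow, hα, add_pow_char, one_pow]; ring)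
  obtain ⟨b, hb⟩ := h a
  have h0 : (α - algebraMap F E b) ^ p = α - algebraMap F E b := by
    have hab := ha
    rw [← hb, map_sub, map_pow] at hab
    rw [sub_pow_char]
    linear_combination -hab
  classical
  -- `α - b` is a root of `X ^ p - X`, whose roots are already exhausted by the `p` elements of the
  -- prime field. Hence it is fixed by `σ`, contradicting `σ α = α + 1`.
  obtain ⟨c, hc⟩ : ∃ c : ZMod p, ZMod.castHom (dvd_refl p) E c = α - algebraMap F E b := by
    by_contra! hne
    have hroots : (Finset.univ.image (ZMod.castHom (dvd_refl p) E) ∪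
        {α - algebraMap F E b}).val ≤ (X ^ p - X : E[X]).roots := by
      rw [Finset.val_le_iff_val_subset]
      intro x hx
      have hne0 : (X ^ p - X : E[X]) ≠ 0 :=
        FiniteField.X_pow_card_sub_X_ne_zero E (Fact.out : p.Prime).one_lt
      rw [mem_roots hne0]
      simp only [Finset.mem_val, Finset.mem_union, Finset.mem_image, Finset.mem_univ, true_and,
        Finset.mem_singleton] at hx
      rcases hx with ⟨c, rfl⟩ | rfl
      · rw [IsRoot, eval_sub, eval_pow, eval_X, ← map_pow, ZMod.pow_card, sub_self]
      · simp [IsRoot, h0]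
    have hc := (Multiset.card_le_card hroots).trans (card_roots' _)
    rw [Finset.card_val, FiniteField.X_pow_card_sub_X_natDegree_eq E (Fact.out : p.Prime).one_lt,
      Finset.card_union_of_disjoint (by simpa using hne),
      Finset.card_image_of_injective _ (ZMod.castHom (dvd_refl p) E).injective] at hc
    simp [ZMod.card] at hc
  have hσc : σ (α - algebraMap F E b) = α - algebraMap F E b := by
    rw [← hc]
    have := RingHom.ext_zmod ((σ : E →+* E).comp (ZMod.castHom (dvd_refl p) E))
      (ZMod.castHom (dvd_refl p) E)
    exact RingHom.congr_fun this c
  rw [map_sub, hα, AlgEquiv.commutes] at hσc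
  have h10 : (1 : E) = 0 := by linear_combination hσc
  exact one_ne_zero h10

/-- Kummer theory: if the base contains a primitive `q`-th root of unity and all its elements are
`q`-th powers, there are no Galois extensions of prime degree `q`. -/
theorem finrank_ne_of_pow_surjective {F E : Type*} [Field F] [Field E] [Algebra F E]
    [FiniteDimensional F E] [IsGalois F E] (q : ℕ) [Fact q.Prime]
    (hζ : (primitiveRoots q F).Nonempty) (h : ∀ a : F, ∃ b : F, b ^ q = a) : finrank F E ≠ q := by
  intro hdeg
  have hcard : Nat.card Gal(E/F) = q := by rw [IsGalois.card_aut_eq_finrank, hdeg]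
  have : IsCyclic Gal(E/F) := isCyclic_of_prime_card hcard
  subst hdeg
  obtain ⟨α, ⟨a, ha⟩, hα⟩ := exists_root_adjoin_eq_top_of_isCyclic F E hζ
  have hirr := irreducible_X_pow_sub_C_of_root_adjoin_eq_top ha.symm hα
  obtain ⟨b, hb⟩ := h a
  exact (pow_ne_of_irreducible_X_pow_sub_C hirr dvd_rfl (Fact.out : (finrank F E).Prime).ne_one b) hb

end FieldTheory

/-! ### From surjective Kummer and Artin–Schreier maps to separably closed and real closed fields.
-/

section FieldTheory
open Polynomial Module

/-- All `m`-th power maps with `m` invertible are surjective, and so is the Artin–Schreier map. -/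
def KummerArtinSchreierSurjective (E : Type*) [Field E] : Prop :=
  (∀ m : ℕ, (m : E) ≠ 0 → ∀ a : E, ∃ b, b ^ m = a) ∧
    ∀ p : ℕ, p.Prime → CharP E p → ∀ a : E, ∃ b, b ^ p - b = a

/-- Every finite extension has surjective Kummer and Artin–Schreier maps. -/
def HereditarilySurjective (F : Type u) [Field F] : Prop :=
  ∀ (E : Type u) [Field E] [Algebra F E] [FiniteDimensional F E], KummerArtinSchreierSurjective E

theorem HereditarilySurjective.self {F : Type u} [Field F] (h : HereditarilySurjective F) :
    KummerArtinSchreierSurjective F := h F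

theorem HereditarilySurjective.of_finite {F E : Type u} [Field F] [Field E] [Algebra F E]
    [FiniteDimensional F E] (h : HereditarilySurjective F) : HereditarilySurjective E := by
  intro E' _ _ _
  let : Algebra F E' := ((algebraMap E E').comp (algebraMap F E)).toAlgebra
  have : IsScalarTower F E E' := .of_algebraMap_eq' rfl
  have : FiniteDimensional F E' := FiniteDimensional.trans F E E'
  exact h E'

/-- A primitive `q`-th root of unity is a root of a cyclotomic polynomial of degree `q - 1`. The
strict bound lets the induction on degrees absorb the adjunction of roots of unity. -/
theorem finrank_cyclotomicField_lt {F : Type u} [Field F] (q : ℕ) [hq : Fact q.Prime]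
    [NeZero (q : F)] : finrank F (CyclotomicField q F) < q := by
  have : NeZero q := ⟨hq.out.ne_zero⟩
  have : FiniteDimensional F (CyclotomicField q F) :=
    IsCyclotomicExtension.finite_of_singleton q F _
  let ζ := IsCyclotomicExtension.zeta q F (CyclotomicField q F)
  have hζ : IsPrimitiveRoot ζ q := IsCyclotomicExtension.zeta_spec q F _
  have htop : IntermediateField.adjoin F {ζ} = ⊤ := by
    rw [← IntermediateField.toSubalgebra_inj, IntermediateField.adjoin_simple_toSubalgebra_of_isAlgebraic
      (Algebra.IsAlgebraic.isAlgebraic ζ)]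
    exact IsCyclotomicExtension.adjoin_primitive_root_eq_top hζ
  rw [← IntermediateField.finrank_top', ← htop,
    IntermediateField.adjoin.finrank (Algebra.IsIntegral.isIntegral ζ)]
  have hroot : aeval ζ (cyclotomic q F) = 0 := by
    rw [aeval_def, ← Polynomial.eval_map, map_cyclotomic]
    exact hζ.isRoot_cyclotomic hq.out.pos
  calc (minpoly F ζ).natDegree ≤ (cyclotomic q F).natDegree :=
        natDegree_le_of_dvd (minpoly.dvd F ζ hroot) (cyclotomic_ne_zero q F)
    _ = q - 1 := by rw [natDegree_cyclotomic, Nat.totient_prime hq.out]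
    _ < q := Nat.sub_lt hq.out.pos one_pos

theorem primitiveRoots_nonempty_of_finrank_eq_one {F E : Type*} [Field F] [Field E] [Algebra F E]
    {q : ℕ} (hq : 0 < q) {ζ : E} (hζ : IsPrimitiveRoot ζ q) (h : ζ ∈ Set.range (algebraMap F E)) :
    (primitiveRoots q F).Nonempty := by
  obtain ⟨z, rfl⟩ := h
  exact ⟨z, (mem_primitiveRoots hq).mpr (hζ.of_map_of_injective (algebraMap F E).injective)⟩

/-- Induction on the degree, over all base fields at once. Let `q` be the least prime factor of `n`.
If `q < n`, the fixed field of an element of order `q` gives a smaller Galois extension of degree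
`q`, which is impossible. If `q = n`, Artin–Schreier theory excludes characteristic `q`; otherwise
the induction hypothesis puts the `q`-th roots of unity in `F`, and Kummer theory applies. -/
theorem HereditarilySurjective.finrank_eq_one {n : ℕ} : ∀ {F E : Type u} [Field F] [Field E]
    [Algebra F E] [FiniteDimensional F E] [IsGalois F E], HereditarilySurjective F →
    finrank F E = n → n = 1 := by
  induction n using Nat.strong_induction_on with
  | _ n ih =>
  intro F E _ _ _ _ _ hF hn
  by_contra hn1
  have hq := Nat.minFac_prime hn1
  set q := n.minFac with hqdef
  have : Fact q.Prime := ⟨hq⟩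
  have hn0 : 0 < n := hn ▸ finrank_pos
  have hcard : Nat.card Gal(E/F) = n := by rw [IsGalois.card_aut_eq_finrank, hn]
  obtain ⟨σ, hσ⟩ := exists_prime_orderOf_dvd_card' (G := Gal(E/F)) q (hcard ▸ n.minFac_dvd)
  rcases (Nat.minFac_le hn0).lt_or_eq with hlt | heq
  · have hM : finrank (IntermediateField.fixedField (Subgroup.zpowers σ)) E = q := by
      rw [IntermediateField.finrank_fixedField_eq_card, Nat.card_zpowers, hσ]
    exact hq.ne_one (ih q hlt (hF.of_finite) hM)
  · rw [← hqdef] at heq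
    by_cases hchar : (q : F) = 0
    · have : CharP F q := (CharP.charP_iff_prime_eq_zero hq).mpr hchar
      exact finrank_ne_of_artinSchreier_surjective q (hF.self.2 q hq this) (hn.trans heq.symm)
    · have : NeZero (q : F) := ⟨hchar⟩
      have : NeZero q := ⟨hq.ne_zero⟩
      have : FiniteDimensional F (CyclotomicField q F) :=
        IsCyclotomicExtension.finite_of_singleton q F _
      have : IsGalois F (CyclotomicField q F) := IsCyclotomicExtension.isGalois {q} F _
      have h1 : finrank F (CyclotomicField q F) = 1 :=
        ih _ ((finrank_cyclotomicField_lt q).trans_eq heq) hF rfl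
      refine finrank_ne_of_pow_surjective q ?_ (hF.self.1 q hchar) (hn.trans heq.symm)
      exact primitiveRoots_nonempty_of_finrank_eq_one hq.pos
        (IsCyclotomicExtension.zeta_spec q F (CyclotomicField q F))
        ((bijective_algebraMap_of_linearEquiv (LinearEquiv.ofFinrankEq F (CyclotomicField q F) (by simp [h1]))).2 _)

theorem HereditarilySurjective.isSepClosed {F : Type u} [Field F] (hF : HereditarilySurjective F) :
    IsSepClosed F := by
  refine IsSepClosed.of_exists_root F fun f hf hirr hsep => ?_
  have := Fact.mk hirr
  let E := f.SplittingField
  have : IsGalois F E := IsGalois.of_separable_splitting_field hsep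
  have h1 : finrank F E = 1 := hF.finrank_eq_one rfl
  obtain ⟨x, hx⟩ := (SplittingField.splits f).exists_eval_eq_zero (by
    rw [degree_map]; exact hirr.degree_pos.ne')
  obtain ⟨y, rfl⟩ : ∃ y, algebraMap F E y = x := (bijective_algebraMap_of_linearEquiv
    (LinearEquiv.ofFinrankEq F E (by simp [h1]))).2 x
  refine ⟨y, (algebraMap F E).injective ?_⟩
  rw [map_zero, ← hx, eval_map_algebraMap, aeval_algebraMap_apply, coe_aeval_eq_eval]

/-- The minimal polynomial of a root in `L` has degree 1 or 2; dividing out a quadratic one leaves a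
polynomial of smaller odd degree. -/
theorem exists_isRoot_of_odd_natDegree_of_finrank_eq_two {K L : Type*} [Field K] [Field L]
    [Algebra K L] [IsAlgClosed L] (h2 : finrank K L = 2) :
    ∀ (n : ℕ) (f : K[X]), f.natDegree = n → Odd n → ∃ x, f.IsRoot x := by
  intro n
  induction n using Nat.strong_induction_on with
  | _ n ih =>
  intro f hn hodd
  have : FiniteDimensional K L := FiniteDimensional.of_finrank_pos (by omega)
  have hf0 : f ≠ 0 := by rintro rfl; simp at hn; subst hn; simp at hodd
  obtain ⟨x, hx⟩ := IsAlgClosed.exists_aeval_eq_zero L f (by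
    rw [degree_eq_natDegree hf0, hn]
    have := hodd.pos
    exact_mod_cast this.ne')
  obtain ⟨g, hg⟩ := minpoly.dvd K x hx
  have hint := Algebra.IsIntegral.isIntegral (R := K) x
  have hg0 : g ≠ 0 := by rintro rfl; simp at hg; exact hf0 hg
  have hdeg : f.natDegree = (minpoly K x).natDegree + g.natDegree := by
    conv_lhs => rw [hg]
    exact natDegree_mul (minpoly.ne_zero hint) hg0
  have hdvd : (minpoly K x).natDegree ∣ 2 := h2 ▸ minpoly.degree_dvd hint
  rcases (Nat.dvd_prime Nat.prime_two).mp hdvd with h | h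
  · obtain ⟨y, rfl⟩ := minpoly.natDegree_eq_one_iff.mp h
    refine ⟨y, (algebraMap K L).injective ?_⟩
    rw [map_zero, ← hx, aeval_algebraMap_apply, coe_aeval_eq_eval]
  · obtain ⟨y, hy⟩ := ih g.natDegree (by omega) g rfl (by
      rw [← hn, hdeg, h] at hodd
      exact (Nat.odd_add'.mp hodd).mpr even_two)
    exact ⟨y, by rw [hg]; exact root_mul_left_of_isRoot _ hy⟩

/-- The data of a quadratic extension `K(i)` all of whose elements are squares, of a field `K` in
which `-1` is not a square. -/
theorem isRealClosed_of_quadratic {K L : Type*} [Field K] [Field L] [Algebra K L]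
    [IsSepClosed L] (h2 : finrank K L = 2) (hsq : ∀ x : L, ∃ y, y ^ 2 = x) (i : L) (hi : i ^ 2 = -1)
    (hiK : i ∉ Set.range (algebraMap K L)) (hchar : (2 : K) ≠ 0) : IsRealClosed K := by
  have : FiniteDimensional K L := FiniteDimensional.of_finrank_pos (by omega)
  have hrep (x : L) : ∃ u v : K, x = algebraMap K L u + algebraMap K L v * i := by
    have hli : LinearIndependent K ![(1 : L), i] := by
      rw [LinearIndependent.pair_iff]
      intro s t hst
      have ht : t = 0 := by
        by_contra ht
        apply hiK
        refine ⟨-s / t, ?_⟩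
        rw [Algebra.smul_def, Algebra.smul_def] at hst
        have : algebraMap K L t ≠ 0 := by simpa using ht
        rw [map_div₀, map_neg]
        field_simp
        linear_combination -hst
      subst ht
      refine ⟨?_, rfl⟩
      simpa using hst
    have hspan := hli.span_eq_top_of_card_eq_finrank' (by simp [h2])
    have hx : x ∈ Submodule.span K (Set.range ![(1 : L), i]) := hspan ▸ Submodule.mem_top
    rw [Matrix.range_cons, Matrix.range_cons, Matrix.range_empty, Set.union_empty,
      Set.singleton_union, Submodule.mem_span_pair] at hx
    obtain ⟨u, v, h⟩ := hx
    exact ⟨u, v, by rw [← h, Algebra.smul_def, Algebra.smul_def, mul_one]⟩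
  have huniq {a b c d : K} (h : algebraMap K L a + algebraMap K L b * i =
      algebraMap K L c + algebraMap K L d * i) : a = c ∧ b = d := by
    have hbd : b = d := by
      by_contra hne
      apply hiK
      refine ⟨(c - a) / (b - d), ?_⟩
      have : algebraMap K L b - algebraMap K L d ≠ 0 := by
        rw [← map_sub]; simpa [sub_eq_zero] using hne
      rw [map_div₀, map_sub, map_sub]
      field_simp
      linear_combination -h
    subst hbd
    exact ⟨(algebraMap K L).injective (by linear_combination h), rfl⟩
  -- Coordinates of a square root `u + vi` of `x + yi`. This one fact shows both that `x ^ 2 + y ^ 2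
  -- = (u ^ 2 + v ^ 2) ^ 2` is a square and, with `y = 0`, that `x` or `-x` is one.
  have hsqrt (x y : K) : ∃ u v : K, x = u ^ 2 - v ^ 2 ∧ y = 2 * u * v := by
    obtain ⟨z, hz⟩ := hsq (algebraMap K L x + algebraMap K L y * i)
    obtain ⟨u, v, rfl⟩ := hrep z
    refine ⟨u, v, ?_⟩
    apply huniq
    rw [← hz]
    push_cast [map_sub, map_mul, map_pow, map_ofNat]
    linear_combination (algebraMap K L v ^ 2) * hi
  have hneg : ¬ IsSquare (-1 : K) := by
    rintro ⟨c, hc⟩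
    have : (i - algebraMap K L c) * (i + algebraMap K L c) = 0 := by
      have h := congrArg (algebraMap K L) hc
      rw [map_neg, map_one, map_mul] at h
      linear_combination hi + h
    rcases mul_eq_zero.mp this with h | h
    · exact hiK ⟨c, by linear_combination -h⟩
    · exact hiK ⟨-c, by rw [map_neg]; linear_combination -h⟩
  have hsum {s : K} (hs : IsSumSq s) : IsSquare s := by
    induction hs with
    | zero => exact IsSquare.zero
    | sq_add a hs ih =>
      obtain ⟨b, rfl⟩ := ih
      obtain ⟨u, v, rfl, rfl⟩ := hsqrt a b
      exact ⟨u ^ 2 + v ^ 2, by ring⟩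
  have hsemi : IsSemireal K := IsSemireal.of_not_isSumSq_neg_one fun h => hneg (hsum h)
  have : PerfectField K := PerfectField.ofCharZero
  have : CharZero L := charZero_of_injective_algebraMap (algebraMap K L).injective
  -- In characteristic zero, separably closed means algebraically closed, as the statement on odd
  -- degrees requires.
  have : PerfectField L := PerfectField.ofCharZero
  exact {
    isSquare_or_isSquare_neg := fun x => by
      obtain ⟨u, v, hx, h0⟩ := hsqrt x 0
      rcases mul_eq_zero.mp h0.symm with h | h
      · have : u = 0 := by simpa [hchar] using h
        exact .inr ⟨v, by rw [hx, this]; ring⟩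
      · exact .inl ⟨u, by rw [hx, h]; ring⟩
    exists_isRoot_of_odd_natDegree := fun {f} hf =>
      exists_isRoot_of_odd_natDegree_of_finrank_eq_two h2 _ f rfl hf }

/-- A field with a nontrivial separably closed finite Galois extension with surjective power maps,
subject to minimality of that extension and surjectivity of Artin–Schreier maps, is real closed. -/
theorem isRealClosed_of_isGalois_isSepClosed {K L : Type u} [Field K] [Field L] [Algebra K L]
    [FiniteDimensional K L] [IsGalois K L] [IsSepClosed L]
    (hns : ¬ Function.Surjective (algebraMap K L))
    (hAS : ∀ p : ℕ, p.Prime → CharP K p → ∀ a : K, ∃ b, b ^ p - b = a)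
    (hclosed : ∀ M : IntermediateField K L, ¬ Function.Surjective (algebraMap K M) → IsSepClosed M)
    (hpow : ∀ m : ℕ, (m : L) ≠ 0 → ∀ a : L, ∃ b, b ^ m = a) : IsRealClosed K := by
  have hL1 : finrank K L ≠ 1 := fun h1 =>
    hns (bijective_algebraMap_of_linearEquiv (LinearEquiv.ofFinrankEq K L (by simp [h1]))).2
  have hcard : Nat.card Gal(L/K) = finrank K L := IsGalois.card_aut_eq_finrank K L
  have hq := Nat.minFac_prime hL1
  set q := (finrank K L).minFac with hqdef
  have : Fact q.Prime := ⟨hq⟩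
  obtain ⟨σ, hσ⟩ := exists_prime_orderOf_dvd_card' (G := Gal(L/K)) q (hcard ▸ Nat.minFac_dvd _)
  -- The fixed field `M` of an element of order `q` must be `K`: otherwise `M` is separably closed
  -- and cannot have the separable extension `L` of degree `q`.
  have hdeg : finrank K L = q := by
    let M := IntermediateField.fixedField (Subgroup.zpowers σ)
    have hM : finrank M L = q := by
      rw [IntermediateField.finrank_fixedField_eq_card, Nat.card_zpowers, hσ]
    have hKM : Function.Surjective (algebraMap K M) := by
      by_contra h
      have : IsSepClosed M := hclosed M h
      have : finrank M L = 1 := by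
        rw [← finrank_self M]
        exact (LinearEquiv.ofBijective (Algebra.linearMap M L)
          ⟨(algebraMap M L).injective, IsSepClosed.algebraMap_surjective M L⟩).finrank_eq.symm
      exact hq.ne_one (hM.symm.trans this)
    have h1 : finrank K M = 1 := by
      rw [← finrank_self K]
      exact (LinearEquiv.ofBijective (Algebra.linearMap K M)
          ⟨(algebraMap K M).injective, hKM⟩).finrank_eq.symm
    rw [← finrank_mul_finrank K M L, h1, hM, one_mul]
  have hqK : (q : K) ≠ 0 := fun h => by
    have : CharP K q := (CharP.charP_iff_prime_eq_zero hq).mpr h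
    exact finrank_ne_of_artinSchreier_surjective q (hAS q hq this) hdeg
  have hqL : (q : L) ≠ 0 := by
    rw [← map_natCast (algebraMap K L)]
    exact (_root_.map_ne_zero _).mpr hqK
  have : NeZero (q : L) := ⟨hqL⟩
  obtain ⟨ζ, hζ⟩ := HasEnoughRootsOfUnity.exists_primitiveRoot L q
  -- The degree of `ζ` over `K` divides the prime `q` and is at most `q - 1`, so it is 1.
  have hζK : (primitiveRoots q K).Nonempty := by
    refine primitiveRoots_nonempty_of_finrank_eq_one hq.pos hζ ?_
    have hint := Algebra.IsIntegral.isIntegral (R := K) ζ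
    rw [← RingHom.coe_range, SetLike.mem_coe, ← minpoly.natDegree_eq_one_iff]
    refine ((Nat.dvd_prime hq).mp (hdeg ▸ minpoly.degree_dvd hint)).resolve_right fun h => ?_
    have hroot : aeval ζ (cyclotomic q K) = 0 := by
      rw [aeval_def, ← Polynomial.eval_map, map_cyclotomic]
      exact hζ.isRoot_cyclotomic hq.pos
    have := natDegree_le_of_dvd (minpoly.dvd K ζ hroot) (cyclotomic_ne_zero q K)
    rw [natDegree_cyclotomic, Nat.totient_prime hq, h] at this
    have := hq.pos
    omega
  have : IsCyclic Gal(L/K) := isCyclic_of_prime_card (hcard.trans hdeg)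
  obtain ⟨α, ⟨a, ha⟩, hα⟩ := exists_root_adjoin_eq_top_of_isCyclic K L (hdeg.symm ▸ hζK)
  have hirr' := irreducible_X_pow_sub_C_of_root_adjoin_eq_top ha.symm hα
  rw [hdeg] at ha hirr'
  have hna := pow_ne_of_irreducible_X_pow_sub_C hirr' dvd_rfl hq.ne_one
  have hmin : minpoly K α = X ^ q - C a := by
    refine (minpoly.eq_of_irreducible_of_monic hirr' ?_ (monic_X_pow_sub_C _ hq.ne_zero)).symm
    simp [ha]
  have hintα := Algebra.IsIntegral.isIntegral (R := K) α
  have h1 : finrank (IntermediateField.adjoin K {α}) L = 1 := by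
    rw [hα, IntermediateField.finrank_top]
  have hnorm : Algebra.norm K α = (-1) ^ q * -a := by
    rw [Algebra.norm_eq_norm_adjoin, h1, pow_one,
      ← IntermediateField.adjoin.powerBasis_gen hintα,
      Algebra.PowerBasis.norm_gen_eq_coeff_zero_minpoly, IntermediateField.adjoin.powerBasis_gen,
      IntermediateField.minpoly_gen, hmin]
    simp [hq.pos.ne, IntermediateField.adjoin.powerBasis_dim, hmin]
  -- The norm of a `q`-th root `β` of `α` satisfies `N(β) ^ q = N(α)`. For odd `q` this makes `a` a
  -- `q`-th power in `K`, a contradiction. For `q = 2` it gives `N(β) ^ 2 = -a`, so that `α / N(β)`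
  -- is a square root of `-1`, not in `K` because `a` is not a square there.
  obtain ⟨β, hβ⟩ := hpow q hqL α
  have hnβ : Algebra.norm K β ^ q = (-1) ^ q * -a := by rw [← map_pow, hβ, hnorm]
  rcases hq.eq_two_or_odd' with h2 | hodd
  · rw [h2] at hnβ hdeg ha hna hqK
    have ha0 : a ≠ 0 := by rintro rfl; exact hna 0 (by simp)
    have hb : algebraMap K L (Algebra.norm K β) ^ 2 = - α ^ 2 := by
      rw [← map_pow, hnβ, ← ha]; simp
    have hα0 : α ≠ 0 := by
      rintro rfl
      apply ha0
      simpa using ha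
    have hb0 : algebraMap K L (Algebra.norm K β) ≠ 0 := by
      intro h0
      rw [h0] at hb
      apply hα0
      simpa using hb.symm
    refine isRealClosed_of_quadratic hdeg (fun x => hpow 2 ?_ x)
      (α / algebraMap K L (Algebra.norm K β)) ?_ ?_ hqK
    · rw [h2] at hqL; exact hqL
    · rw [div_pow, hb, div_neg, div_self (pow_ne_zero 2 hα0)]
    · rintro ⟨c, hc⟩
      rw [eq_div_iff hb0, ← map_mul] at hc
      apply hna (c * Algebra.norm K β)
      apply (algebraMap K L).injective
      rw [ha, ← hc, map_pow]
  · exact absurd (by rw [hnβ, hodd.neg_one_pow]; ring) (hna (Algebra.norm K β))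

/-- A field which is not separably closed, all of whose proper finite extensions have surjective
Kummer and Artin–Schreier maps, is real closed, provided that its own Artin–Schreier map is
surjective. -/
theorem isRealClosed_of_surjective {K : Type u} [Field K] (hK : ¬ IsSepClosed K)
    (hAS : ∀ p : ℕ, p.Prime → CharP K p → ∀ a : K, ∃ b, b ^ p - b = a)
    (hL : ∀ (L : Type u) [Field L] [Algebra K L] [FiniteDimensional K L],
      ¬ Function.Surjective (algebraMap K L) → KummerArtinSchreierSurjective L) :
    IsRealClosed K := by
  have hclosed (L : Type u) [Field L] [Algebra K L] [FiniteDimensional K L]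
      (h : ¬ Function.Surjective (algebraMap K L)) : IsSepClosed L := by
    -- A finite extension of a proper extension of `K` is again a proper finite extension of `K`.
    apply HereditarilySurjective.isSepClosed
    intro E _ _ _
    let : Algebra K E := ((algebraMap L E).comp (algebraMap K L)).toAlgebra
    have : IsScalarTower K L E := .of_algebraMap_eq' rfl
    have : FiniteDimensional K E := FiniteDimensional.trans K L E
    apply hL E
    intro hs
    apply h
    intro x
    obtain ⟨y, hy⟩ := hs (algebraMap L E x)
    exact ⟨y, (algebraMap L E).injective (hy ▸ rfl)⟩
  obtain ⟨f, hf, hirr, hsep, hroot⟩ : ∃ f : K[X], f.Monic ∧ Irreducible f ∧ f.Separable ∧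
      ∀ x, f.eval x ≠ 0 := by
    by_contra! h
    exact hK (IsSepClosed.of_exists_root K h)
  have := Fact.mk hirr
  let L := AdjoinRoot f
  have : FiniteDimensional K L := (AdjoinRoot.powerBasis hirr.ne_zero).finite
  have hns : ¬ Function.Surjective (algebraMap K L) := by
    intro h
    obtain ⟨x, hx⟩ := h (AdjoinRoot.root f)
    apply hroot x
    apply (algebraMap K L).injective
    rw [map_zero, ← AdjoinRoot.eval₂_root f, ← hx, ← Polynomial.eval_map]
    exact (Polynomial.eval_map_apply _ _).symm
  have : IsSepClosed L := hclosed L hns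
  have : Algebra.IsSeparable K L := by
    have hs : (minpoly K (AdjoinRoot.root f)).Separable := by
      rw [AdjoinRoot.minpoly_root hirr.ne_zero, hf.leadingCoeff, inv_one, C_1, mul_one]
      exact hsep
    have h1 : Algebra.IsSeparable K (IntermediateField.adjoin K {AdjoinRoot.root f}) :=
      (IntermediateField.isSeparable_adjoin_simple_iff_isSeparable K L).mpr hs
    rw [show IntermediateField.adjoin K {AdjoinRoot.root f} = ⊤ from
      IntermediateField.adjoin_root_eq_top f] at h1
    exact Algebra.IsSeparable.of_algHom K _ IntermediateField.topEquiv.symm.toAlgHom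
  -- A separable extension which is separably closed is a separable closure, hence normal.
  have : IsSepClosure K L := ⟨inferInstance, inferInstance⟩
  have : IsGalois K L := inferInstance
  exact isRealClosed_of_isGalois_isSepClosed hns hAS (fun M h => hclosed M h) (hL L hns).1

end FieldTheory

/-! ### Real closed fields: finite extensions, the ordering, intermediate values of polynomials. -/

section RealClosed
open Polynomial Module

theorem exists_sq_mem_range_of_finrank_eq_two {K L : Type*} [Field K] [Field L] [Algebra K L]
    (h2 : (2 : K) ≠ 0) (hdeg : finrank K L = 2) :
    ∃ z : L, z ^ 2 ∈ Set.range (algebraMap K L) ∧ z ∉ Set.range (algebraMap K L) := by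
  have : FiniteDimensional K L := FiniteDimensional.of_finrank_pos (by omega)
  obtain ⟨y, hy⟩ : ∃ y : L, y ∉ Set.range (algebraMap K L) := by
    by_contra! h
    have := (LinearEquiv.ofBijective (Algebra.linearMap K L)
      ⟨(algebraMap K L).injective, h⟩).finrank_eq
    rw [finrank_self] at this
    omega
  have hint := Algebra.IsIntegral.isIntegral (R := K) y
  have hd : (minpoly K y).natDegree = 2 :=
    ((Nat.dvd_prime Nat.prime_two).mp (hdeg ▸ minpoly.degree_dvd hint)).resolve_left fun h =>
      hy (minpoly.natDegree_eq_one_iff.mp h)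
  have h0 := minpoly.aeval K y
  have hlead : (minpoly K y).coeff 2 = 1 := by
    rw [← hd]; exact minpoly.monic hint
  rw [aeval_eq_sum_range, hd, Finset.sum_range_succ, Finset.sum_range_succ,
    Finset.sum_range_one, hlead, Algebra.smul_def, Algebra.smul_def, one_smul] at h0
  set c := (minpoly K y).coeff 0
  set b := (minpoly K y).coeff 1
  have h2' : (2 : L) ≠ 0 := by
    rw [← map_ofNat (algebraMap K L)]
    exact (_root_.map_ne_zero _).mpr h2
  refine ⟨y + algebraMap K L (b / 2), ⟨b ^ 2 / 4 - c, ?_⟩, ?_⟩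
  · have h4 : (4 : L) ≠ 0 := by
      rw [show (4 : L) = 2 * 2 by norm_num]
      exact mul_ne_zero h2' h2'
    rw [map_sub, map_div₀, map_div₀, map_pow, map_ofNat, map_ofNat]
    field_simp
    linear_combination (-16) * h0
  · rintro ⟨d, hd⟩
    exact hy ⟨d - b / 2, by rw [map_sub, hd]; ring⟩

/-- A proper finite extension of a real closed field contains a square root of `-1`. -/
theorem exists_sq_eq_neg_one {K F : Type*} [Field K] [IsRealClosed K] [Field F] [Algebra K F]
    [FiniteDimensional K F] (hns : ¬ Function.Surjective (algebraMap K F)) :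
    ∃ i : F, i ^ 2 = -1 := by
  have : PerfectField K := PerfectField.ofCharZero
  let E := IntermediateField.normalClosure K F (AlgebraicClosure F)
  have : IsGalois K E := IsGalois.mk
  have : Fact (Nat.Prime 2) := ⟨Nat.prime_two⟩
  obtain ⟨P⟩ : Nonempty (Sylow 2 Gal(E/K)) := inferInstance
  -- The fixed field of a Sylow 2-subgroup has odd degree; the minimal polynomial of a primitive
  -- element then has a root in `K`, so the degree is 1 and the Galois group is a 2-group.
  have hP : (P : Subgroup Gal(E/K)) = ⊤ := by
    have hodd : Odd (finrank K (IntermediateField.fixedField (P : Subgroup Gal(E/K)))) := by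
      rw [IntermediateField.finrank_eq_fixingSubgroup_index,
        IntermediateField.fixingSubgroup_fixedField, ← Nat.not_even_iff_odd, even_iff_two_dvd]
      exact P.not_dvd_index
    obtain ⟨x, hx⟩ := Field.exists_primitive_element K
      (IntermediateField.fixedField (P : Subgroup Gal(E/K)))
    have hint := Algebra.IsIntegral.isIntegral (R := K) x
    have hdeg : (minpoly K x).natDegree =
        finrank K (IntermediateField.fixedField (P : Subgroup Gal(E/K))) := by
      rw [← IntermediateField.adjoin.finrank hint, hx, IntermediateField.finrank_top']
    obtain ⟨r, hr⟩ := IsRealClosed.exists_isRoot_of_odd_natDegree (hdeg ▸ hodd)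
    have h1 : (minpoly K x).degree = 1 :=
      degree_eq_one_of_irreducible_of_root (minpoly.irreducible hint) hr
    rw [natDegree_eq_of_degree_eq_some h1, IntermediateField.finrank_eq_fixingSubgroup_index,
        IntermediateField.fixingSubgroup_fixedField] at hdeg
    exact Subgroup.index_eq_one.mp hdeg.symm
  have h2 : IsPGroup 2 Gal(E/K) := by
    have := P.isPGroup'
    rw [hP] at this
    exact this.of_equiv Subgroup.topEquiv
  obtain ⟨n, hn⟩ := IsPGroup.iff_card.mp h2
  let F' : IntermediateField K E := (IsScalarTower.toAlgHom K F E).fieldRange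
  let e : F ≃ₐ[K] F' := AlgEquiv.ofInjectiveField (IsScalarTower.toAlgHom K F E)
  have hne : F'.fixingSubgroup ≠ ⊤ := by
    intro h
    apply hns
    have hbot : F' = ⊥ := by
      rw [← IsGalois.fixedField_fixingSubgroup F', h]
      exact IsGalois.fixedField_top
    have h1 : finrank K F = 1 := by
      rw [e.toLinearEquiv.finrank_eq, hbot, IntermediateField.finrank_bot]
    exact (bijective_algebraMap_of_linearEquiv (LinearEquiv.ofFinrankEq K F (by simp [h1]))).2
  obtain ⟨m, hm⟩ := IsPGroup.iff_card.mp (h2.to_subgroup F'.fixingSubgroup)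
  have hmn : m < n := by
    have hle : 2 ^ m ≤ 2 ^ n := hm ▸ hn ▸ Subgroup.card_le_card_group _
    have : m ≤ n := (Nat.pow_le_pow_iff_right one_lt_two).mp hle
    refine lt_of_le_of_ne this fun h => hne ?_
    exact Subgroup.eq_top_of_card_eq _ (by rw [hm, hn, h])
  obtain ⟨k, rfl⟩ : ∃ k, n = k + 1 := ⟨n - 1, by omega⟩
  -- In a 2-group a proper subgroup lies in one of index 2. Its fixed field is a quadratic extension
  -- of `K` inside the image of `F`, generated by a square root of some `a = -b ^ 2`, so it contains
  -- a square root of `-1`.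
  obtain ⟨M, hM, hFM⟩ := Sylow.exists_subgroup_card_pow_prime_le 2
    (n := m) (m := k) (hn ▸ pow_dvd_pow 2 (Nat.le_succ k)) F'.fixingSubgroup hm (by omega)
  have hdeg : finrank K (IntermediateField.fixedField M) = 2 := by
    rw [IntermediateField.finrank_eq_fixingSubgroup_index,
        IntermediateField.fixingSubgroup_fixedField]
    have := M.card_mul_index
    rw [hM, hn, pow_succ] at this
    exact Nat.eq_of_mul_eq_mul_left (by positivity) this
  have hle : IntermediateField.fixedField M ≤ F' := by
    rw [← IsGalois.fixedField_fixingSubgroup F']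
    exact IntermediateField.fixedField_antitone hFM
  have : Algebra.IsQuadraticExtension K (IntermediateField.fixedField M) := ⟨hdeg⟩
  obtain ⟨z, ⟨a, ha⟩, hz⟩ : ∃ z : IntermediateField.fixedField M, z ^ 2 ∈ Set.range (algebraMap K _) ∧
      z ∉ Set.range (algebraMap K _) := by
    exact exists_sq_mem_range_of_finrank_eq_two two_ne_zero hdeg
  have ha' : ¬ IsSquare a := by
    rintro ⟨c, rfl⟩
    have : (z - algebraMap K _ c) * (z + algebraMap K _ c) = 0 := by
      rw [map_mul] at ha
      linear_combination -ha
    rcases mul_eq_zero.mp this with h | h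
    · exact hz ⟨c, by linear_combination -h⟩
    · exact hz ⟨-c, by rw [map_neg]; linear_combination -h⟩
  obtain ⟨b, hb⟩ := IsRealClosed.isSquare_neg_of_not_isSquare ha'
  have hb0 : b ≠ 0 := by
    rintro rfl
    apply ha'
    rw [mul_zero, neg_eq_zero] at hb
    exact hb ▸ IsSquare.zero
  have hbM : algebraMap K (IntermediateField.fixedField M) b ≠ 0 := (_root_.map_ne_zero _).mpr hb0
  have hz2 : z ^ 2 = -(algebraMap K (IntermediateField.fixedField M) b) ^ 2 := by
    rw [← ha, ← map_pow, ← map_neg]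
    congr 1
    linear_combination -hb
  have hw : (z / algebraMap K (IntermediateField.fixedField M) b) ^ 2 = -1 := by
    rw [div_pow, hz2, neg_div, div_self (pow_ne_zero 2 hbM)]
  refine ⟨e.symm (IntermediateField.inclusion hle (z / algebraMap K _ b)), ?_⟩
  rw [← map_pow, ← map_pow, hw, map_neg, map_neg, map_one, map_one]

/-- Otherwise `-(x + y) = z ^ 2` with `z ≠ 0`, and dividing by `z ^ 2` writes `-1` as a sum of
squares. -/
theorem isSquare_add_of_isRealClosed {K : Type*} [Field K] [IsRealClosed K] {x y : K}
    (hx : IsSquare x) (hy : IsSquare y) : IsSquare (x + y) := by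
  by_contra h
  obtain ⟨z, hz⟩ := IsRealClosed.isSquare_neg_of_not_isSquare h
  have hz0 : z ≠ 0 := by
    rintro rfl
    rw [mul_zero, neg_eq_zero] at hz
    exact h (hz ▸ IsSquare.zero)
  obtain ⟨a, rfl⟩ := hx
  obtain ⟨b, rfl⟩ := hy
  refine IsSemireal.one_add_ne_zero (R := K)
    (.sq_add (a / z) (.sq_add (b / z) .zero)) ?_
  field_simp
  linear_combination -hz

/-- A real closed field carries an ordering compatible with its field structure. -/
theorem exists_linearOrder_of_isRealClosed (K : Type*) [Field K] [IsRealClosed K] :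
    ∃ _ : LinearOrder K, IsStrictOrderedRing K := by
  classical
  have hanti {x : K} (hx : IsSquare x) (hnx : IsSquare (-x)) : x = 0 := by
    obtain ⟨a, rfl⟩ := hx
    obtain ⟨b, hb⟩ := hnx
    by_contra ha
    have ha0 : a ≠ 0 := by rintro rfl; simp at ha
    refine IsSemireal.one_add_ne_zero (R := K) (.sq_add (b / a) .zero) ?_
    field_simp
    linear_combination -hb
  let o : LinearOrder K :=
    { le := fun a b => IsSquare (b - a)
      le_refl := fun a => by rw [sub_self]; exact IsSquare.zero
      le_trans := fun a b c hab hbc => by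
        have := isSquare_add_of_isRealClosed hab hbc
        rwa [sub_add_sub_comm, add_comm b c, add_sub_add_right_eq_sub] at this
      le_antisymm := fun a b hab hba => by
        rw [← neg_sub] at hba
        exact (sub_eq_zero.mp (hanti hab hba)).symm
      le_total := fun a b => by
        have := IsRealClosed.isSquare_or_isSquare_neg (b - a)
        rwa [neg_sub] at this
      toDecidableLE := Classical.decRel _ }
  refine ⟨o, ?_⟩
  have hle (a b : K) : a ≤ b ↔ IsSquare (b - a) := Iff.rfl
  have : IsOrderedAddMonoid K :=
    { add_le_add_left := fun a b h c => by
        rw [hle] at h ⊢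
        rwa [add_sub_add_right_eq_sub] }
  have : ZeroLEOneClass K := ⟨by rw [hle, sub_zero]; exact IsSquare.one⟩
  refine IsStrictOrderedRing.of_mul_pos fun a b ha hb => lt_of_le_of_ne ?_ ?_
  · have ha' := ha.le
    have hb' := hb.le
    rw [hle, sub_zero] at ha' hb' ⊢
    exact ha'.mul hb'
  · exact (mul_ne_zero ha.ne' hb.ne').symm

/-- The intermediate value property for polynomials over an ordered field. -/
def PolynomialIVT (K : Type*) [Field K] [LinearOrder K] : Prop :=
  ∀ (p : K[X]) (a b : K), a < b → p.eval a * p.eval b < 0 → ∃ r, a < r ∧ r < b ∧ p.eval r = 0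

/-- Strong induction on the degree. If `p` is reducible, one factor changes sign. If `p` is
irreducible of degree at least 2, then `-1` is a square modulo `p`, so `h ^ 2 + 1 = p s` with `s` of
smaller degree; `s` has the sign of `p` wherever evaluated, hence changes sign too, and a root of
`s` would give `h ^ 2 + 1 = 0`, which is absurd. Only linear `p` contributes a root directly. -/
theorem polynomialIVT_of_isRealClosed (K : Type*) [Field K] [IsRealClosed K] [LinearOrder K]
    [IsStrictOrderedRing K] : PolynomialIVT K := by
  intro p a b hab
  induction hn : p.natDegree using Nat.strong_induction_on generalizing p with
  | _ n ih =>
  intro hp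
  have hunit : ¬ IsUnit p := by
    intro hu
    obtain ⟨c, -, rfl⟩ := Polynomial.isUnit_iff.mp hu
    simp only [eval_C] at hp
    exact absurd hp (not_lt.mpr (mul_self_nonneg c))
  have hp0 : p ≠ 0 := by rintro rfl; simp at hp
  by_cases hirr : Irreducible p
  · by_cases h1 : p.natDegree = 1
    · obtain ⟨c, hc, d, rfl⟩ := natDegree_eq_one.mp h1
      have hroot : eval (-d / c) (C c * X + C d) = 0 := by simp; field_simp; ring
      simp only [eval_add, eval_mul, eval_C, eval_X] at hp
      have hkey : (c * c) * ((a - -d / c) * (b - -d / c)) < 0 := by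
        convert hp using 1
        field_simp
        ring
      have hcc : 0 < c * c := mul_self_pos.mpr hc
      have hneg := neg_of_mul_neg_right hkey hcc.le
      rcases mul_neg_iff.mp hneg with ⟨h2, h3⟩ | ⟨h2, h3⟩
      · linarith
      · exact ⟨-d / c, by linarith, by linarith, hroot⟩
    · have := Fact.mk hirr
      have hpos : 0 < p.natDegree := hirr.natDegree_pos
      have : FiniteDimensional K (AdjoinRoot p) := (AdjoinRoot.powerBasis hp0).finite
      obtain ⟨i, hi⟩ := exists_sq_eq_neg_one (K := K) (F := AdjoinRoot p) (by
        intro hs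
        have hd := (AdjoinRoot.powerBasis hp0).finrank
        rw [AdjoinRoot.powerBasis_dim] at hd
        have : finrank K (AdjoinRoot p) = 1 := by
          rw [← finrank_self K]
          exact (LinearEquiv.ofBijective (Algebra.linearMap K (AdjoinRoot p))
            ⟨(algebraMap K (AdjoinRoot p)).injective, hs⟩).finrank_eq.symm
        omega)
      obtain ⟨h', rfl⟩ := AdjoinRoot.mk_surjective i
      obtain ⟨h, hh⟩ : ∃ h, h = h' % p := ⟨_, rfl⟩
      have hdvd : p ∣ h ^ 2 + 1 := by
        rw [← AdjoinRoot.mk_eq_zero, map_add, map_pow, map_one, hh, EuclideanDomain.mod_eq_sub_mul_div,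
          map_sub, map_mul, AdjoinRoot.mk_self, zero_mul, sub_zero, hi, neg_add_cancel]
      obtain ⟨s, hs⟩ := hdvd
      have hev (x : K) : p.eval x * s.eval x = h.eval x ^ 2 + 1 := by
        rw [← eval_mul, ← hs]; simp
      have hs0 : s ≠ 0 := by
        rintro rfl
        have := hev a
        simp only [eval_zero, mul_zero] at this
        nlinarith [sq_nonneg (h.eval a)]
      have hdegh : h.natDegree < p.natDegree := hh ▸ natDegree_mod_lt h' hpos.ne'
      -- Since `deg h < deg p`, the product `p s = h ^ 2 + 1` has degree less than `2 deg p`.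
      have hdegs : s.natDegree < n := by
        have h2 : (p * s).natDegree ≤ 2 * h.natDegree := by
          rw [← hs]
          refine (natDegree_add_le _ _).trans (max_le natDegree_pow_le ?_)
          simp
        rw [natDegree_mul hp0 hs0] at h2
        omega
      have hs_neg : s.eval a * s.eval b < 0 := by
        have h3 : 0 < (p.eval a * p.eval b) * (s.eval a * s.eval b) := by
          have := mul_pos (show 0 < p.eval a * s.eval a by rw [hev]; positivity)
            (show 0 < p.eval b * s.eval b by rw [hev]; positivity)
          convert this using 1
          ring
        exact neg_of_mul_pos_right h3 hp.le
      obtain ⟨r, -, -, hr⟩ := ih _ hdegs s rfl hs_neg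
      have := hev r
      rw [hr, mul_zero] at this
      nlinarith [sq_nonneg (h.eval r)]
  · obtain ⟨u, v, hu, hv, rfl⟩ : ∃ u v, ¬ IsUnit u ∧ ¬ IsUnit v ∧ p = u * v := by
      by_contra! hcon
      refine hirr ⟨hunit, fun u v huv => ?_⟩
      by_contra! h
      exact hcon u v h.1 h.2 huv
    have hu0 := left_ne_zero_of_mul hp0
    have hv0 := right_ne_zero_of_mul hp0
    have hdu : 0 < u.natDegree := Nat.pos_of_ne_zero fun h => hu
      (isUnit_iff_degree_eq_zero.mpr (by rw [degree_eq_natDegree hu0, h]; rfl))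
    have hdv : 0 < v.natDegree := Nat.pos_of_ne_zero fun h => hv
      (isUnit_iff_degree_eq_zero.mpr (by rw [degree_eq_natDegree hv0, h]; rfl))
    rw [natDegree_mul hu0 hv0] at hn
    rw [eval_mul, eval_mul, mul_mul_mul_comm] at hp
    rcases mul_neg_iff.mp hp with ⟨-, h⟩ | ⟨h, -⟩
    · obtain ⟨r, h1, h2, h3⟩ := ih _ (by omega) v rfl h
      exact ⟨r, h1, h2, by rw [eval_mul, h3, mul_zero]⟩
    · obtain ⟨r, h1, h2, h3⟩ := ih _ (by omega) u rfl h
      exact ⟨r, h1, h2, by rw [eval_mul, h3, zero_mul]⟩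

end RealClosed

/-! ### Rational points of a finite algebra and the signature of its trace form (Hermite). -/

section Signature
open Module

section Inertia

variable {K : Type*} [Field K] [LinearOrder K] [IsStrictOrderedRing K] {ι : Type*} [Fintype ι]

/-- A space mapping to a diagonal quadratic space so that the pulled back form is positive definite
has dimension at most the number of positive diagonal entries. -/
theorem finrank_le_card_pos {W : Type*} [AddCommGroup W] [Module K W] (d : ι → K)
    (φ : W →ₗ[K] (ι → K)) (h : ∀ w ≠ 0, 0 < ∑ i, d i * φ w i ^ 2) :
    finrank K W ≤ Fintype.card {i // 0 < d i} := by
  let ψ : W →ₗ[K] ({i // 0 < d i} → K) := LinearMap.funLeft K K Subtype.val ∘ₗ φ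
  have hψ : Function.Injective ψ := by
    rw [injective_iff_map_eq_zero]
    intro w hw
    by_contra hw0
    refine absurd (h w hw0) (not_lt.mpr (Finset.sum_nonpos fun i _ => ?_))
    by_cases hi : 0 < d i
    · have : φ w i = 0 := congrFun hw ⟨i, hi⟩
      rw [this]; simp
    · exact mul_nonpos_of_nonpos_of_nonneg (not_lt.mp hi) (sq_nonneg _)
  simpa using LinearMap.finrank_le_finrank_of_injective hψ

open Classical in
/-- Extension by zero of a function on a subtype. -/
noncomputable def extendZero (K : Type*) [Field K] (P : ι → Prop) : ({i // P i} → K) →ₗ[K] (ι → K) :=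
  LinearMap.pi fun i => if h : P i then LinearMap.proj ⟨i, h⟩ else 0

theorem sum_extendZero_pos {P : ι → Prop} (d : ι → K) (hd : ∀ i, P i → 0 < d i)
    (w : {i // P i} → K) (hw : w ≠ 0) : 0 < ∑ i, d i * extendZero K P w i ^ 2 := by
  obtain ⟨⟨i, hi⟩, hwi⟩ : ∃ i, w i ≠ 0 := by
    by_contra! h
    exact hw (funext h)
  refine Finset.sum_pos' (fun j _ => ?_) ⟨i, Finset.mem_univ i, ?_⟩
  · by_cases hj : P j
    · exact mul_nonneg (hd j hj).le (sq_nonneg _)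
    · simp [extendZero, hj]
  · have : extendZero K P w i = w ⟨i, hi⟩ := by simp [extendZero, hi]
    rw [this]
    exact mul_pos (hd i hi) (by positivity)

end Inertia

variable {K A : Type*} [Field K] [CommRing A] [Algebra K A] [Module.Finite K A]

theorem isNilpotent_of_forall_mem_maximal {A : Type*} [CommRing A] [IsArtinianRing A] {x : A}
    (h : ∀ m : MaximalSpectrum A, x ∈ m.asIdeal) : IsNilpotent x := by
  rw [nilpotent_iff_mem_prime]
  intro p hp
  have : p.IsMaximal := inferInstance
  exact h ⟨p, this⟩

/-- An element of all maximal ideals of a finite algebra is nilpotent, so its trace is nilpotent in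
a field, hence zero. Trace identities can thus be checked at each maximal ideal separately. -/
theorem trace_eq_of_forall_sub_mem_maximal {x y : A}
    (h : ∀ m : MaximalSpectrum A, x - y ∈ m.asIdeal) :
    Algebra.trace K A x = Algebra.trace K A y := by
  have : IsArtinianRing A := .of_finite K A
  have := Algebra.isNilpotent_trace_of_isNilpotent (R := K) (isNilpotent_of_forall_mem_maximal h)
  rw [map_sub] at this
  exact sub_eq_zero.mp this.eq_zero

theorem exists_forall_sub_mem_maximal (K : Type*) {A : Type*} [Field K] [CommRing A] [Algebra K A]
    [Module.Finite K A] (x : MaximalSpectrum A → A) :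
    ∃ y : A, ∀ m : MaximalSpectrum A, y - x m ∈ m.asIdeal := by
  have : IsArtinianRing A := .of_finite K A
  have : Finite (MaximalSpectrum A) := inferInstance
  obtain ⟨y, hy⟩ := Ideal.pi_quotient_surjective (I := fun m : MaximalSpectrum A => m.asIdeal)
    (fun m n hmn => Ideal.isCoprime_of_isMaximal fun h => hmn (MaximalSpectrum.ext h))
    (fun m => Ideal.Quotient.mk _ (x m))
  exact ⟨y, fun m => Ideal.Quotient.eq.mp (hy m)⟩

/-- The Chinese remainder theorem gives an element idempotent modulo the nilradical, and idempotents
lift along nil ideals. -/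
theorem exists_idempotent_at_maximal (K : Type*) {A : Type*} [Field K] [CommRing A] [Algebra K A]
    [Module.Finite K A] (m : MaximalSpectrum A) :
    ∃ e : A, IsIdempotentElem e ∧ e - 1 ∈ m.asIdeal ∧
      ∀ n : MaximalSpectrum A, n ≠ m → e ∈ n.asIdeal := by
  classical
  obtain ⟨y, hy⟩ := exists_forall_sub_mem_maximal K (A := A) fun n => if n = m then 1 else 0
  have hnil : IsNilpotent (y * y - y) := by
    have : IsArtinianRing A := .of_finite K A
    apply isNilpotent_of_forall_mem_maximal
    intro n
    have h := hy n
    split_ifs at h with hn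
    · rw [show y * y - y = y * (y - 1) by ring]
      exact Ideal.mul_mem_left _ _ h
    · rw [show y * y - y = (y - 1) * (y - 0) by ring]
      exact Ideal.mul_mem_left _ _ h
  obtain ⟨e, he, hey⟩ := exists_isIdempotentElem_eq_of_ker_isNilpotent
    (Ideal.Quotient.mk (nilradical A)) (fun x hx => by rwa [Ideal.mk_ker] at hx)
    (Ideal.Quotient.mk _ y) ⟨y, rfl⟩ (by
      rw [IsIdempotentElem, ← map_mul, Ideal.Quotient.eq]
      exact hnil)
  rw [Ideal.Quotient.eq] at hey
  have hmem (n : MaximalSpectrum A) : e - y ∈ n.asIdeal :=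
    nilradical_le_prime n.asIdeal hey
  refine ⟨e, he, ?_, fun n hn => ?_⟩
  · have := hy m
    rw [if_pos rfl] at this
    simpa using Ideal.add_mem _ (hmem m) this
  · have := hy n
    rw [if_neg hn] at this
    simpa using Ideal.add_mem _ (hmem n) this

/-- The trace of a projection is its rank, and an ordered field has characteristic zero. -/
theorem trace_idempotent_pos [LinearOrder K] [IsStrictOrderedRing K] {e : A}
    (he : IsIdempotentElem e) (he0 : e ≠ 0) : 0 < Algebra.trace K A e := by
  have hproj : IsIdempotentElem (LinearMap.mulLeft K e) := by
    ext x
    simp [← mul_assoc, he.eq]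
  rw [Algebra.trace_apply]
  have h1 : LinearMap.trace K A (LinearMap.mulLeft K e) =
      (finrank K (LinearMap.range (LinearMap.mulLeft K e)) : K) :=
    LinearMap.IsProj.trace (LinearMap.IsIdempotentElem.isProj_range _ hproj)
  change 0 < LinearMap.trace K A (LinearMap.mulLeft K e)
  rw [h1, Nat.cast_pos, finrank_pos_iff, Submodule.nontrivial_iff_ne_bot, Ne, LinearMap.range_eq_bot]
  intro h
  apply he0
  simpa using LinearMap.congr_fun h 1

/-- A maximal ideal with residue field `K`. -/
def IsRationalIdeal (K : Type*) {A : Type*} [Field K] [CommRing A] [Algebra K A]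
    (m : MaximalSpectrum A) : Prop :=
  ∀ x : A, ∃ c : K, x - algebraMap K A c ∈ m.asIdeal

theorem exists_algHom_of_isRationalIdeal {K A : Type*} [Field K] [CommRing A] [Algebra K A]
    {m : MaximalSpectrum A} (hm : IsRationalIdeal K m) :
    ∃ φ : A →ₐ[K] K, ∀ x, φ x = 0 → x ∈ m.asIdeal := by
  have hbij : Function.Bijective (algebraMap K (A ⧸ m.asIdeal)) := by
    have := m.isMaximal
    refine ⟨(algebraMap K (A ⧸ m.asIdeal)).injective, fun y => ?_⟩
    obtain ⟨x, rfl⟩ := Ideal.Quotient.mk_surjective y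
    obtain ⟨c, hc⟩ := hm x
    exact ⟨c, (Ideal.Quotient.eq.mpr hc).symm⟩
  let e : K ≃ₐ[K] (A ⧸ m.asIdeal) := AlgEquiv.ofBijective (Algebra.ofId K _) hbij
  refine ⟨e.symm.toAlgHom.comp (Ideal.Quotient.mkₐ K m.asIdeal), fun x hx => ?_⟩
  have : e.symm (Ideal.Quotient.mk m.asIdeal x) = 0 := hx
  rw [EmbeddingLike.map_eq_zero_iff] at this
  exact Ideal.Quotient.eq_zero_iff_mem.mp this

/-- The residue field at `m` is a proper finite extension of the real closed field `K`. -/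
theorem exists_sq_add_one_mem [IsRealClosed K] {m : MaximalSpectrum A}
    (hm : ¬ IsRationalIdeal K m) : ∃ t : A, t ^ 2 + 1 ∈ m.asIdeal := by
  have := m.isMaximal
  let := Ideal.Quotient.field m.asIdeal
  obtain ⟨i, hi⟩ := exists_sq_eq_neg_one (K := K) (F := A ⧸ m.asIdeal) (by
    intro h
    apply hm
    intro x
    obtain ⟨c, hc⟩ := h (Ideal.Quotient.mk _ x)
    exact ⟨c, Ideal.Quotient.eq.mp hc.symm⟩)
  obtain ⟨t, rfl⟩ := Ideal.Quotient.mk_surjective i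
  refine ⟨t, Ideal.Quotient.eq_zero_iff_mem.mp ?_⟩
  rw [map_add, map_pow, hi, map_one, neg_add_cancel]

/-- An element acting as a square root of `1` at the rational and of `-1` at the other maximal
ideals. -/
theorem exists_sq_sub_mem (K : Type*) {A : Type*} [Field K] [IsRealClosed K] [CommRing A]
    [Algebra K A] [Module.Finite K A] : ∃ t : A, ∀ m : MaximalSpectrum A,
      (IsRationalIdeal K m → t ^ 2 - 1 ∈ m.asIdeal) ∧
      (¬ IsRationalIdeal K m → t ^ 2 + 1 ∈ m.asIdeal) := by
  classical
  have h (m : MaximalSpectrum A) : ∃ t : A, (IsRationalIdeal K m → t = 1) ∧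
      (¬ IsRationalIdeal K m → t ^ 2 + 1 ∈ m.asIdeal) := by
    by_cases hm : IsRationalIdeal K m
    · exact ⟨1, fun _ => rfl, fun h => absurd hm h⟩
    · obtain ⟨t, ht⟩ := exists_sq_add_one_mem hm
      exact ⟨t, fun h => absurd h hm, fun _ => ht⟩
  choose s hs1 hs2 using h
  obtain ⟨t, ht⟩ := exists_forall_sub_mem_maximal K s
  refine ⟨t, fun m => ⟨fun hm => ?_, fun hm => ?_⟩⟩
  · have := ht m
    rw [hs1 m hm] at this
    rw [show t ^ 2 - 1 = (t + 1) * (t - 1) by ring]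
    exact Ideal.mul_mem_left _ _ this
  · rw [show t ^ 2 + 1 = (t + s m) * (t - s m) + (s m ^ 2 + 1) by ring]
    exact Ideal.add_mem _ (Ideal.mul_mem_left _ _ (ht m)) (hs2 m hm)

/-- At every maximal ideal `e * x ^ 2` agrees with `c ^ 2 * e`, where `c` is the value of `x` at
`m`, so the trace is `c ^ 2` times a positive number. -/
theorem trace_idempotent_mul_sq [LinearOrder K] [IsStrictOrderedRing K] {m : MaximalSpectrum A}
    (hm : IsRationalIdeal K m) {e : A} (he : IsIdempotentElem e) (he1 : e - 1 ∈ m.asIdeal)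
    (hen : ∀ n : MaximalSpectrum A, n ≠ m → e ∈ n.asIdeal) (x : A) :
    0 ≤ Algebra.trace K A (e * x ^ 2) ∧
      (x ∉ m.asIdeal → 0 < Algebra.trace K A (e * x ^ 2)) := by
  obtain ⟨c, hc⟩ := hm x
  have htr : Algebra.trace K A (e * x ^ 2) = c ^ 2 * Algebra.trace K A e := by
    rw [← smul_eq_mul (c ^ 2), ← map_smul]
    apply trace_eq_of_forall_sub_mem_maximal
    intro n
    rw [Algebra.smul_def, map_pow]
    by_cases hn : n = m
    · subst hn
      rw [show e * x ^ 2 - algebraMap K A c ^ 2 * e =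
        (e * (x + algebraMap K A c)) * (x - algebraMap K A c) by ring]
      exact Ideal.mul_mem_left _ _ hc
    · rw [show e * x ^ 2 - algebraMap K A c ^ 2 * e = (x ^ 2 - algebraMap K A c ^ 2) * e by ring]
      exact Ideal.mul_mem_left _ _ (hen n hn)
  have he0 : e ≠ 0 := by
    rintro rfl
    rw [zero_sub, neg_mem_iff] at he1
    exact m.isMaximal.ne_top ((Ideal.eq_top_iff_one _).mpr he1)
  have hpos := trace_idempotent_pos (K := K) he he0
  rw [htr]
  refine ⟨mul_nonneg (sq_nonneg c) hpos.le, fun hx => mul_pos (sq_pos_of_ne_zero ?_) hpos⟩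
  rintro rfl
  rw [map_zero, sub_zero] at hc
  exact hx hc

/-- An element which is `1` at the rational and `0` at the other maximal ideals, with respect to
which the trace form is positive. -/
theorem exists_rational_idempotent (K : Type*) {A : Type*} [Field K] [LinearOrder K]
    [IsStrictOrderedRing K] [CommRing A] [Algebra K A] [Module.Finite K A] :
    ∃ e : A, (∀ m : MaximalSpectrum A, (IsRationalIdeal K m → e - 1 ∈ m.asIdeal) ∧
      (¬ IsRationalIdeal K m → e ∈ m.asIdeal)) ∧
      (∀ x : A, 0 ≤ Algebra.trace K A (e * x ^ 2)) ∧
      ∀ (m : MaximalSpectrum A) (x : A), IsRationalIdeal K m → x ∉ m.asIdeal →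
        0 < Algebra.trace K A (e * x ^ 2) := by
  classical
  have : IsArtinianRing A := .of_finite K A
  have := Fintype.ofFinite (MaximalSpectrum A)
  choose e he he1 hen using fun m : MaximalSpectrum A => exists_idempotent_at_maximal K m
  let S : Finset (MaximalSpectrum A) := Finset.univ.filter (IsRationalIdeal K)
  have htr (x : A) : Algebra.trace K A ((∑ m ∈ S, e m) * x ^ 2) =
      ∑ m ∈ S, Algebra.trace K A (e m * x ^ 2) := by
    rw [Finset.sum_mul, map_sum]
  have hnonneg (x : A) (m : MaximalSpectrum A) (hm : m ∈ S) :
      0 ≤ Algebra.trace K A (e m * x ^ 2) :=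
    (trace_idempotent_mul_sq (Finset.mem_filter.mp hm).2 (he m) (he1 m) (hen m) x).1
  refine ⟨∑ m ∈ S, e m, fun m => ⟨fun hm => ?_, fun hm => ?_⟩, fun x => ?_, fun m x hm hx => ?_⟩
  · have hmS : m ∈ S := Finset.mem_filter.mpr ⟨Finset.mem_univ m, hm⟩
    rw [← Finset.add_sum_erase S e hmS, add_sub_right_comm]
    refine Ideal.add_mem _ (he1 m) (Ideal.sum_mem _ fun n hn => hen n m ?_)
    exact (Finset.ne_of_mem_erase hn).symm
  · refine Ideal.sum_mem _ fun n hn => hen n m ?_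
    rintro rfl
    exact hm (Finset.mem_filter.mp hn).2
  · rw [htr]
    exact Finset.sum_nonneg (hnonneg x)
  · have hmS : m ∈ S := Finset.mem_filter.mpr ⟨Finset.mem_univ m, hm⟩
    rw [htr]
    exact Finset.sum_pos' (hnonneg x)
      ⟨m, hmS, (trace_idempotent_mul_sq hm (he m) (he1 m) (hen m) x).2 hx⟩

theorem isRationalIdeal_ker {K A : Type*} [Field K] [CommRing A] [Algebra K A] (φ : A →ₐ[K] K) :
    ∃ m : MaximalSpectrum A, IsRationalIdeal K m ∧ ∀ x, x ∈ m.asIdeal ↔ φ x = 0 := by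
  refine ⟨⟨RingHom.ker φ, RingHom.ker_isMaximal_of_surjective φ fun c => ⟨algebraMap K A c, by simp⟩⟩,
    fun x => ⟨φ x, ?_⟩, fun x => RingHom.mem_ker⟩
  rw [RingHom.mem_ker]
  simp

/-- A finite algebra `A` over a real closed field has a rational point at which `g` does not vanish
iff the trace form `Tr (g² u v)` has positive signature. -/
theorem exists_algHom_iff_card_lt_card [IsRealClosed K] [LinearOrder K] [IsStrictOrderedRing K]
    {ι : Type*} [Fintype ι] (g : A) (d : ι → K) (E : (ι → K) ≃ₗ[K] A)
    (h : ∀ x, Algebra.trace K A (g ^ 2 * E x ^ 2) = ∑ i, d i * x i ^ 2) :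
    (∃ φ : A →ₐ[K] K, φ g ≠ 0) ↔
      Fintype.card {i // d i < 0} < Fintype.card {i // 0 < d i} := by
  have hE (x : A) : ∑ i, d i * E.symm x i ^ 2 = Algebra.trace K A (g ^ 2 * x ^ 2) := by
    rw [← h, E.apply_symm_apply]
  -- Multiplication by `t` changes the sign of the trace form on the non-rational part of `A` and
  -- preserves it on the rational part, so only rational points contribute to the signature.
  obtain ⟨t, ht⟩ := exists_sq_sub_mem K (A := A)
  constructor
  · rintro ⟨φ, hφ⟩
    obtain ⟨m, hm, hmφ⟩ := isRationalIdeal_ker φ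
    obtain ⟨e, he, hnonneg, hpos⟩ := exists_rational_idempotent K (A := A)
    -- A positive definite space one dimension larger than the negative one: `t * (1 - e)` turns
    -- negative vectors into positive ones, up to the nonnegative rational contribution, and the
    -- line through `e` is the extra dimension supplied by the point `φ`.
    let ψ : (({i // d i < 0} → K) × K) →ₗ[K] (ι → K) :=
      E.symm.toLinearMap ∘ₗ
        (LinearMap.mulLeft K (t * (1 - e)) ∘ₗ E.toLinearMap ∘ₗ extendZero K (fun i => d i < 0) ∘ₗ
          LinearMap.fst K _ _ + LinearMap.toSpanSingleton K A e ∘ₗ LinearMap.snd K _ _)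
    have hψ : ∀ w ≠ 0, 0 < ∑ i, d i * ψ w i ^ 2 := by
      rintro ⟨u, k⟩ hw
      set v := E (extendZero K (fun i => d i < 0) u) with hv
      have hψw : ψ (u, k) = E.symm (t * (1 - e) * v + k • e) := rfl
      rw [hψw, hE]
      have key : Algebra.trace K A (g ^ 2 * (t * (1 - e) * v + k • e) ^ 2) =
          Algebra.trace K A (e * (g * v) ^ 2) - Algebra.trace K A (g ^ 2 * v ^ 2) +
            k ^ 2 * Algebra.trace K A (e * g ^ 2) := by
        rw [← smul_eq_mul (k ^ 2), ← map_smul, ← map_sub, ← map_add]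
        apply trace_eq_of_forall_sub_mem_maximal
        intro n
        rw [Algebra.smul_def, Algebra.smul_def, map_pow]
        set a := algebraMap K A k
        by_cases hn : IsRationalIdeal K n
        · have h1 := (he n).1 hn
          convert Ideal.mul_mem_left _ (g ^ 2 * ((t ^ 2 * v ^ 2) * (e - 1) - 2 * (t * v * a * e)
            + a ^ 2 * e - v ^ 2)) h1 using 1
          ring
        · have h1 := (he n).2 hn
          have h2 := (ht n).2 hn
          convert Ideal.add_mem _ (Ideal.mul_mem_left _ (g ^ 2 * v ^ 2) h2)
            (Ideal.mul_mem_left _ (g ^ 2 * (t ^ 2 * v ^ 2 * (e - 2) + 2 * (t * (1 - e) * v * a)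
              + a ^ 2 * e - v ^ 2 - a ^ 2)) h1) using 1
          ring
      rw [key]
      have h1 := hnonneg (g * v)
      have h2 := hpos m g hm (fun hg => hφ ((hmφ g).mp hg))
      have h3 : Algebra.trace K A (g ^ 2 * v ^ 2) = ∑ i, d i * extendZero K (fun i => d i < 0) u i ^ 2 := h _
      by_cases hu : u = 0
      · have hk : k ≠ 0 := by
          rintro rfl
          exact hw (by rw [hu]; rfl)
        have hv0 : v = 0 := by rw [hv, hu, map_zero, map_zero]
        rw [hv0]
        have := mul_pos (sq_pos_of_ne_zero hk) h2
        simpa using this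
      · have h4 := sum_extendZero_pos (fun i => - d i) (P := fun i => d i < 0)
          (fun i hi => neg_pos.mpr hi) u hu
        simp only [neg_mul, Finset.sum_neg_distrib] at h4
        have h5 := mul_nonneg (sq_nonneg k) h2.le
        linarith
    have := finrank_le_card_pos d ψ hψ
    rw [finrank_prod, finrank_self, finrank_fintype_fun_eq_card] at this
    omega
  · intro hlt
    by_contra! hφ
    refine absurd hlt (not_lt.mpr ?_)
    -- If `g` vanishes at all rational points, multiplication by `t` negates the whole form, so the
    -- positive index is at most the negative one.
    let ψ : ({i // 0 < d i} → K) →ₗ[K] (ι → K) :=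
      E.symm.toLinearMap ∘ₗ LinearMap.mulLeft K t ∘ₗ E.toLinearMap ∘ₗ extendZero K (fun i => 0 < d i)
    have hψ : ∀ w ≠ 0, 0 < ∑ i, (- d i) * ψ w i ^ 2 := by
      intro w hw
      set v := E (extendZero K (fun i => 0 < d i) w) with hv
      have hψw : ψ w = E.symm (t * v) := rfl
      simp only [neg_mul, Finset.sum_neg_distrib]
      rw [hψw, hE]
      have key : Algebra.trace K A (g ^ 2 * (t * v) ^ 2) = - Algebra.trace K A (g ^ 2 * v ^ 2) := by
        rw [← map_neg]
        apply trace_eq_of_forall_sub_mem_maximal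
        intro n
        by_cases hn : IsRationalIdeal K n
        · obtain ⟨φ, hφn⟩ := exists_algHom_of_isRationalIdeal hn
          have hg := hφn g (hφ φ)
          convert Ideal.mul_mem_left _ (g * (t ^ 2 * v ^ 2 + v ^ 2)) hg using 1
          ring
        · convert Ideal.mul_mem_left _ (g ^ 2 * v ^ 2) ((ht n).2 hn) using 1
          ring
      rw [key, neg_neg, hv, h]
      exact sum_extendZero_pos d (fun i hi => hi) w hw
    have := finrank_le_card_pos (fun i => - d i) ψ hψ
    rw [finrank_fintype_fun_eq_card] at this
    simpa only [neg_pos] using this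

end Signature

/-! ### Trace forms of finite free algebras over `K[X]`. -/

section Generic
open Module Polynomial Matrix

/-- Symmetric matrices over a domain with `2 ≠ 0` can be diagonalised by a congruence with nonzero
determinant. -/
theorem exists_transpose_mul_mul_eq_diagonal {R : Type*} [CommRing R] [IsDomain R]
    (h2 : (2 : R) ≠ 0) {n : ℕ} (M : Matrix (Fin n) (Fin n) R) (hM : M.IsSymm) :
    ∃ (P : Matrix (Fin n) (Fin n) R) (d : Fin n → R), P.det ≠ 0 ∧ Pᵀ * M * P = diagonal d := by
  let F := FractionRing R
  have hinj : Function.Injective (algebraMap R F) := IsFractionRing.injective R F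
  have h2F : (2 : F) ≠ 0 := by
    rw [← map_ofNat (algebraMap R F), Ne, map_eq_zero_iff _ hinj]
    exact h2
  let : Invertible (2 : F) := invertibleOfNonzero h2F
  let MF : Matrix (Fin n) (Fin n) F := M.map (algebraMap R F)
  have hsymm : LinearMap.IsSymm (Matrix.toBilin' MF) := by
    refine ⟨fun x y => ?_⟩
    rw [Matrix.toBilin'_apply', Matrix.toBilin'_apply', Matrix.dotProduct_mulVec,
      ← Matrix.mulVec_transpose, dotProduct_comm]
    have : MFᵀ = MF := by rw [← transpose_map, hM]
    rw [this, RingHom.id_apply]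
  obtain ⟨v', hv'⟩ := LinearMap.BilinForm.exists_orthogonal_basis hsymm
  let v := v'.reindex (finCongr (finrank_fin_fun F))
  have hv (i j : Fin n) (hij : i ≠ j) : Matrix.toBilin' MF (v i) (v j) = 0 := by
    rw [Basis.reindex_apply, Basis.reindex_apply]
    exact hv' (fun h => hij ((finCongr _).symm.injective h))
  let Q : Matrix (Fin n) (Fin n) F := of fun i j => v j i
  have hQdet : Q.det ≠ 0 := by
    have h1 : Q = (Pi.basisFun F (Fin n)).toMatrix v := by
      ext i j
      simp [Q, Basis.toMatrix_apply]
    have h3 := Basis.toMatrix_mul_toMatrix_flip (Pi.basisFun F (Fin n)) v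
    rw [← h1] at h3
    have := congrArg Matrix.det h3
    rw [det_mul, det_one] at this
    exact left_ne_zero_of_mul_eq_one this
  -- An orthogonal basis over the fraction field, multiplied by one common denominator `s` of all
  -- its coordinates, diagonalises over `R`.
  obtain ⟨s, hs⟩ := IsLocalization.exist_integer_multiples_of_finite (nonZeroDivisors R)
    (fun p : Fin n × Fin n => Q p.1 p.2)
  choose P' hP' using hs
  let P : Matrix (Fin n) (Fin n) R := of fun i j => P' (i, j)
  have hP : P.map (algebraMap R F) = algebraMap R F s • Q := by
    ext i j
    simpa [P, Algebra.smul_def] using hP' (i, j)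
  have hs0 : algebraMap R F s ≠ 0 := by
    rw [Ne, map_eq_zero_iff _ hinj]
    exact nonZeroDivisors.ne_zero s.2
  refine ⟨P, fun i => (Pᵀ * M * P) i i, ?_, ?_⟩
  · intro h0
    have := congrArg (algebraMap R F) h0
    rw [RingHom.map_det, RingHom.mapMatrix_apply, hP, det_smul, map_zero] at this
    exact mul_ne_zero (pow_ne_zero _ hs0) hQdet this
  · ext i j
    by_cases hij : i = j
    · subst hij; simp
    · rw [diagonal_apply_ne _ hij]
      apply hinj
      have hmap : (Pᵀ * M * P).map (algebraMap R F) =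
          algebraMap R F s • algebraMap R F s • (Qᵀ * MF * Q) := by
        rw [Matrix.map_mul, Matrix.map_mul, transpose_map, hP, transpose_smul, smul_mul, smul_mul,
          Matrix.mul_smul]
      have hQ : (Qᵀ * MF * Q) i j = 0 := by
        rw [← hv i j hij, Matrix.toBilin'_apply', Matrix.mul_assoc]
        rfl
      rw [map_zero, ← Matrix.map_apply (f := algebraMap R F), hmap]
      simp [hQ]

theorem exists_sign_eq_of_polynomialIVT {K : Type*} [Field K] [LinearOrder K]
    [IsStrictOrderedRing K] (hK : PolynomialIVT K) (d : K[X]) {a b : K} (hab : a < b)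
    (h : ∀ r, a ≤ r → r ≤ b → d ≠ 0 → d.eval r ≠ 0) :
    (0 < d.eval a ↔ 0 < d.eval b) ∧ (d.eval a < 0 ↔ d.eval b < 0) := by
  by_cases hd : d = 0
  · simp [hd]
  · have ha := h a le_rfl hab.le hd
    have hb := h b hab.le le_rfl hd
    have hpos : 0 < d.eval a * d.eval b := by
      refine lt_of_le_of_ne (not_lt.mp fun hneg => ?_) (mul_ne_zero ha hb).symm
      obtain ⟨r, h1, h2, h3⟩ := hK d a b hab hneg
      exact h r h1.le h2.le hd h3
    rcases mul_pos_iff.mp hpos with ⟨h1, h2⟩ | ⟨h1, h2⟩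
    · exact ⟨iff_of_true h1 h2, iff_of_false h1.le.not_gt h2.le.not_gt⟩
    · exact ⟨iff_of_false h1.le.not_gt h2.le.not_gt, iff_of_true h1 h2⟩

theorem trace_one_tmul {R S T : Type*} [CommRing R] [CommRing S] [CommRing T] [Algebra R S]
    [Algebra R T] [Module.Free R S] [Module.Finite R S] (s : S) :
    Algebra.trace T (TensorProduct R T S) ((1 : T) ⊗ₜ[R] s) =
      algebraMap R T (Algebra.trace R S s) := by
  rw [Algebra.trace_apply, Algebra.trace_apply, ← LinearMap.trace_baseChange]
  congr 1
  ext x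
  simp

/-- The points of a finite free algebra `S` over `K[X]` at which `g` does not vanish are governed,
away from the zeros of a polynomial, by the signs of finitely many polynomials. -/
theorem exists_polynomials_exists_ringHom_iff {K : Type*} [Field K] [IsRealClosed K]
    [LinearOrder K] [IsStrictOrderedRing K] {S : Type*} [CommRing S] [Algebra K[X] S] [Module.Free K[X] S]
    [Module.Finite K[X] S] (g : S) :
    ∃ (n : ℕ) (D : K[X]) (d : Fin n → K[X]), D ≠ 0 ∧ ∀ c : K, D.eval c ≠ 0 →
      ((∃ φ : S →+* K, φ.comp (algebraMap K[X] S) = evalRingHom c ∧ φ g ≠ 0) ↔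
        Fintype.card {i // (d i).eval c < 0} < Fintype.card {i // 0 < (d i).eval c}) := by
  let b := Module.finBasis K[X] S
  set n := finrank K[X] S
  let M : Matrix (Fin n) (Fin n) K[X] := of fun i j => Algebra.trace K[X] S (g ^ 2 * (b i * b j))
  -- One diagonalisation over `K[X]` serves all fibres: it specialises to an honest change of basis
  -- at every `c` where `P.det` does not vanish.
  obtain ⟨P, d, hP, hd⟩ := exists_transpose_mul_mul_eq_diagonal (R := K[X])
    two_ne_zero M (by ext i j; simp [M, mul_comm (b i)])
  refine ⟨n, P.det, d, hP, fun c hc => ?_⟩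
  let : Algebra K[X] K := (evalRingHom c).toAlgebra
  have halg (p : K[X]) : algebraMap K[X] K p = p.eval c := rfl
  let A := TensorProduct K[X] K S
  let b' : Basis (Fin n) K A := Algebra.TensorProduct.basis K b
  let Pc : Matrix (Fin n) (Fin n) K := P.map (evalRingHom c)
  have hPc : IsUnit Pc.det := by
    have h1 : Pc.det = P.det.eval c := by
      rw [← coe_evalRingHom, RingHom.map_det]; rfl
    rw [h1]
    exact hc.isUnit
  let E : (Fin n → K) ≃ₗ[K] A :=
    (Matrix.toLinearEquiv' Pc ((isUnit_iff_isUnit_det Pc).mpr hPc).invertible).trans b'.equivFun.symm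
  -- The fibre at `c` is the base change `A`; Hermite's criterion applies to it in the specialised
  -- basis.
  have key := exists_algHom_iff_card_lt_card (K := K) (A := A) ((1 : K) ⊗ₜ[K[X]] g)
    (fun i => (d i).eval c) E ?_
  · rw [← key]
    constructor
    · rintro ⟨φ, hφ, hg⟩
      let φ' : S →ₐ[K[X]] K := ⟨φ, fun r => RingHom.congr_fun hφ r⟩
      refine ⟨Algebra.TensorProduct.lift (Algebra.ofId K K) φ' (fun _ _ => Commute.all _ _), ?_⟩
      rw [Algebra.TensorProduct.lift_tmul, map_one, one_mul]
      exact hg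
    · rintro ⟨φ, hg⟩
      refine ⟨(φ : A →+* K).comp (Algebra.TensorProduct.includeRight : S →ₐ[K[X]] A).toRingHom,
        RingHom.ext fun r => ?_, hg⟩
      change φ ((1 : K) ⊗ₜ[K[X]] algebraMap K[X] S r) = r.eval c
      rw [← Algebra.TensorProduct.tmul_one_eq_one_tmul, halg]
      exact φ.commutes (r.eval c)
  · intro x
    let Mc : Matrix (Fin n) (Fin n) K := M.map (evalRingHom c)
    have hdc : Pcᵀ * Mc * Pc = diagonal (fun i => (d i).eval c) := by
      have := congrArg (fun N : Matrix (Fin n) (Fin n) K[X] => N.map (evalRingHom c)) hd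
      simp only [Matrix.map_mul, transpose_map] at this
      rw [this, diagonal_map (map_zero _)]
      rfl
    have hE : E x = ∑ j, (Pc *ᵥ x) j • ((1 : K) ⊗ₜ[K[X]] b j : A) := by
      change b'.equivFun.symm (Pc *ᵥ x) = _
      rw [Basis.equivFun_symm_apply]
      exact Finset.sum_congr rfl fun j _ => congrArg _ (Algebra.TensorProduct.basis_apply b j)
    set y := Pc *ᵥ x with hy
    have h1 : ∑ i, (d i).eval c * x i ^ 2 = y ⬝ᵥ Mc *ᵥ y := by
      have : x ⬝ᵥ diagonal (fun i => (d i).eval c) *ᵥ x = y ⬝ᵥ Mc *ᵥ y := by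
        rw [← hdc, ← mulVec_mulVec, ← mulVec_mulVec, dotProduct_mulVec, vecMul_transpose]
      rw [← this, dotProduct]
      refine Finset.sum_congr rfl fun i _ => ?_
      rw [mulVec_diagonal]
      ring
    rw [h1, hE, sq (∑ j, _), Finset.sum_mul_sum, Finset.mul_sum, map_sum, dotProduct]
    refine Finset.sum_congr rfl fun i _ => ?_
    rw [Finset.mul_sum, map_sum, mulVec, dotProduct, Finset.mul_sum]
    refine Finset.sum_congr rfl fun j _ => ?_
    have h2 : ((1 : K) ⊗ₜ[K[X]] g : A) ^ 2 *
        ((y i • ((1 : K) ⊗ₜ[K[X]] b i : A)) * (y j • ((1 : K) ⊗ₜ[K[X]] b j : A))) =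
        (y i * y j) • ((1 : K) ⊗ₜ[K[X]] (g ^ 2 * (b i * b j)) : A) := by
      rw [smul_mul_smul_comm, mul_smul_comm, Algebra.TensorProduct.tmul_pow,
        Algebra.TensorProduct.tmul_mul_tmul, Algebra.TensorProduct.tmul_mul_tmul]
      simp
    rw [h2, map_smul, trace_one_tmul, halg, smul_eq_mul]
    change _ = y i * ((M i j).eval c * y j)
    simp only [M, of_apply]
    ring

end Generic

/-! ### Images of standard étale algebras over real closed, separably closed and real base fields.
-/

section StandardEtaleImage
open Polynomial Topology

/-- The set of `c ∈ K` over which the standard étale algebra of `P` has a `K`-point. -/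
def standardEtaleImage {K : Type*} [Field K] (P : StandardEtalePair K[X]) : Set K :=
  {c | ∃ y, (P.f.map (evalRingHom c)).eval y = 0 ∧ (P.g.map (evalRingHom c)).eval y ≠ 0}

theorem mem_standardEtaleImage_iff_exists_ringHom {K : Type*} [Field K] (P : StandardEtalePair K[X])
    (c : K) : c ∈ standardEtaleImage P ↔ ∃ φ : AdjoinRoot P.f →+* K,
      φ.comp (algebraMap K[X] (AdjoinRoot P.f)) = evalRingHom c ∧ φ (AdjoinRoot.mk P.f P.g) ≠ 0 := by
  constructor
  · rintro ⟨y, hf, hg⟩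
    rw [Polynomial.eval_map] at hf hg
    refine ⟨AdjoinRoot.lift (evalRingHom c) y hf, ?_, ?_⟩
    · exact RingHom.ext fun r => AdjoinRoot.lift_of hf
    · rwa [AdjoinRoot.lift_mk]
  · rintro ⟨φ, hφ, hg⟩
    have key (p : K[X][X]) : (p.map (evalRingHom c)).eval (φ (AdjoinRoot.root P.f)) =
        φ (AdjoinRoot.mk P.f p) := by
      rw [← hφ, ← Polynomial.map_map, Polynomial.eval_map_apply, AdjoinRoot.algebraMap_eq,
        Polynomial.eval_map, ← AdjoinRoot.aeval_eq, aeval_def, AdjoinRoot.algebraMap_eq]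
    exact ⟨φ (AdjoinRoot.root P.f), by rw [key, AdjoinRoot.mk_self, map_zero], by rwa [key]⟩

theorem exists_finset_mem_standardEtaleImage_iff {K : Type*} [Field K] [IsRealClosed K]
    [LinearOrder K] [IsStrictOrderedRing K] (P : StandardEtalePair K[X]) :
    ∃ Z : Finset K, ∀ a b : K, a < b → (∀ r ∈ Z, ¬ (a ≤ r ∧ r ≤ b)) →
      (a ∈ standardEtaleImage P ↔ b ∈ standardEtaleImage P) := by
  have := P.monic_f.free_adjoinRoot
  have := P.monic_f.finite_adjoinRoot
  obtain ⟨n, D, d, hD, h⟩ := exists_polynomials_exists_ringHom_iff (K := K) (AdjoinRoot.mk P.f P.g)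
  classical
  -- The exceptional points are the zeros of `D` and of the nonzero `d i`. An identically zero `d i`
  -- has constant sign, and its `roots` is empty by convention.
  refine ⟨D.roots.toFinset ∪ Finset.univ.biUnion fun i => (d i).roots.toFinset, fun a b hab hZ => ?_⟩
  have hDr (r : K) (h1 : a ≤ r) (h2 : r ≤ b) : D.eval r ≠ 0 := fun h0 =>
    hZ r (Finset.mem_union_left _ (by simpa [hD] using h0)) ⟨h1, h2⟩
  have hdr (i : Fin n) := exists_sign_eq_of_polynomialIVT (polynomialIVT_of_isRealClosed K) (d i) hab
    fun r h1 h2 hdi h0 => hZ r (Finset.mem_union_right _ (Finset.mem_biUnion.mpr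
      ⟨i, Finset.mem_univ i, by simpa [hdi] using h0⟩)) ⟨h1, h2⟩
  rw [mem_standardEtaleImage_iff_exists_ringHom, mem_standardEtaleImage_iff_exists_ringHom,
    h a (hDr a le_rfl hab.le), h b (hDr b hab.le le_rfl)]
  simp only [Fintype.card_subtype, (hdr _).1, (hdr _).2]

theorem continuous_eval_map_evalRingHom {K : Type*} [Field K] [TopologicalSpace K]
    [IsTopologicalRing K] (p : K[X][X]) :
    Continuous fun x : K × K => (p.map (evalRingHom x.1)).eval x.2 := by
  simp only [Polynomial.eval_map, eval₂_eq_sum_range, coe_evalRingHom]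
  refine continuous_finsetSum _ fun i _ => ?_
  exact ((p.coeff i).continuous.comp continuous_fst).mul (continuous_snd.pow i)

/-- An implicit function theorem by sign changes: `y` is a simple root of the polynomial at `c`, so
the polynomial changes sign near `y`, does so for all nearby parameters, and the intermediate value
property yields a nearby root, at which `g` is still nonzero. -/
theorem standardEtaleImage_mem_nhds {K : Type*} [Field K] [LinearOrder K] [IsStrictOrderedRing K]
    [TopologicalSpace K] [OrderTopology K] (hK : PolynomialIVT K) (P : StandardEtalePair K[X])
    {c : K} (hc : c ∈ standardEtaleImage P) : standardEtaleImage P ∈ 𝓝 c := by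
  obtain ⟨y, hf, hg⟩ := hc
  set p := P.f.map (evalRingHom c) with hp
  -- The defining identity of the pair expresses a power of `g` through `f` and its derivative; at
  -- `y`, where `f` vanishes and `g` does not, it forces the root to be simple.
  have hder : p.derivative.eval y ≠ 0 := by
    obtain ⟨p₁, p₂, n, e⟩ := P.cond
    have := congrArg (fun q : K[X][X] => (q.map (evalRingHom c)).eval y) e
    simp only [Polynomial.map_add, Polynomial.map_mul, Polynomial.map_pow, eval_add, eval_mul,
      eval_pow, ← derivative_map, ← hp, hf, zero_mul, add_zero] at this
    intro h0
    rw [h0, zero_mul] at this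
    exact pow_ne_zero n hg this.symm
  obtain ⟨q, hq⟩ := dvd_iff_isRoot.mpr hf
  have hqy : q.eval y ≠ 0 := by
    rw [hq] at hder
    simpa using hder
  have hG := (continuous_eval_map_evalRingHom P.g).continuousAt.eventually_ne
    (x := (c, y)) hg
  rw [nhds_prod_eq, Filter.eventually_prod_iff] at hG
  obtain ⟨pa, hpa, pb, hpb, hG⟩ := hG
  have hqs : ∀ᶠ z in 𝓝 y, 0 < q.eval z * q.eval y :=
    (q.continuous.mul continuous_const).continuousAt.eventually_const_lt
      (lt_of_le_of_ne (mul_self_nonneg _) (mul_ne_zero hqy hqy).symm)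
  obtain ⟨l, u, ⟨hl, hu⟩, hW⟩ := mem_nhds_iff_exists_Ioo_subset.mp (hpb.and hqs)
  obtain ⟨y₁, hly, hy₁⟩ := exists_between hl
  obtain ⟨y₂, hy₂, hyu⟩ := exists_between hu
  have h1 := (hW ⟨hly, hy₁.trans hu⟩).2
  have h2 := (hW ⟨hl.trans hy₂, hyu⟩).2
  have hneg : p.eval y₁ * p.eval y₂ < 0 := by
    have h3 : 0 < q.eval y₁ * q.eval y₂ := by
      have := mul_pos h1 h2
      have h4 : 0 < (q.eval y₁ * q.eval y₂) * (q.eval y * q.eval y) := by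
        convert this using 1; ring
      exact pos_of_mul_pos_left h4 (mul_self_nonneg _)
    have h5 : (y₁ - y) * (y₂ - y) < 0 :=
      mul_neg_of_neg_of_pos (sub_neg.mpr hy₁) (sub_pos.mpr hy₂)
    have := mul_neg_of_neg_of_pos h5 h3
    rw [hq]
    simp only [eval_mul, eval_sub, eval_X, eval_C]
    convert this using 1
    ring
  have hcont (z : K) : Continuous fun x => (P.f.map (evalRingHom x)).eval z :=
    (continuous_eval_map_evalRingHom P.f).comp (Continuous.prodMk_left z)
  have hev : ∀ᶠ x in 𝓝 c, (P.f.map (evalRingHom x)).eval y₁ * (P.f.map (evalRingHom x)).eval y₂ < 0 :=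
    ((hcont y₁).mul (hcont y₂)).continuousAt.eventually_lt_const hneg
  filter_upwards [hpa, hev] with x hx1 hx2
  obtain ⟨r, hr1, hr2, hr⟩ := hK _ y₁ y₂ (hy₁.trans hy₂) hx2
  exact ⟨r, hr, hG hx1 (hW ⟨hly.trans hr1, hr2.trans hyu⟩).1⟩

/-- A locally constant predicate which is constant on intervals avoiding a finite set is constant. -/
theorem mem_iff_mem_of_finite_of_locallyConstant {K : Type*} [LinearOrder K] [DenselyOrdered K]
    [NoMinOrder K] [NoMaxOrder K]
    [TopologicalSpace K] [OrderTopology K] (S : Set K) (Z : Finset K)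
    (hZ : ∀ a b : K, a < b → (∀ r ∈ Z, ¬ (a ≤ r ∧ r ≤ b)) → (a ∈ S ↔ b ∈ S))
    (hS : ∀ c, ∀ᶠ x in 𝓝 c, (x ∈ S ↔ c ∈ S)) {a b : K} (hab : a ≤ b) : a ∈ S ↔ b ∈ S := by
  classical
  induction hn : (Z.filter fun r => a ≤ r ∧ r ≤ b).card using Nat.strong_induction_on
    generalizing a b with
  | _ n ih =>
  by_cases h : ∃ r ∈ Z, a ≤ r ∧ r ≤ b
  · obtain ⟨z, hz, haz, hzb⟩ := h
    obtain ⟨l, u, ⟨hl, hu⟩, hlu⟩ := mem_nhds_iff_exists_Ioo_subset.mp (hS z)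
    -- The interval is cut at an exceptional point `z`. A point `w < z` in a neighbourhood where
    -- membership is constant leaves `[a, w]` with fewer exceptional points; the other side is
    -- symmetric.
    have hleft : a ∈ S ↔ z ∈ S := by
      rcases haz.eq_or_lt with rfl | haz
      · rfl
      · obtain ⟨w, hw1, hw2⟩ := exists_between (max_lt haz hl)
        obtain ⟨haw, hlw⟩ := max_lt_iff.mp hw1
        refine (ih _ ?_ haw.le rfl).trans (hlu ⟨hlw, hw2.trans hu⟩)
        rw [← hn]
        refine Finset.card_lt_card (Finset.ssubset_iff_of_subset ?_ |>.mpr ⟨z, ?_, ?_⟩)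
        · exact Finset.monotone_filter_right _ fun r _ hr => ⟨hr.1, hr.2.trans (hw2.le.trans hzb)⟩
        · exact Finset.mem_filter.mpr ⟨hz, haz.le, hzb⟩
        · exact fun hmem => hw2.not_ge (Finset.mem_filter.mp hmem).2.2
    have hright : z ∈ S ↔ b ∈ S := by
      rcases hzb.eq_or_lt with rfl | hzb
      · rfl
      · obtain ⟨w, hw1, hw2⟩ := exists_between (lt_min hzb hu)
        obtain ⟨hwb, hwu⟩ := lt_min_iff.mp hw2
        refine (hlu ⟨hl.trans hw1, hwu⟩).symm.trans (ih _ ?_ hwb.le rfl)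
        rw [← hn]
        refine Finset.card_lt_card (Finset.ssubset_iff_of_subset ?_ |>.mpr ⟨z, ?_, ?_⟩)
        · exact Finset.monotone_filter_right _ fun r _ hr => ⟨(haz.trans hw1.le).trans hr.1, hr.2⟩
        · exact Finset.mem_filter.mpr ⟨hz, haz, hzb.le⟩
        · exact fun hmem => hw1.not_ge (Finset.mem_filter.mp hmem).2.1
    exact hleft.trans hright
  · rcases hab.eq_or_lt with rfl | hab
    · rfl
    · exact hZ a b hab fun r hr hr' => h ⟨r, hr, hr'⟩

/-- Over a real closed field, a finite union of standard étale images whose complement is a union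
of standard étale images is trivial. -/
theorem eq_empty_or_univ_of_isRealClosed {K : Type*} [Field K] [IsRealClosed K] {ι : Type*}
    [Finite ι] (P : ι → StandardEtalePair K[X])
    (h : ∀ c ∉ ⋃ i, standardEtaleImage (P i), ∃ Q : StandardEtalePair K[X],
      c ∈ standardEtaleImage Q ∧ Disjoint (standardEtaleImage Q) (⋃ i, standardEtaleImage (P i))) :
    ⋃ i, standardEtaleImage (P i) = ∅ ∨ ⋃ i, standardEtaleImage (P i) = Set.univ := by
  classical
  obtain ⟨_, _⟩ := exists_linearOrder_of_isRealClosed K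
  let : TopologicalSpace K := Preorder.topology K
  have : OrderTopology K := ⟨rfl⟩
  have := Fintype.ofFinite ι
  choose Z hZ using fun i => exists_finset_mem_standardEtaleImage_iff (P i)
  set S := ⋃ i, standardEtaleImage (P i) with hS
  have hIVT := polynomialIVT_of_isRealClosed K
  have key {a b : K} (hab : a ≤ b) : a ∈ S ↔ b ∈ S := by
    refine mem_iff_mem_of_finite_of_locallyConstant S (Finset.univ.biUnion Z) ?_ ?_ hab
    · intro a b hab hr
      simp only [hS, Set.mem_iUnion]
      exact exists_congr fun i => hZ i a b hab fun r hrZ =>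
        hr r (Finset.mem_biUnion.mpr ⟨i, Finset.mem_univ i, hrZ⟩)
    · intro c
      by_cases hc : c ∈ S
      · obtain ⟨i, hi⟩ := Set.mem_iUnion.mp hc
        filter_upwards [standardEtaleImage_mem_nhds hIVT (P i) hi] with x hx
        exact iff_of_true (Set.mem_iUnion_of_mem i hx) hc
      · obtain ⟨Q, hQ, hdisj⟩ := h c hc
        filter_upwards [standardEtaleImage_mem_nhds hIVT Q hQ] with x hx
        exact iff_of_false (Set.disjoint_left.mp hdisj hx) hc
  by_cases h0 : (0 : K) ∈ S
  · right
    refine Set.eq_univ_of_forall fun x => ?_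
    rcases le_total 0 x with hx | hx
    · exact (key hx).mp h0
    · exact (key hx).mpr h0
  · left
    refine Set.eq_empty_of_forall_notMem fun x => ?_
    rcases le_total 0 x with hx | hx
    · exact fun h => h0 ((key hx).mpr h)
    · exact fun h => h0 ((key hx).mp h)

/-- Over a separably closed field, nonempty standard étale images are cofinite. -/
theorem exists_ne_zero_forall_mem_standardEtaleImage {K : Type*} [Field K] [IsSepClosed K]
    (P : StandardEtalePair K[X]) (hne : (standardEtaleImage P).Nonempty) :
    ∃ a : K[X], a ≠ 0 ∧ ∀ c, a.eval c ≠ 0 → c ∈ standardEtaleImage P := by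
  obtain ⟨c₀, y₀, hf₀, hg₀⟩ := hne
  set N := P.f.natDegree
  -- Over an algebraic closure, `f_c` divides `g_c ^ N` with `N = deg f` as soon as `g_c` vanishes
  -- at every root of `f_c`. A coefficient of the remainder which is nonzero at `c₀` is thus a
  -- polynomial whose nonvanishing guarantees a root of `f_c` with `g_c ≠ 0`.
  have hmod (c : K) : (P.g ^ N %ₘ P.f).map (evalRingHom c) = 0 ↔
      P.f.map (evalRingHom c) ∣ P.g.map (evalRingHom c) ^ N := by
    rw [Polynomial.map_modByMonic _ P.monic_f, modByMonic_eq_zero_iff_dvd (P.monic_f.map _),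
      Polynomial.map_pow]
  have h0 : (P.g ^ N %ₘ P.f).map (evalRingHom c₀) ≠ 0 := by
    rw [Ne, hmod]
    rintro ⟨k, hk⟩
    have := congrArg (Polynomial.eval y₀) hk
    rw [eval_pow, eval_mul, hf₀, zero_mul] at this
    exact pow_ne_zero N hg₀ this
  obtain ⟨i, hi⟩ : ∃ i, ((P.g ^ N %ₘ P.f).coeff i).eval c₀ ≠ 0 := by
    by_contra! h
    exact h0 (Polynomial.ext fun i => by rw [coeff_map, coeff_zero]; exact h i)
  refine ⟨(P.g ^ N %ₘ P.f).coeff i, fun h => hi (by rw [h, eval_zero]), fun c hc => ?_⟩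
  have hndvd : ¬ P.f.map (evalRingHom c) ∣ P.g.map (evalRingHom c) ^ N := by
    rw [← hmod]
    intro h
    apply hc
    have := congrArg (fun q => q.coeff i) h
    simpa [coeff_map] using this
  set p := P.f.map (evalRingHom c) with hp
  set q := P.g.map (evalRingHom c) with hq
  have hpm : p.Monic := P.monic_f.map _
  let Ω := AlgebraicClosure K
  obtain ⟨ω, hω, hqω⟩ : ∃ ω : Ω, aeval ω p = 0 ∧ aeval ω q ≠ 0 := by
    by_contra! h
    apply hndvd
    rw [← map_dvd_map (algebraMap K Ω) (algebraMap K Ω).injective hpm, Polynomial.map_pow]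
    have hs := IsAlgClosed.splits (p.map (algebraMap K Ω))
    have hcard : (p.map (algebraMap K Ω)).roots.card = N := by
      rw [← hs.natDegree_eq_card_roots, natDegree_map, P.monic_f.natDegree_map]
    rw [hs.eq_prod_roots_of_monic (hpm.map _), ← hcard, ← Multiset.prod_replicate,
      ← Multiset.map_const']
    refine Multiset.prod_dvd_prod_of_dvd _ _ fun a ha => ?_
    rw [dvd_iff_isRoot, IsRoot, Polynomial.eval_map_algebraMap]
    apply h
    rw [← Polynomial.eval_map_algebraMap]
    exact isRoot_of_mem_roots ha
  have hder : aeval ω p.derivative ≠ 0 := by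
    obtain ⟨p₁, p₂, n, e⟩ := P.cond
    have := congrArg (fun r : K[X][X] => aeval ω (r.map (evalRingHom c))) e
    simp only [Polynomial.map_add, Polynomial.map_mul, Polynomial.map_pow, map_add, map_mul,
      map_pow, ← derivative_map, ← hp, ← hq, hω, zero_mul, add_zero] at this
    intro h0
    rw [h0, zero_mul] at this
    exact pow_ne_zero n hqω this.symm
  have hint := Algebra.IsIntegral.isIntegral (R := K) ω
  have hirr := minpoly.irreducible hint
  -- `ω` is a simple root of `p`, so its minimal polynomial has nonzero derivative; over a separably
  -- closed field this puts `ω` in `K`.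
  have hsep : (minpoly K ω).Separable := by
    rw [separable_iff_derivative_ne_zero hirr]
    intro h0
    obtain ⟨k, hk⟩ := minpoly.dvd K ω hω
    apply hder
    rw [hk, derivative_mul, h0, zero_mul, zero_add, map_mul, minpoly.aeval, zero_mul]
  obtain ⟨y, rfl⟩ := minpoly.mem_range_of_degree_eq_one K ω
    (IsSepClosed.degree_eq_one_of_irreducible K hirr hsep)
  refine ⟨y, ?_, ?_⟩
  · rw [aeval_algebraMap_apply, map_eq_zero_iff _ (algebraMap K Ω).injective] at hω
    exact hω
  · rw [aeval_algebraMap_apply, Ne, map_eq_zero_iff _ (algebraMap K Ω).injective] at hqω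
    exact hqω

theorem standardEtaleImage_inter_nonempty {K : Type*} [Field K] [Infinite K] [IsSepClosed K]
    (P Q : StandardEtalePair K[X]) (hP : (standardEtaleImage P).Nonempty)
    (hQ : (standardEtaleImage Q).Nonempty) :
    (standardEtaleImage P ∩ standardEtaleImage Q).Nonempty := by
  obtain ⟨a, ha, hPa⟩ := exists_ne_zero_forall_mem_standardEtaleImage P hP
  obtain ⟨b, hb, hQb⟩ := exists_ne_zero_forall_mem_standardEtaleImage Q hQ
  obtain ⟨c, hc⟩ : ∃ c, (a * b).eval c ≠ 0 := by
    by_contra! h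
    exact mul_ne_zero ha hb (Polynomial.funext fun r => by rw [h r, eval_zero])
  rw [eval_mul] at hc
  exact ⟨c, hPa c (left_ne_zero_of_mul hc), hQb c (right_ne_zero_of_mul hc)⟩

theorem polynomialIVT_real : PolynomialIVT ℝ := by
  intro p a b hab h
  have h0 : (0 : ℝ) ∈ (fun x => p.eval x) '' Set.Ioo a b := by
    rcases mul_neg_iff.mp h with ⟨h1, h2⟩ | ⟨h1, h2⟩
    · exact intermediate_value_Ioo' hab.le p.continuous.continuousOn ⟨h2, h1⟩
    · exact intermediate_value_Ioo hab.le p.continuous.continuousOn ⟨h1, h2⟩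
  obtain ⟨r, hr, hr0⟩ := h0
  exact ⟨r, hr.1, hr.2, hr0⟩

theorem isOpen_preimage_standardEtaleImage {K : Type*} [Field K] (e : K ≃+* ℝ)
    (P : StandardEtalePair K[X]) : IsOpen (e.symm ⁻¹' standardEtaleImage P) := by
  have key (p : K[X][X]) (r s : ℝ) : ((p.map (mapRingHom (e : K →+* ℝ))).map (evalRingHom r)).eval s =
      e ((p.map (evalRingHom (e.symm r))).eval (e.symm s)) := by
    have h1 : (evalRingHom r).comp (mapRingHom (e : K →+* ℝ)) =
        (e : K →+* ℝ).comp (evalRingHom (e.symm r)) := by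
      ext x
      · simp
      · simp
    rw [Polynomial.map_map, h1, ← Polynomial.map_map]
    have h2 : s = (e : K →+* ℝ) (e.symm s) := by simp
    conv_lhs => rw [h2]
    rw [Polynomial.eval_map_apply]
    rfl
  have : e.symm ⁻¹' standardEtaleImage P =
      standardEtaleImage (P.map (mapRingHom (e : K →+* ℝ))) := by
    ext r
    constructor
    · rintro ⟨y, hf, hg⟩
      refine ⟨e y, ?_, ?_⟩
      · rw [StandardEtalePair.map_f, key]; simpa using hf
      · rw [StandardEtalePair.map_g, key]; simpa using hg
    · rintro ⟨y, hf, hg⟩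
      rw [StandardEtalePair.map_f, key] at hf
      rw [StandardEtalePair.map_g, key] at hg
      exact ⟨e.symm y, by simpa using hf, by simpa using hg⟩
  rw [this, isOpen_iff_mem_nhds]
  exact fun c hc => standardEtaleImage_mem_nhds polynomialIVT_real _ hc

end StandardEtaleImage

/-! ### Weil restriction of the étale equation `G(y) = α + xβ` from `L` to `K`. -/

section WeilRestriction
open Polynomial TensorProduct

/-- Unique lifting of simple roots along a square-zero extension. -/
theorem existsUnique_lift_of_mul_eq_zero {K S S' : Type*} [CommRing K] [CommRing S] [CommRing S'] [Algebra K S]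
    [Algebra K S'] (N : S →ₐ[K] S') (hN : Function.Surjective N)
    (hker : ∀ a b, N a = 0 → N b = 0 → a * b = 0) (G : K[X]) (t : S) (y' z' : S')
    (hy' : aeval y' G = N t) (hz' : aeval y' (derivative G) * z' = 1) :
    ∃! p : S × S, (aeval p.1 G = t ∧ aeval p.1 (derivative G) * p.2 = 1) ∧ N p.1 = y' ∧ N p.2 = z' := by
  have hinv (y : S) (hy : N y = y') : ∃ z, aeval y (derivative G) * z = 1 ∧ N z = z' := by
    obtain ⟨z, rfl⟩ := hN z'
    have h0 : N (aeval y (derivative G) * z - 1) = 0 := by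
      rw [map_sub, map_mul, ← aeval_algHom_apply, hy, hz', map_one, sub_self]
    set ε := aeval y (derivative G) * z - 1 with hε
    -- Here `ε ^ 2 = 0`, so `1 - ε` inverts `1 + ε` and corrects the approximate inverse `z`.
    refine ⟨z * (1 - ε), ?_, ?_⟩
    · have := hker ε ε h0 h0
      linear_combination -this + (1 - ε) * (-hε)
    · rw [map_mul, map_sub, h0, map_one, sub_zero, mul_one]
  obtain ⟨y₀, hy₀⟩ := hN y'
  obtain ⟨w, hw, -⟩ := hinv y₀ hy₀
  have h0 : N (aeval y₀ G - t) = 0 := by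
    rw [map_sub, ← aeval_algHom_apply, hy₀, hy', sub_self]
  -- One Newton step from the approximate root `y₀`; it is exact because the kernel of `N` squares
  -- to zero.
  have hδ : N (-w * (aeval y₀ G - t)) = 0 := by rw [map_mul, h0, mul_zero]
  have hy : N (y₀ + -w * (aeval y₀ G - t)) = y' := by rw [map_add, hδ, add_zero, hy₀]
  obtain ⟨z, hz, hzz⟩ := hinv _ hy
  have hG : aeval (y₀ + -w * (aeval y₀ G - t)) G = t := by
    rw [aeval_add_of_sq_eq_zero _ _ _ (by rw [sq]; exact hker _ _ hδ hδ)]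
    linear_combination (-(aeval y₀ G - t)) * hw
  refine ⟨(_, z), ⟨⟨hG, hz⟩, hy, hzz⟩, ?_⟩
  rintro ⟨y₁, z₁⟩ ⟨⟨h1, h2⟩, h3, h4⟩
  simp only at h1 h2 h3 h4
  set y := y₀ + -w * (aeval y₀ G - t)
  have hyy : y₁ = y := by
    have hd : N (y₁ - y) = 0 := by rw [map_sub, h3, hy, sub_self]
    have h5 : aeval (y + (y₁ - y)) G = t := by rw [add_sub_cancel, h1]
    rw [aeval_add_of_sq_eq_zero _ _ _ (by rw [sq]; exact hker _ _ hd hd), hG] at h5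
    have h6 : aeval y (derivative G) * (y₁ - y) = 0 := by linear_combination h5
    linear_combination (-(y₁ - y)) * hz + z * h6
  subst hyy
  refine Prod.ext rfl ?_
  change z₁ = z
  linear_combination (-z₁) * hz + z * h2

variable {K : Type*} {L : Type*} [CommRing K] [CommRing L] [Algebra K L] {ι : Type*} [Fintype ι]
  (b : Module.Basis ι K L)

theorem basis_repr_map {K L ι : Type*} [CommRing K] [CommRing L] [Algebra K L]
    (b : Module.Basis ι K L) {T T' : Type*} [CommRing T] [CommRing T'] [Algebra K T] [Algebra K T']
    (f : T →ₐ[K] T') (z : T ⊗[K] L) (i : ι) :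
    (Algebra.TensorProduct.basis T' b).repr (Algebra.TensorProduct.map f (AlgHom.id K L) z) i =
      f ((Algebra.TensorProduct.basis T b).repr z i) := by
  induction z with
  | zero => simp
  | tmul t l => simp [Algebra.TensorProduct.basis_repr_tmul]
  | add x y hx hy => simp only [map_add, Finsupp.add_apply, hx, hy]

/-- The element with given coordinates in a base change. -/
noncomputable def ofCoords (T : Type*) [CommRing T] [Algebra K T] (v : ι → T) : T ⊗[K] L := ∑ i, v i ⊗ₜ b i

theorem map_ofCoords {T T' : Type*} [CommRing T] [CommRing T'] [Algebra K T] [Algebra K T']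
    (f : T →ₐ[K] T') (v : ι → T) :
    Algebra.TensorProduct.map f (AlgHom.id K L) (ofCoords b T v) = ofCoords b T' (fun i => f (v i)) := by
  simp [ofCoords]

theorem ofCoords_eq (T : Type*) [CommRing T] [Algebra K T] (v : ι → T) :
    ofCoords b T v = (Algebra.TensorProduct.basis T b).equivFun.symm v := by
  rw [Module.Basis.equivFun_symm_apply, ofCoords]
  exact Finset.sum_congr rfl fun i _ => by
    rw [Algebra.TensorProduct.basis_apply, TensorProduct.smul_tmul', smul_eq_mul, mul_one]

theorem ofCoords_bijective (T : Type*) [CommRing T] [Algebra K T] :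
    Function.Bijective (ofCoords b T) := by
  have : ofCoords b T = (Algebra.TensorProduct.basis T b).equivFun.symm := funext (ofCoords_eq b T)
  rw [this]
  exact LinearEquiv.bijective _

/-- In the basis `b`, the kernel of `T ⊗ L → (T ⧸ I) ⊗ L` consists of the elements with coordinates
in `I`; a product of two has coefficients in `I ^ 2 = 0`. -/
theorem mul_eq_zero_of_map_mk_eq_zero {K L ι : Type*} [CommRing K] [CommRing L] [Algebra K L]
    [Fintype ι] (b : Module.Basis ι K L) {T : Type*} [CommRing T] [Algebra K T] (I : Ideal T)
    (hI : I ^ 2 = ⊥) (x y : T ⊗[K] L)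
    (hx : Algebra.TensorProduct.map (Ideal.Quotient.mkₐ K I) (AlgHom.id K L) x = 0)
    (hy : Algebra.TensorProduct.map (Ideal.Quotient.mkₐ K I) (AlgHom.id K L) y = 0) : x * y = 0 := by
  have hcoord (v : ι → T) (h : Algebra.TensorProduct.map (Ideal.Quotient.mkₐ K I) (AlgHom.id K L)
      (ofCoords b T v) = 0) (i : ι) : v i ∈ I := by
    rw [map_ofCoords] at h
    have h0 : ofCoords b (T ⧸ I) (fun _ => 0) = 0 := by simp [ofCoords]
    rw [← h0] at h
    exact Ideal.Quotient.eq_zero_iff_mem.mp (congrFun ((ofCoords_bijective b _).1 h) i)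
  obtain ⟨v, rfl⟩ := (ofCoords_bijective b T).2 x
  obtain ⟨w, rfl⟩ := (ofCoords_bijective b T).2 y
  rw [ofCoords, ofCoords, Finset.sum_mul_sum]
  refine Finset.sum_eq_zero fun i _ => Finset.sum_eq_zero fun j _ => ?_
  rw [Algebra.TensorProduct.tmul_mul_tmul]
  have : v i * w j ∈ I ^ 2 := by
    rw [sq]; exact Ideal.mul_mem_mul (hcoord v hx i) (hcoord w hy j)
  rw [hI, Ideal.mem_bot] at this
  rw [this, zero_tmul]

/-- The two equations `G(y) = α + x β` and `G'(y) z = 1` in `T ⊗ L`, as elements to be equated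
to zero. -/
noncomputable def weilEquation (G : K[X]) (α β : L) {T : Type*} [CommRing T] [Algebra K T] (x : T)
    (v : ι ⊕ ι → T) : (T ⊗[K] L) × (T ⊗[K] L) :=
  (aeval (ofCoords b T (v ∘ Sum.inl)) G - (1 ⊗ₜ α + x ⊗ₜ β),
    aeval (ofCoords b T (v ∘ Sum.inl)) (derivative G) * ofCoords b T (v ∘ Sum.inr) - 1)

theorem map_weilEquation (G : K[X]) (α β : L) {T T' : Type*} [CommRing T] [CommRing T']
    [Algebra K T] [Algebra K T'] (f : T →ₐ[K] T') (x : T) (v : ι ⊕ ι → T) :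
    weilEquation b G α β (f x) (fun i => f (v i)) =
      (Algebra.TensorProduct.map f (AlgHom.id K L) (weilEquation b G α β x v).1,
        Algebra.TensorProduct.map f (AlgHom.id K L) (weilEquation b G α β x v).2) := by
  have h (s : ι → ι ⊕ ι) : (fun i => f (v i)) ∘ s = fun i => f ((v ∘ s) i) := rfl
  simp only [weilEquation, h, ← map_ofCoords, aeval_algHom_apply, map_sub, map_mul, map_add, map_one,
    Algebra.TensorProduct.map_tmul, AlgHom.id_apply]

/-- The defining relations of the Weil restriction. -/
noncomputable def weilRelation (G : K[X]) (α β : L) : ι ⊕ ι → MvPolynomial (ι ⊕ ι) K[X] :=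
  Sum.elim
    (fun i => (Algebra.TensorProduct.basis _ b).repr
      (weilEquation b G α β (MvPolynomial.C X) MvPolynomial.X).1 i)
    (fun i => (Algebra.TensorProduct.basis _ b).repr
      (weilEquation b G α β (MvPolynomial.C X) MvPolynomial.X).2 i)

/-- The defining property of Weil restriction: an equation in `T ⊗ L` amounts to equations in `T`
for its coordinates in the basis `b`. -/
theorem forall_weilRelation_eq_zero_iff (G : K[X]) (α β : L) {T : Type*} [CommRing T] [Algebra K T]
    (f : MvPolynomial (ι ⊕ ι) K[X] →ₐ[K] T) :
    (∀ i, f (weilRelation b G α β i) = 0) ↔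
      weilEquation b G α β (f (MvPolynomial.C X)) (fun i => f (MvPolynomial.X i)) = 0 := by
  rw [map_weilEquation, Prod.mk_eq_zero, Sum.forall]
  have h (z : MvPolynomial (ι ⊕ ι) K[X] ⊗[K] L) :
      (∀ i, f ((Algebra.TensorProduct.basis _ b).repr z i) = 0) ↔
        Algebra.TensorProduct.map f (AlgHom.id K L) z = 0 := by
    rw [← (Algebra.TensorProduct.basis T b).repr.map_eq_zero_iff, Finsupp.ext_iff]
    exact forall_congr' fun i => by rw [basis_repr_map]; rfl
  exact and_congr (h _) (h _)

/-- The Weil restriction of the étale locus of `G(y) = α + x β`. -/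
abbrev WeilAlgebra (G : K[X]) (α β : L) : Type _ :=
  MvPolynomial (ι ⊕ ι) K[X] ⧸ Ideal.span (Set.range (weilRelation b G α β))

variable {b} {G : K[X]} {α β : L}

/-- A solution of the equations in `T` induces a morphism to `T`. -/
noncomputable def WeilAlgebra.lift {T : Type*} [CommRing T] [Algebra K T] [Algebra K[X] T] [IsScalarTower K K[X] T]
    (v : ι ⊕ ι → T) (hv : weilEquation b G α β (algebraMap K[X] T X) v = 0) :
    WeilAlgebra b G α β →ₐ[K[X]] T :=
  Ideal.Quotient.liftₐ _ (MvPolynomial.aeval v) <| (Ideal.span_le (I := RingHom.ker _)).mpr <| by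
    rintro _ ⟨i, rfl⟩
    refine (forall_weilRelation_eq_zero_iff b G α β
      ((MvPolynomial.aeval v : MvPolynomial (ι ⊕ ι) K[X] →ₐ[K[X]] T).restrictScalars K)).mpr ?_ i
    simpa [MvPolynomial.aeval_C] using hv

theorem WeilAlgebra.lift_mk_X {T : Type*} [CommRing T] [Algebra K T] [Algebra K[X] T]
    [IsScalarTower K K[X] T] (v : ι ⊕ ι → T)
    (hv : weilEquation b G α β (algebraMap K[X] T X) v = 0) (i : ι ⊕ ι) :
    WeilAlgebra.lift v hv (Ideal.Quotient.mk _ (MvPolynomial.X i)) = v i :=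
  MvPolynomial.aeval_X v i

theorem WeilAlgebra.weilEquation_eq_zero {T : Type*} [CommRing T] [Algebra K T] [Algebra K[X] T]
    [IsScalarTower K K[X] T] (φ : WeilAlgebra b G α β →ₐ[K[X]] T) :
    weilEquation b G α β (algebraMap K[X] T X)
      (fun i => φ (Ideal.Quotient.mk _ (MvPolynomial.X i))) = 0 := by
  have h := (forall_weilRelation_eq_zero_iff b G α β
    ((φ.comp (Ideal.Quotient.mkₐ K[X] _)).restrictScalars K)).mp fun i => by
      change φ (Ideal.Quotient.mk _ (weilRelation b G α β i)) = 0
      rw [Ideal.Quotient.eq_zero_iff_mem.mpr (Ideal.subset_span (Set.mem_range_self i)), map_zero]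
  have hX : ((φ.comp (Ideal.Quotient.mkₐ K[X] _)).restrictScalars K) (MvPolynomial.C X) =
      algebraMap K[X] T X := (φ.comp (Ideal.Quotient.mkₐ K[X] _)).commutes X
  rw [hX] at h
  exact h

theorem WeilAlgebra.hom_ext {T : Type*} [CommRing T] [Algebra K[X] T]
    {φ ψ : WeilAlgebra b G α β →ₐ[K[X]] T}
    (h : ∀ i, φ (Ideal.Quotient.mk _ (MvPolynomial.X i)) = ψ (Ideal.Quotient.mk _ (MvPolynomial.X i))) :
    φ = ψ :=
  Ideal.Quotient.algHom_ext _ (MvPolynomial.algHom_ext h)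

theorem weilEquation_eq_zero_iff {T : Type*} [CommRing T] [Algebra K T] (x : T) (v : ι ⊕ ι → T) :
    weilEquation b G α β x v = 0 ↔
      aeval (ofCoords b T (v ∘ Sum.inl)) G = 1 ⊗ₜ α + x ⊗ₜ β ∧
      aeval (ofCoords b T (v ∘ Sum.inl)) (derivative G) * ofCoords b T (v ∘ Sum.inr) = 1 := by
  rw [weilEquation, Prod.mk_eq_zero, sub_eq_zero, sub_eq_zero]

/-- Unique lifting of simple roots applied to `T ⊗ L → (T ⧸ I) ⊗ L`, then read in coordinates. -/
theorem existsUnique_weilEquation {T : Type*} [CommRing T] [Algebra K T] (I : Ideal T)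
    (hI : I ^ 2 = ⊥) (x : T) (v' : ι ⊕ ι → T ⧸ I)
    (hv' : weilEquation b G α β (Ideal.Quotient.mk I x) v' = 0) :
    ∃! v : ι ⊕ ι → T, weilEquation b G α β x v = 0 ∧ ∀ i, Ideal.Quotient.mk I (v i) = v' i := by
  let N := Algebra.TensorProduct.map (Ideal.Quotient.mkₐ K I) (AlgHom.id K L)
  have hN : Function.Surjective N := by
    intro z
    obtain ⟨w, rfl⟩ := (ofCoords_bijective b _).2 z
    choose u hu using fun i => Ideal.Quotient.mk_surjective (w i)
    refine ⟨ofCoords b T u, ?_⟩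
    rw [map_ofCoords]
    exact congrArg _ (funext hu)
  rw [weilEquation_eq_zero_iff] at hv'
  have hNv (u : ι → T) (w : ι → T ⧸ I) :
      N (ofCoords b T u) = ofCoords b _ w ↔ ∀ i, Ideal.Quotient.mk I (u i) = w i := by
    rw [map_ofCoords, (ofCoords_bijective b _).1.eq_iff, funext_iff]
    rfl
  obtain ⟨⟨y, z⟩, ⟨⟨h1, h2⟩, h3, h4⟩, huniq⟩ := existsUnique_lift_of_mul_eq_zero N hN
    (mul_eq_zero_of_map_mk_eq_zero b I hI) G (1 ⊗ₜ α + x ⊗ₜ β) _ _ (by simpa [N] using hv'.1) hv'.2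
  obtain ⟨vy, rfl⟩ := (ofCoords_bijective b T).2 y
  obtain ⟨vz, rfl⟩ := (ofCoords_bijective b T).2 z
  refine ⟨Sum.elim vy vz, ⟨?_, ?_⟩, ?_⟩
  · rw [weilEquation_eq_zero_iff]
    exact ⟨h1, h2⟩
  · rintro (i | i)
    · exact (hNv _ _).mp h3 i
    · exact (hNv _ _).mp h4 i
  · rintro v ⟨hv1, hv2⟩
    rw [weilEquation_eq_zero_iff] at hv1
    have := huniq (ofCoords b T (v ∘ Sum.inl), ofCoords b T (v ∘ Sum.inr))
      ⟨hv1, (hNv _ _).mpr fun i => hv2 _, (hNv _ _).mpr fun i => hv2 _⟩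
    rw [Prod.mk.injEq, (ofCoords_bijective b T).1.eq_iff, (ofCoords_bijective b T).1.eq_iff] at this
    rw [← this.1, ← this.2]
    exact (Sum.elim_comp_inl_inr v).symm

/-- Maps from the Weil restriction to `T` are solutions in `T`, so the infinitesimal lifting
criterion is the unique lifting of solutions along `T → T ⧸ I`. -/
instance WeilAlgebra.formallyEtale : Algebra.FormallyEtale K[X] (WeilAlgebra b G α β) := by
  refine Algebra.FormallyEtale.iff_comp_bijective.mpr fun T _ _ I hI => ?_
  let : Algebra K T := ((algebraMap K[X] T).comp C).toAlgebra
  have : IsScalarTower K K[X] T := .of_algebraMap_eq' rfl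
  have hmk : algebraMap K[X] (T ⧸ I) X = Ideal.Quotient.mk I (algebraMap K[X] T X) := rfl
  constructor
  · intro φ ψ h
    obtain ⟨v, -, huniq⟩ := existsUnique_weilEquation I hI (algebraMap K[X] T X) _
      (hmk ▸ WeilAlgebra.weilEquation_eq_zero ((Ideal.Quotient.mkₐ K[X] I).comp φ))
    have h1 := huniq _ ⟨WeilAlgebra.weilEquation_eq_zero φ, fun i => rfl⟩
    have h2 := huniq _ ⟨WeilAlgebra.weilEquation_eq_zero ψ, fun i =>
      (AlgHom.congr_fun h (Ideal.Quotient.mk _ (MvPolynomial.X i))).symm⟩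
    exact WeilAlgebra.hom_ext (congrFun (h1.trans h2.symm))
  · intro ψ
    obtain ⟨v, ⟨hv, hv'⟩, -⟩ := existsUnique_weilEquation I hI (algebraMap K[X] T X) _
      (hmk ▸ WeilAlgebra.weilEquation_eq_zero ψ)
    refine ⟨WeilAlgebra.lift v hv, WeilAlgebra.hom_ext fun i => ?_⟩
    rw [← hv', AlgHom.comp_apply, WeilAlgebra.lift_mk_X]
    rfl

instance WeilAlgebra.etale : Algebra.Etale K[X] (WeilAlgebra b G α β) where
  finitePresentation := .quotient (Submodule.fg_span (Set.finite_range _))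

/-- The set of `c` for which `G(y) = α + c β` has a simple root in `L` is the image of the points of
an étale `K[X]`-algebra. -/
theorem exists_ringHom_weilAlgebra_iff {K L ι : Type*} [Field K] [Field L] [Algebra K L] [Fintype ι]
    (b : Module.Basis ι K L) (G : K[X]) (α β : L) (c : K) :
    (∃ φ : WeilAlgebra b G α β →+* K, φ.comp (algebraMap K[X] _) = evalRingHom c) ↔
      ∃ y : L, aeval y G = α + algebraMap K L c * β ∧ aeval y (derivative G) ≠ 0 := by
  let : Algebra K[X] K := (evalRingHom c).toAlgebra
  have : IsScalarTower K K[X] K := .of_algebraMap_eq fun r => by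
    change r = eval c (C r)
    simp
  have hX : algebraMap K[X] K X = c := eval_X
  let e : K ⊗[K] L ≃ₐ[K] L := Algebra.TensorProduct.lid K L
  have hc : e (1 ⊗ₜ α + c ⊗ₜ β) = α + algebraMap K L c * β := by
    simp [e, Algebra.smul_def]
  constructor
  · rintro ⟨φ, hφ⟩
    let φ' : WeilAlgebra b G α β →ₐ[K[X]] K := ⟨φ, fun r => RingHom.congr_fun hφ r⟩
    have h := WeilAlgebra.weilEquation_eq_zero φ'
    rw [weilEquation_eq_zero_iff, hX] at h
    obtain ⟨h1, h2⟩ := h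
    refine ⟨e (ofCoords b K ((fun i => φ' (Ideal.Quotient.mk _ (MvPolynomial.X i))) ∘ Sum.inl)),
      ?_, ?_⟩
    · rw [aeval_algHom_apply, h1, hc]
    · rw [aeval_algHom_apply]
      exact left_ne_zero_of_mul_eq_one ((map_mul e _ _).symm.trans ((congrArg e h2).trans (map_one e)))
  · rintro ⟨y, hy, hy'⟩
    obtain ⟨v, hv⟩ := (ofCoords_bijective b K).2 (e.symm y)
    obtain ⟨w, hw⟩ := (ofCoords_bijective b K).2 (e.symm (aeval y (derivative G))⁻¹)
    have hsol : weilEquation b G α β (algebraMap K[X] K X) (Sum.elim v w) = 0 := by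
      rw [weilEquation_eq_zero_iff, hX, Sum.elim_comp_inl, Sum.elim_comp_inr, hv, hw]
      constructor
      · rw [aeval_algHom_apply, hy, ← hc, e.symm_apply_apply]
      · rw [aeval_algHom_apply, ← map_mul, mul_inv_cancel₀ hy', map_one]
    exact ⟨(WeilAlgebra.lift (Sum.elim v w) hsol : WeilAlgebra b G α β →+* K),
      RingHom.ext fun r => (WeilAlgebra.lift (Sum.elim v w) hsol).commutes r⟩

end WeilRestriction

/-! ### Images of étale `K[X]`-algebras as finite unions of standard ones. -/

section AlgebraImage
open Polynomial

/-- The set of `c ∈ K` such that the fibre of the `K[X]`-algebra `B` over `c` has a `K`-point. -/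
def algebraImage (K : Type*) [Field K] (B : Type*) [CommRing B] [Algebra K[X] B] : Set K :=
  {c | ∃ φ : B →+* K, φ.comp (algebraMap K[X] B) = evalRingHom c}

theorem algebraImage_ring {K : Type*} [Field K] (P : StandardEtalePair K[X]) :
    algebraImage K P.Ring = standardEtaleImage P := by
  ext c
  let : Algebra K[X] K := (evalRingHom c).toAlgebra
  have key (y : K) : P.HasMap y ↔
      (P.f.map (evalRingHom c)).eval y = 0 ∧ (P.g.map (evalRingHom c)).eval y ≠ 0 := by
    rw [StandardEtalePair.HasMap, isUnit_iff_ne_zero, Polynomial.eval_map, Polynomial.eval_map]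
    rfl
  constructor
  · rintro ⟨φ, hφ⟩
    let φ' : P.Ring →ₐ[K[X]] K := ⟨φ, fun r => RingHom.congr_fun hφ r⟩
    exact ⟨φ' P.X, (key _).mp (P.hasMap_X.map φ')⟩
  · rintro ⟨y, hy⟩
    exact ⟨P.lift y ((key y).mpr hy), RingHom.ext fun r => (P.lift y ((key y).mpr hy)).commutes r⟩

theorem algebraImage_subset_of_algHom {K : Type*} [Field K] {B B' : Type*} [CommRing B]
    [CommRing B'] [Algebra K[X] B] [Algebra K[X] B'] (f : B →ₐ[K[X]] B') :
    algebraImage K B' ⊆ algebraImage K B := by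
  rintro c ⟨φ, hφ⟩
  exact ⟨φ.comp f, by rw [RingHom.comp_assoc, f.comp_algebraMap, hφ]⟩

/-- An étale algebra is standard étale locally on its spectrum. Finitely many such localisations
suffice, and a `K`-point of `B` factors through one at whose defining element it does not vanish. -/
theorem exists_algebraImage_eq_iUnion_standardEtaleImage {K : Type u} [Field K] (B : Type u)
    [CommRing B] [Algebra K[X] B] [Algebra.Etale K[X] B] :
    ∃ (ι : Type u) (_ : Finite ι) (P : ι → StandardEtalePair K[X]),
      algebraImage K B = ⋃ i, standardEtaleImage (P i) := by
  let S : Set B := {f | Algebra.IsStandardEtale K[X] (Localization.Away f)}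
  have hS : Ideal.span S = ⊤ := by
    by_contra h
    obtain ⟨m, hm, hle⟩ := Ideal.exists_le_maximal _ h
    obtain ⟨f, hf, hf'⟩ := Algebra.IsEtaleAt.exists_isStandardEtale (R := K[X]) m
    exact hf (hle (Ideal.subset_span hf'))
  obtain ⟨s, hsS, hs⟩ := Submodule.mem_span_finite_of_mem_span ((Ideal.eq_top_iff_one _).mp hS)
  have hP (f : s) : ∃ P : StandardEtalePair K[X],
      Nonempty (Localization.Away (f : B) ≃ₐ[K[X]] P.Ring) := by
    have : Algebra.IsStandardEtale K[X] (Localization.Away (f : B)) := hsS f.2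
    obtain ⟨P⟩ := Algebra.IsStandardEtale.nonempty_standardEtalePresentation
      (R := K[X]) (S := Localization.Away (f : B))
    exact ⟨_, ⟨P.equivRing⟩⟩
  choose P e using hP
  refine ⟨s, inferInstance, P, ?_⟩
  simp_rw [← algebraImage_ring]
  refine Set.Subset.antisymm ?_ (Set.iUnion_subset fun f => algebraImage_subset_of_algHom
    (((e f).some : _ →ₐ[K[X]] _).comp (IsScalarTower.toAlgHom K[X] B (Localization.Away (f : B)))))
  rintro c ⟨φ, hφ⟩
  obtain ⟨f, hf, hφf⟩ : ∃ f ∈ s, φ f ≠ 0 := by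
    by_contra! h
    have : (1 : B) ∈ RingHom.ker φ := (Ideal.span_le.mpr (fun f hf => h f hf) : Ideal.span (s : Set B) ≤ RingHom.ker φ) hs
    rw [RingHom.mem_ker, map_one] at this
    exact one_ne_zero this
  refine Set.mem_iUnion.mpr ⟨⟨f, hf⟩, algebraImage_subset_of_algHom
    (e ⟨f, hf⟩).some.symm.toAlgHom ⟨IsLocalization.Away.lift f hφf.isUnit, ?_⟩⟩
  rw [IsScalarTower.algebraMap_eq K[X] B (Localization.Away f), ← RingHom.comp_assoc,
    IsLocalization.Away.lift_comp, hφ]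

end AlgebraImage

/-! ### Étale images in the affine line in terms of algebras. -/

section AffineLine
open Polynomial

instance isVariety_affineLine (K : Type u) [Field K] : IsVariety K (affineLine K) where
  isSeparated := by change IsSeparated (Spec.map _); infer_instance
  locallyOfFiniteType := by
    refine (HasRingHomProperty.Spec_iff (P := @LocallyOfFiniteType)).mpr ?_
    exact RingHom.finiteType_algebraMap.mpr inferInstance
  quasiCompact := by change QuasiCompact (Spec.map _); infer_instance

theorem IsVariety.of_hom {K : Type u} [Field K] {X V : Over (base K)} [hV : IsVariety K V]
    (f : X ⟶ V) [hs : IsSeparated f.left] [hf : LocallyOfFiniteType f.left]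
    [hq : QuasiCompact f.left] : IsVariety K X := by
  have := hV.isSeparated
  have := hV.locallyOfFiniteType
  have := hV.quasiCompact
  refine ⟨?_, ?_, ?_⟩ <;> rw [← Over.w f] <;> infer_instance

theorem IsVariety.isSeparated_left {K : Type u} [Field K] {X V : Over (base K)}
    [hX : IsVariety K X] (f : X ⟶ V) : IsSeparated f.left := by
  have : IsSeparated (f.left ≫ V.hom) := by rw [Over.w f]; exact hX.isSeparated
  exact IsSeparated.of_comp f.left V.hom

theorem IsVariety.quasiCompact_left {K : Type u} [Field K] {X V : Over (base K)}
    [hX : IsVariety K X] [hV : IsVariety K V] (f : X ⟶ V) : QuasiCompact f.left := by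
  have := hV.isSeparated
  have : QuasiCompact (f.left ≫ V.hom) := by rw [Over.w f]; exact hX.quasiCompact
  exact QuasiCompact.of_comp f.left V.hom

/-- The `K`-points of the affine line are the elements of `K`. -/
noncomputable def affineLinePoint (K : Type u) [Field K] : K ≃ Points K (affineLine K) :=
  Equiv.ofBijective
    (fun c => (Over.homMk (Spec.map (CommRingCat.ofHom (evalRingHom c))) (by
      change Spec.map _ ≫ Spec.map _ = 𝟙 _
      rw [← Spec.map_comp, ← CommRingCat.ofHom_comp, ← Spec.map_id]
      congr 2
      exact RingHom.ext fun r => by simp) : Over.mk (𝟙 (base K)) ⟶ affineLine K)) <| by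
    constructor
    · intro c d h
      have h1 : Spec.map (CommRingCat.ofHom (evalRingHom c)) =
        Spec.map (CommRingCat.ofHom (evalRingHom d)) := congrArg CommaMorphism.left h
      have h2 := congrArg CommRingCat.Hom.hom (Spec.map_injective h1)
      simpa using RingHom.congr_fun h2 X
    · intro p
      let q : Over.mk (𝟙 (base K)) ⟶ affineLine K := p
      obtain ⟨φ, hφ⟩ := Spec.map_surjective (R := CommRingCat.of K[X]) (S := CommRingCat.of K) q.left
      have hw : Spec.map φ ≫ Spec.map (CommRingCat.ofHom (algebraMap K K[X])) = 𝟙 _ :=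
        hφ ▸ Over.w q
      rw [← Spec.map_comp, ← Spec.map_id] at hw
      have hw' := congrArg CommRingCat.Hom.hom (Spec.map_injective hw)
      refine ⟨φ.hom X, ?_⟩
      change _ = q
      ext1
      refine Eq.trans ?_ hφ
      change Spec.map _ = Spec.map _
      congr 1
      ext1
      refine Polynomial.ringHom_ext (fun a => ?_) ?_
      · have := RingHom.congr_fun hw' a
        change φ.hom (C a) = a at this
        change eval _ (C a) = φ.hom (C a)
        rw [this, eval_C]
      · change eval _ X = _
        rw [eval_X]

theorem affineLinePoint_mem_range_map_iff {K : Type u} [Field K] {X : Over (base K)}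
    (f : X ⟶ affineLine K) (c : K) : affineLinePoint K c ∈ Set.range (Points.map f) ↔
      ∃ q : base K ⟶ X.left, q ≫ f.left = Spec.map (CommRingCat.ofHom (evalRingHom c)) := by
  constructor
  · rintro ⟨p, hp⟩
    exact ⟨CommaMorphism.left p, congrArg CommaMorphism.left hp⟩
  · rintro ⟨q, hq⟩
    let p : Over.mk (𝟙 (base K)) ⟶ affineLine K := affineLinePoint K c
    refine ⟨(Over.homMk q ?_ : Over.mk (𝟙 (base K)) ⟶ X), ?_⟩
    · rw [← Over.w f, ← Category.assoc, hq]
      exact Over.w p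
    · change _ = p
      ext1
      exact hq

theorem exists_comp_eq_iff_mem_algebraImage {K : Type u} [Field K] (B : Type u) [CommRing B]
    [Algebra K[X] B] (c : K) :
    (∃ q : base K ⟶ Spec (CommRingCat.of B),
      q ≫ Spec.map (CommRingCat.ofHom (algebraMap K[X] B)) =
        Spec.map (CommRingCat.ofHom (evalRingHom c))) ↔ c ∈ algebraImage K B := by
  constructor
  · rintro ⟨q, hq⟩
    obtain ⟨φ, rfl⟩ := Spec.map_surjective q
    rw [← Spec.map_comp] at hq
    exact ⟨φ.hom, congrArg CommRingCat.Hom.hom (Spec.map_injective hq)⟩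
  · rintro ⟨φ, hφ⟩
    refine ⟨Spec.map (CommRingCat.ofHom φ), ?_⟩
    rw [← Spec.map_comp, ← CommRingCat.ofHom_comp, hφ]

theorem isEtaleImage_image_algebraImage {K : Type u} [Field K] (B : Type u) [CommRing B]
    [Algebra K[X] B] [Algebra.Etale K[X] B] :
    IsEtaleImage (affineLinePoint K '' algebraImage K B) := by
  let X : Over (base K) := Over.mk
    (Spec.map (CommRingCat.ofHom (algebraMap K[X] B)) ≫ (affineLine K).hom)
  let f : X ⟶ affineLine K := Over.homMk (Spec.map (CommRingCat.ofHom (algebraMap K[X] B))) rfl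
  have hf : Etale f.left := by
    refine (HasRingHomProperty.Spec_iff (P := @Etale)).mpr ?_
    exact RingHom.etale_algebraMap.mpr ‹_›
  have : IsSeparated f.left := by change IsSeparated (Spec.map _); infer_instance
  have : QuasiCompact f.left := by change QuasiCompact (Spec.map _); infer_instance
  refine ⟨X, f, IsVariety.of_hom f, hf, ?_⟩
  ext p
  obtain ⟨c, rfl⟩ := (affineLinePoint K).surjective p
  rw [affineLinePoint_mem_range_map_iff, (affineLinePoint K).injective.mem_set_image]
  exact exists_comp_eq_iff_mem_algebraImage B c

/-- `Spec K` has a single point, so a `K`-point factors through any open set containing its image.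
-/
theorem exists_factor_of_openCover {K : Type u} [Field K] {X : Scheme.{u}} (𝒰 : X.OpenCover)
    (q : base K ⟶ X) : ∃ (j : 𝒰.I₀) (r : base K ⟶ 𝒰.X j), r ≫ 𝒰.f j = q := by
  let x : base K := (default : PrimeSpectrum K)
  have : Subsingleton (base K) := inferInstanceAs (Subsingleton (PrimeSpectrum K))
  obtain ⟨j, y, hy⟩ := 𝒰.exists_eq (q x)
  refine ⟨j, IsOpenImmersion.lift (𝒰.f j) q ?_, IsOpenImmersion.lift_fac _ _ _⟩
  rintro _ ⟨z, rfl⟩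
  rw [Subsingleton.elim z x]
  exact ⟨y, hy⟩

/-- A variety is quasi-compact, so finitely many affine opens cover the source; each is étale over
`K[X]`. This converts the geometric notion into the algebraic one in all later arguments. -/
theorem exists_preimage_eq_iUnion_standardEtaleImage {K : Type u} [Field K]
    {U : Set (Points K (affineLine K))} (hU : IsEtaleImage U) :
    ∃ (ι : Type u) (_ : Finite ι) (P : ι → StandardEtalePair K[X]),
      affineLinePoint K ⁻¹' U = ⋃ i, standardEtaleImage (P i) := by
  obtain ⟨X, f, hX, hf, rfl⟩ := hU
  have := hX.quasiCompact
  have : CompactSpace X.left := QuasiCompact.compactSpace_of_compactSpace X.hom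
  let 𝒰 := X.left.affineCover.finiteSubcover
  have (j : 𝒰.I₀) : ∃ (ι : Type u) (_ : Finite ι) (P : ι → StandardEtalePair K[X]),
      {c | ∃ q : base K ⟶ 𝒰.X j, (q ≫ 𝒰.f j) ≫ f.left =
        Spec.map (CommRingCat.ofHom (evalRingHom c))} = ⋃ i, standardEtaleImage (P i) := by
    let R := Γ(𝒰.X j, ⊤)
    let e : 𝒰.X j ≅ Spec R := (𝒰.X j).isoSpec
    obtain ⟨φ, hφ⟩ := Spec.map_surjective (R := CommRingCat.of K[X]) (S := R)
      (e.inv ≫ 𝒰.f j ≫ f.left)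
    let : Algebra K[X] R := φ.hom.toAlgebra
    have hφ' : φ = CommRingCat.ofHom (algebraMap K[X] R) := rfl
    have : Algebra.Etale K[X] R := by
      refine RingHom.etale_algebraMap.mp ((HasRingHomProperty.Spec_iff (P := @Etale) (φ := φ)).mp ?_)
      rw [hφ]
      have h1 : Etale (𝒰.f j ≫ f.left) := inferInstance
      exact Etale.etale_comp e.inv (𝒰.f j ≫ f.left)
    obtain ⟨ι, hι, P, h⟩ := exists_algebraImage_eq_iUnion_standardEtaleImage (K := K) R
    refine ⟨ι, hι, P, ?_⟩
    rw [← h]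
    ext c
    rw [← exists_comp_eq_iff_mem_algebraImage]
    constructor
    · rintro ⟨q, hq⟩
      refine ⟨q ≫ e.hom, ?_⟩
      rw [← hq, ← hφ', hφ, Category.assoc, e.hom_inv_id_assoc, Category.assoc]
      rfl
    · rintro ⟨q, hq⟩
      refine ⟨q ≫ e.inv, ?_⟩
      rw [← hq, ← hφ', hφ, Category.assoc, Category.assoc]
      rfl
  choose ι hι P h using this
  refine ⟨Σ j, ι j, inferInstance, fun i => P i.1 i.2, ?_⟩
  rw [Set.iUnion_sigma]
  simp_rw [← h]
  ext c
  rw [Set.mem_preimage, affineLinePoint_mem_range_map_iff, Set.mem_iUnion]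
  constructor
  · rintro ⟨q, hq⟩
    obtain ⟨j, r, rfl⟩ := exists_factor_of_openCover 𝒰 q
    exact ⟨j, r, hq⟩
  · rintro ⟨j, r, hq⟩
    exact ⟨_, hq⟩

end AffineLine

/-! ### Preimages, and images under étale morphisms. -/

section Functoriality

/-- Étale morphisms are stable under base change, and a `K`-point of a fibre product is a compatible
pair of `K`-points. -/
theorem IsEtaleImage.preimage {K : Type u} [Field K] {V W : Over (base K)} [hV : IsVariety K V]
    [hW : IsVariety K W] (g : W ⟶ V) {U : Set (Points K V)} (hU : IsEtaleImage U) :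
    IsEtaleImage (Points.map g ⁻¹' U) := by
  obtain ⟨X, f, hX, hf, rfl⟩ := hU
  have := IsVariety.isSeparated_left f
  have := IsVariety.quasiCompact_left f
  let P : Over (base K) := Over.mk (Limits.pullback.snd f.left g.left ≫ W.hom)
  let b : P ⟶ W := Over.homMk (Limits.pullback.snd f.left g.left) rfl
  have ha : Limits.pullback.fst f.left g.left ≫ X.hom = P.hom := by
    change _ = Limits.pullback.snd f.left g.left ≫ W.hom
    rw [← Over.w f, ← Over.w g, Limits.pullback.condition_assoc]
  let a : P ⟶ X := Over.homMk (Limits.pullback.fst f.left g.left) ha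
  have hab : a ≫ f = b ≫ g := by
    ext1
    exact Limits.pullback.condition
  have h1 : IsSeparated b.left := by
    change IsSeparated (Limits.pullback.snd f.left g.left); infer_instance
  have h2 : Etale b.left := by
    change Etale (Limits.pullback.snd f.left g.left); infer_instance
  have h3 : QuasiCompact b.left := by
    change QuasiCompact (Limits.pullback.snd f.left g.left); infer_instance
  refine ⟨P, b, IsVariety.of_hom b, h2, ?_⟩
  ext p
  constructor
  · rintro ⟨q, rfl⟩
    let q' : Over.mk (𝟙 (base K)) ⟶ P := q
    refine ⟨q' ≫ a, ?_⟩
    change (q' ≫ a) ≫ f = (q' ≫ b) ≫ g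
    rw [Category.assoc, hab, Category.assoc]
  · rintro ⟨r, hr⟩
    let p' : Over.mk (𝟙 (base K)) ⟶ W := p
    let r' : Over.mk (𝟙 (base K)) ⟶ X := r
    have hl : r'.left ≫ f.left = p'.left ≫ g.left := congrArg CommaMorphism.left hr
    let t : Over.mk (𝟙 (base K)) ⟶ P :=
      Over.homMk (Limits.pullback.lift r'.left p'.left hl) (by
        change Limits.pullback.lift r'.left p'.left hl ≫ Limits.pullback.snd _ _ ≫ W.hom = _
        rw [Limits.pullback.lift_snd_assoc]
        exact Over.w p')
    refine ⟨t, ?_⟩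
    change t ≫ b = p'
    ext1
    exact Limits.pullback.lift_snd _ _ _

theorem continuous_pointsMap {K : Type u} [Field K] {V W : Over (base K)} [IsVariety K V]
    [IsVariety K W] (g : W ⟶ V) : Continuous (Points.map g) :=
  continuous_generateFrom_iff.mpr fun _ hU =>
    TopologicalSpace.isOpen_generateFrom_of_mem (hU.preimage g)

theorem IsClopenEtaleImage.preimage {K : Type u} [Field K] {V W : Over (base K)} [IsVariety K V]
    [IsVariety K W] (g : W ⟶ V) {U : Set (Points K V)} (hU : IsClopenEtaleImage U) :
    IsClopenEtaleImage (Points.map g ⁻¹' U) :=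
  ⟨hU.1.preimage g, hU.2.preimage (continuous_pointsMap g)⟩

theorem IsEtaleImage.image {K : Type u} [Field K] {V W : Over (base K)} (g : W ⟶ V)
    [hg : Etale g.left] {U : Set (Points K W)} (hU : IsEtaleImage U) :
    IsEtaleImage (Points.map g '' U) := by
  obtain ⟨X, f, hX, hf, rfl⟩ := hU
  refine ⟨X, f ≫ g, hX, ?_, ?_⟩
  · change Etale (f.left ≫ g.left); infer_instance
  · rw [← Set.range_comp]
    exact congrArg Set.range (funext fun p => (Category.assoc (obj := Over (base K)) p f g).symm)

theorem isOpenMap_pointsMap {K : Type u} [Field K] {V W : Over (base K)} [IsVariety K W]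
    (g : W ⟶ V) [hg : Etale g.left] : IsOpenMap (Points.map (K := K) g) :=
  (isTopologicalBasis_isEtaleImage K W).isOpenMap_iff.mpr fun _ hU =>
    TopologicalSpace.isOpen_generateFrom_of_mem (IsEtaleImage.image g hU)

end Functoriality

/-! ### Anisotropic forms over fields that are not separably closed. -/

section AnisotropicForm
open Polynomial

theorem exists_monic_forall_eval_ne_zero {K : Type*} [Field K] (hK : ¬ IsSepClosed K) :
    ∃ p : K[X], p.Monic ∧ 0 < p.natDegree ∧ ∀ x, p.eval x ≠ 0 := by
  by_contra! h
  exact hK (IsSepClosed.of_exists_root K fun p hp hirr _ => h p hp hirr.natDegree_pos)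

theorem eval_homogenize_of_eq_zero {K : Type*} [Field K] (p : K[X]) (n : ℕ) (x : Fin 2 → K)
    (hx : x 1 = 0) : MvPolynomial.eval x (p.homogenize n) = p.coeff n * x 0 ^ n := by
  have key (k l : ℕ) : MvPolynomial.eval x (MvPolynomial.monomial
      ((Finsupp.single 0 k).update 1 l) (p.coeff k)) = p.coeff k * (x 0 ^ k * x 1 ^ l) := by
    rw [MvPolynomial.eval_monomial, Finsupp.update_eq_add_single, Finsupp.prod_add_index',
      Finsupp.prod_single_index, Finsupp.prod_single_index] <;> simp [pow_add]
  rw [homogenize, MvPolynomial.eval_sum, Finset.sum_eq_single (n, 0)]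
  · rw [key, pow_zero, mul_one]
  · rintro ⟨k, l⟩ hkl hne
    rw [Finset.HasAntidiagonal.mem_antidiagonal] at hkl
    have hl : l ≠ 0 := by rintro rfl; simp_all
    rw [key, hx, zero_pow hl, mul_zero, mul_zero]
  · simp

/-- Where `x 1 ≠ 0` the form is `p (x 0 / x 1)` times a power of `x 1`; where `x 1 = 0` only the
leading term remains, which is a power of `x 0` since `p` is monic. -/
theorem eval_homogenize_ne_zero {K : Type*} [Field K] {p : K[X]} (hp : p.Monic)
    (h : ∀ x, p.eval x ≠ 0) (x : Fin 2 → K) (hx : MvPolynomial.eval x (p.homogenize p.natDegree) = 0) :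
    x 0 = 0 ∧ x 1 = 0 := by
  have h1 : x 1 = 0 := by
    by_contra h1
    rw [eval_homogenize le_rfl x h1] at hx
    exact mul_ne_zero (h _) (pow_ne_zero _ h1) hx
  refine ⟨?_, h1⟩
  rw [eval_homogenize_of_eq_zero _ _ _ h1, hp.coeff_natDegree, one_mul] at hx
  exact eq_zero_of_pow_eq_zero hx

/-- A field which is not separably closed has anisotropic forms in any number of variables. -/
theorem exists_isHomogeneous_anisotropic {K : Type*} [Field K] (hK : ¬ IsSepClosed K)
    (σ : Type*) [Fintype σ] :
    ∃ (N : MvPolynomial σ K) (d : ℕ), 0 < d ∧ N.IsHomogeneous d ∧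
      ∀ v : σ → K, MvPolynomial.eval v N = 0 → v = 0 := by
  classical
  obtain ⟨p, hp, hdeg, hroot⟩ := exists_monic_forall_eval_ne_zero hK
  suffices ∀ s : Finset σ, ∃ (N : MvPolynomial σ K) (d : ℕ), 0 < d ∧ N.IsHomogeneous d ∧
      ∀ v : σ → K, MvPolynomial.eval v N = 0 → ∀ i ∈ s, v i = 0 by
    obtain ⟨N, d, hd, hN, h⟩ := this Finset.univ
    exact ⟨N, d, hd, hN, fun v hv => funext fun i => h v hv i (Finset.mem_univ i)⟩
  intro s
  induction s using Finset.induction_on with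
  | empty => exact ⟨0, 1, one_pos, MvPolynomial.isHomogeneous_zero _ _ _, by simp⟩
  | insert i s _ ih =>
    obtain ⟨N, d, hd, hN, h⟩ := ih
    -- The anisotropic binary form is evaluated at `N` and `X i ^ d`; the exponent makes both
    -- arguments homogeneous of the same degree.
    let w : Fin 2 → MvPolynomial σ K := ![N, MvPolynomial.X i ^ d]
    refine ⟨MvPolynomial.aeval w (p.homogenize p.natDegree), d * p.natDegree,
      Nat.mul_pos hd hdeg, (isHomogeneous_homogenize p).aeval _ ?_, fun v hv => ?_⟩
    · refine Fin.forall_fin_two.mpr ⟨hN, ?_⟩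
      simpa [w] using (MvPolynomial.isHomogeneous_X K i).pow d
    · have h0 : MvPolynomial.eval (fun j => MvPolynomial.eval v (w j)) (p.homogenize p.natDegree) = 0 := by
        rw [← hv]
        have hcomp : MvPolynomial.eval (fun j => MvPolynomial.eval v (w j)) =
            (MvPolynomial.eval v).comp (MvPolynomial.aeval w : MvPolynomial (Fin 2) K →ₐ[K] _) :=
          MvPolynomial.ringHom_ext (by simp) (by simp)
        rw [hcomp]
        rfl
      obtain ⟨h1, h2⟩ := eval_homogenize_ne_zero hp hroot _ h0
      have h2' : v i = 0 := by simpa [w, hd.ne'] using h2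
      intro j hj
      rcases Finset.mem_insert.mp hj with rfl | hj
      · exact h2'
      · exact h v h1 j hj

end AnisotropicForm

/-! ### Rational points of projective space and the complement of an anisotropic hypersurface. -/

section ProjectiveSpace
open MvPolynomial HomogeneousLocalization

attribute [local instance] MvPolynomial.gradedAlgebra

theorem eval₂_mul_of_isHomogeneous {R S σ : Type*} [CommSemiring R] [CommSemiring S]
    {p : MvPolynomial σ R} {d : ℕ} (hp : p.IsHomogeneous d) (f : R →+* S) (u : S) (g : σ → S) :
    p.eval₂ f (fun i => u * g i) = u ^ d * p.eval₂ f g := by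
  rw [eval₂_eq, eval₂_eq, Finset.mul_sum]
  refine Finset.sum_congr rfl fun m hm => ?_
  rw [hp.degree_eq_sum_deg_support hm, ← Finset.prod_pow_eq_pow_sum]
  simp_rw [mul_pow, Finset.prod_mul_distrib]
  ring

/-- The structure map of the affine open `D₊(f)` of projective space over `K`. -/
noncomputable def awayStructureMap (K : Type*) [Field K] {σ : Type*} (f : MvPolynomial σ K) :
    K →+* Away (homogeneousSubmodule σ K) f :=
  (fromZeroRingHom (homogeneousSubmodule σ K) _).comp
    (algebraMap K (homogeneousSubmodule σ K 0))

theorem X_mem_homogeneousSubmodule (K : Type*) [Field K] {σ : Type*} (i : σ) :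
    X i ∈ homogeneousSubmodule σ K 1 :=
  isHomogeneous_X K i

/-- The regular function `X j / X i` on the complement of `X i = 0` in projective space. -/
noncomputable def awayCoord (K : Type*) [Field K] {σ : Type*} (i j : σ) :
    Away (homogeneousSubmodule σ K) (X i) :=
  Away.mk (homogeneousSubmodule σ K) (X_mem_homogeneousSubmodule K i) 1 (X j)
    (X_mem_homogeneousSubmodule K j)

/-- The inverse of `X i` in the localization of the polynomial ring away from `X i`. -/
noncomputable def awayInvCoord (K : Type*) [Field K] {σ : Type*} (i : σ) :
    Localization.Away (X i : MvPolynomial σ K) :=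
  Localization.mk (1 : MvPolynomial σ K)
    (⟨X i, Submonoid.mem_powers _⟩ : Submonoid.powers (X i : MvPolynomial σ K))

theorem val_awayCoord (K : Type*) [Field K] {σ : Type*} (i j : σ) : (awayCoord K i j).val =
    awayInvCoord K i *
      algebraMap (MvPolynomial σ K) (Localization.Away (X i : MvPolynomial σ K)) (X j) := by
  rw [awayCoord, awayInvCoord, Away.val_mk, mul_comm, ← Localization.mk_one_eq_algebraMap, Localization.mk_mul,
    mul_one, one_mul]
  simp only [pow_one]

theorem awayCoord_self (K : Type*) [Field K] {σ : Type*} (i : σ) : awayCoord K i i = 1 := by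
  apply val_injective
  rw [awayCoord, Away.val_mk, val_one, ← Localization.mk_one, Localization.mk_eq_mk_iff,
    Localization.r_iff_exists]
  exact ⟨1, by simp⟩

/-- Dehomogenisation: `N / X i ^ d` is `N` evaluated at the coordinates `X j / X i`. It is verified
in the full localisation, where `X i` is invertible. -/
theorem isLocalizationElem_eq_eval₂ {K : Type*} [Field K] {σ : Type*} (i : σ) {N : MvPolynomial σ K}
    {d : ℕ} (hN : N ∈ homogeneousSubmodule σ K d) (hi : X i ∈ homogeneousSubmodule σ K 1) :
    Away.isLocalizationElem hi hN = N.eval₂ (awayStructureMap K (X i)) (awayCoord K i) := by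
  let L := Localization.Away (X i : MvPolynomial σ K)
  let ι : Away (homogeneousSubmodule σ K) (X i) →+* L := algebraMap _ _
  have hι : Function.Injective ι := val_injective _
  apply hι
  rw [hom_eval₂]
  have h1 : (fun j => ι (awayCoord K i j)) = fun j => awayInvCoord K i *
      algebraMap (MvPolynomial σ K) L (X j) :=
    funext fun j => val_awayCoord K i j
  have h2 : ι.comp (awayStructureMap K (X i)) = (algebraMap (MvPolynomial σ K) L).comp C := rfl
  have h3 : eval₂ ((algebraMap (MvPolynomial σ K) L).comp C)
      (fun j => algebraMap (MvPolynomial σ K) L (X j)) N = algebraMap (MvPolynomial σ K) L N := by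
    rw [← hom_eval₂ N C _ X, eval₂_eta]
  rw [h1, h2, eval₂_mul_of_isHomogeneous hN]
  refine Eq.trans ?_ (congrArg _ h3.symm)
  change (Away.isLocalizationElem hi hN).val = _
  rw [awayInvCoord, Away.val_mk, ← Localization.mk_one_eq_algebraMap, Localization.mk_pow,
    Localization.mk_mul, mul_one, one_pow, one_mul]
  simp only [pow_one]
  rfl

theorem exists_mem_basicOpen_X {n : ℕ} {K : Type u} [Field K]
    (x : Proj (homogeneousSubmodule (Fin (n + 1)) K)) :
    ∃ i, x ∈ Proj.basicOpen (homogeneousSubmodule (Fin (n + 1)) K) (X i) := by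
  have h := Proj.iSup_basicOpen_eq_top' (homogeneousSubmodule (Fin (n + 1)) K) X
    (fun i => ⟨1, isHomogeneous_X K i⟩) (by
      refine top_le_iff.mp fun p _ => ?_
      have hp : p ∈ Algebra.adjoin K (Set.range X) := adjoin_range_X (R := K) (σ := Fin (n+1)) ▸ trivial
      induction hp using Algebra.adjoin_induction with
      | mem x hx => exact Algebra.subset_adjoin hx
      | algebraMap r => exact Subalgebra.algebraMap_mem _ (algebraMap K (homogeneousSubmodule (Fin (n + 1)) K 0) r)
      | add x y _ _ hx hy => exact add_mem (hx trivial) (hy trivial)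
      | mul x y _ _ hx hy => exact mul_mem (hx trivial) (hy trivial))
  exact TopologicalSpace.Opens.mem_iSup.mp (h.ge (Set.mem_univ x))

/-- The structure morphism of projective space over `K`. -/
noncomputable abbrev projectiveSpaceStructure (n : ℕ) (K : Type u) [Field K] :
    Proj (homogeneousSubmodule (Fin (n + 1)) K) ⟶ base K :=
  (projectiveSpace n K).hom

theorem awayι_comp_projectiveSpaceStructure {n : ℕ} {K : Type u} [Field K]
    {f : MvPolynomial (Fin (n + 1)) K} {d : ℕ} (hf : f ∈ homogeneousSubmodule (Fin (n + 1)) K d)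
    (hd : 0 < d) : Proj.awayι _ f hf hd ≫ projectiveSpaceStructure n K =
      Spec.map (CommRingCat.ofHom (awayStructureMap K f)) := by
  change Proj.awayι _ f hf hd ≫ Proj.toSpecZero _ ≫ Spec.map _ = _
  rw [Proj.awayι_toSpecZero_assoc, ← Spec.map_comp]
  rfl

theorem exists_comp_awayι_eq {n : ℕ} {K : Type u} [Field K]
    {f : MvPolynomial (Fin (n + 1)) K} {d : ℕ} (hf : f ∈ homogeneousSubmodule (Fin (n + 1)) K d)
    (hd : 0 < d) (p : base K ⟶ Proj (homogeneousSubmodule (Fin (n + 1)) K))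
    (hp : p (default : PrimeSpectrum K) ∈ Proj.basicOpen _ f) :
    ∃ q, q ≫ Proj.awayι _ f hf hd = p := by
  have : Subsingleton (base K) := inferInstanceAs (Subsingleton (PrimeSpectrum K))
  refine ⟨IsOpenImmersion.lift (Proj.awayι _ f hf hd) p ?_, IsOpenImmersion.lift_fac _ _ _⟩
  rintro _ ⟨z, rfl⟩
  rw [Subsingleton.elim z (default : PrimeSpectrum K)]
  rw [← Proj.opensRange_awayι _ f hf hd] at hp
  exact hp

/-- The `K`-points of projective space lie in the complement of the zero locus of an anisotropic
form. -/
theorem mem_basicOpen_of_anisotropic {n : ℕ} {K : Type u} [Field K]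
    {N : MvPolynomial (Fin (n + 1)) K} {d : ℕ} (hN : N ∈ homogeneousSubmodule (Fin (n + 1)) K d)
    (hd : 0 < d) (h : ∀ v, eval v N = 0 → v = 0)
    (p : base K ⟶ Proj (homogeneousSubmodule (Fin (n + 1)) K))
    (hp : p ≫ projectiveSpaceStructure n K = 𝟙 _) :
    p (default : PrimeSpectrum K) ∈ Proj.basicOpen _ N := by
  obtain ⟨i, hi⟩ := exists_mem_basicOpen_X (p (default : PrimeSpectrum K))
  have hX := X_mem_homogeneousSubmodule K i
  obtain ⟨q, rfl⟩ := exists_comp_awayι_eq hX one_pos p hi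
  obtain ⟨φ, rfl⟩ := Spec.map_surjective q
  rw [Category.assoc, awayι_comp_projectiveSpaceStructure, ← Spec.map_comp, ← Spec.map_id] at hp
  have hφ : φ.hom.comp (awayStructureMap K (X i)) = RingHom.id K :=
    congrArg CommRingCat.Hom.hom (Spec.map_injective hp)
  change Spec.map φ (default : PrimeSpectrum K) ∈ Proj.awayι _ (X i) hX one_pos ⁻¹ᵁ Proj.basicOpen _ N
  rw [Proj.awayι_preimage_basicOpen _ hX one_pos hN hd]
  change φ.hom (Away.isLocalizationElem hX hN) ∉ (default : PrimeSpectrum K).asIdeal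
  have hdef : (default : PrimeSpectrum K).asIdeal = ⊥ := Ideal.eq_bot_of_prime _
  rw [hdef, Ideal.mem_bot, isLocalizationElem_eq_eval₂, hom_eval₂, hφ]
  intro h0
  -- A zero of `N` would be the zero vector, but its `i`-th coordinate is `X i / X i = 1`.
  have := congrFun (h _ h0) i
  rw [awayCoord_self, map_one] at this
  exact one_ne_zero this

end ProjectiveSpace

/-! ### Separating rational points of quasi-projective varieties by regular functions. -/

section QuasiProjective
open MvPolynomial HomogeneousLocalization

attribute [local instance] MvPolynomial.gradedAlgebra

/-- The morphism to the affine line given by a regular function on `Spec R`. -/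
theorem exists_separating_affineLine {K : Type u} [Field K] (R : Type u) [CommRing R] (κ : K →+* R)
    (r : R) : ∃ g : Over.mk (Spec.map (CommRingCat.ofHom κ)) ⟶ affineLine K,
      ∀ φ : R →+* K, Spec.map (CommRingCat.ofHom φ) ≫ g.left =
        Spec.map (CommRingCat.ofHom (φ.comp (Polynomial.eval₂RingHom κ r))) := by
  refine ⟨Over.homMk (Spec.map (CommRingCat.ofHom (Polynomial.eval₂RingHom κ r))) ?_, fun φ => ?_⟩
  · change Spec.map _ ≫ Spec.map _ = Spec.map _
    rw [← Spec.map_comp, ← CommRingCat.ofHom_comp]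
    congr 2
    exact RingHom.ext fun a => Polynomial.eval₂_C κ r
  · change Spec.map _ ≫ Spec.map _ = Spec.map _
    rw [← Spec.map_comp, ← CommRingCat.ofHom_comp]

/-- `W` is the part of `V` lying over the affine open set where an anisotropic form does not vanish;
it contains all `K`-points. It is immersed in an affine scheme, and immersions are monomorphisms, so
distinct `K`-points give distinct ring homomorphisms, told apart by some regular function `r`. -/
theorem exists_separating_of_isQuasiProjective {K : Type u} [Field K] (hK : ¬ IsSepClosed K)
    {V : Over (base K)} [hV : IsVariety K V] (hq : IsQuasiProjective K V) {a b : Points K V}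
    (hab : a ≠ b) : ∃ (W : Over (base K)) (_ : IsVariety K W) (j : W ⟶ V) (g : W ⟶ affineLine K)
      (_ : Etale j.left) (a' b' : Points K W), Function.Bijective (Points.map (K := K) j) ∧
      Points.map j a' = a ∧ Points.map j b' = b ∧ Points.map g a' ≠ Points.map g b' := by
  obtain ⟨n, i, hi⟩ := hq
  obtain ⟨N, d, hd, hN, hN0⟩ := exists_isHomogeneous_anisotropic hK (Fin (n + 1))
  replace hN : N ∈ homogeneousSubmodule (Fin (n + 1)) K d := hN
  let ι := Proj.awayι _ N hN hd
  let f : V.left ⟶ Proj (homogeneousSubmodule (Fin (n + 1)) K) := i.left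
  have hf : IsImmersion f := hi
  have hfw : f ≫ projectiveSpaceStructure n K = V.hom := Over.w i
  let W : Over (base K) := Over.mk (Limits.pullback.fst f ι ≫ V.hom)
  let j : W ⟶ V := Over.homMk (Limits.pullback.fst f ι) rfl
  let S : Over (base K) := Over.mk (Spec.map (CommRingCat.ofHom (awayStructureMap K N)))
  have hs : Limits.pullback.snd f ι ≫ Spec.map (CommRingCat.ofHom (awayStructureMap K N)) = W.hom := by
    rw [← awayι_comp_projectiveSpaceStructure hN hd, ← Category.assoc, ← Limits.pullback.condition,
      Category.assoc, hfw]
    rfl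
  let s : W ⟶ S := Over.homMk (Limits.pullback.snd f ι) hs
  have hjo : IsOpenImmersion (Limits.pullback.fst f ι) := inferInstance
  have hso : IsImmersion (Limits.pullback.snd f ι) := inferInstance
  -- Over a locally Noetherian scheme open immersions are quasi-compact, which makes `W` a variety.
  have : IsLocallyNoetherian V.left := by
    have := hV.locallyOfFiniteType
    exact LocallyOfFiniteType.isLocallyNoetherian V.hom
  have hjq : QuasiCompact (Limits.pullback.fst f ι) := inferInstance
  have h1 : IsSeparated j.left := by change IsSeparated (Limits.pullback.fst f ι); infer_instance
  have h2 : LocallyOfFiniteType j.left := by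
    change LocallyOfFiniteType (Limits.pullback.fst f ι); infer_instance
  have h3 : QuasiCompact j.left := hjq
  have hj : Etale j.left := by change Etale (Limits.pullback.fst f ι); infer_instance
  have hW : IsVariety K W := IsVariety.of_hom j
  have hbij : Function.Bijective (Points.map (K := K) j) := by
    constructor
    · intro p q hpq
      let p' : Over.mk (𝟙 (base K)) ⟶ W := p
      let q' : Over.mk (𝟙 (base K)) ⟶ W := q
      have h : p'.left ≫ Limits.pullback.fst f ι = q'.left ≫ Limits.pullback.fst f ι :=
        congrArg CommaMorphism.left hpq
      change p' = q'
      ext1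
      exact (cancel_mono (Limits.pullback.fst f ι)).mp h
    · intro p
      let p' : Over.mk (𝟙 (base K)) ⟶ V := p
      have hw : (p'.left ≫ f) ≫ projectiveSpaceStructure n K = 𝟙 _ := by
        rw [Category.assoc, hfw]
        exact Over.w p'
      obtain ⟨q, hq⟩ := exists_comp_awayι_eq hN hd (p'.left ≫ f)
        (mem_basicOpen_of_anisotropic hN hd hN0 _ hw)
      have hl : Limits.pullback.lift p'.left q hq.symm ≫ Limits.pullback.fst f ι = p'.left :=
        Limits.pullback.lift_fst _ _ _
      refine ⟨(Over.homMk (Limits.pullback.lift p'.left q hq.symm) ?_ :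
        Over.mk (𝟙 (base K)) ⟶ W), ?_⟩
      · change Limits.pullback.lift p'.left q hq.symm ≫ Limits.pullback.fst f ι ≫ V.hom = _
        rw [← Category.assoc, hl]
        exact Over.w p'
      · change _ = p'
        ext1
        exact hl
  obtain ⟨a', rfl⟩ := hbij.2 a
  obtain ⟨b', rfl⟩ := hbij.2 b
  let a'' : Over.mk (𝟙 (base K)) ⟶ W := a'
  let b'' : Over.mk (𝟙 (base K)) ⟶ W := b'
  obtain ⟨φ, hφ⟩ := Spec.map_surjective (R := CommRingCat.of (Away (homogeneousSubmodule (Fin (n + 1)) K) N))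
    (S := CommRingCat.of K) (a''.left ≫ Limits.pullback.snd f ι)
  obtain ⟨ψ, hψ⟩ := Spec.map_surjective (R := CommRingCat.of (Away (homogeneousSubmodule (Fin (n + 1)) K) N))
    (S := CommRingCat.of K) (b''.left ≫ Limits.pullback.snd f ι)
  have hne : φ.hom ≠ ψ.hom := by
    intro h
    apply hab
    refine congrArg _ (show a'' = b'' from ?_)
    ext1
    rw [← cancel_mono (Limits.pullback.snd f ι)]
    refine hφ.symm.trans (Eq.trans ?_ hψ)
    rw [CommRingCat.hom_ext h]
  obtain ⟨r, hr⟩ : ∃ r, φ.hom r ≠ ψ.hom r := by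
    by_contra! h
    exact hne (RingHom.ext h)
  obtain ⟨g, hg⟩ := exists_separating_affineLine _ (awayStructureMap K N) r
  refine ⟨W, hW, j, s ≫ g, hj, a', b', hbij, rfl, rfl, fun h => hr ?_⟩
  have h' : (a''.left ≫ Limits.pullback.snd f ι) ≫ g.left =
      (b''.left ≫ Limits.pullback.snd f ι) ≫ g.left := by
    have := congrArg CommaMorphism.left h
    refine (Category.assoc _ _ _).trans (Eq.trans ?_ (Category.assoc _ _ _).symm)
    exact this
  rw [← hφ, ← hψ] at h'
  have h'' := (hg φ.hom).symm.trans (h'.trans (hg ψ.hom))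
  have := RingHom.congr_fun (congrArg CommRingCat.Hom.hom (Spec.map_injective h'')) Polynomial.X
  simpa using this

theorem algebraMap_mul_awayInvCoord (K : Type*) [Field K] {σ : Type*} (i : σ) :
    algebraMap (MvPolynomial σ K) (Localization.Away (X i : MvPolynomial σ K)) (X i) *
      awayInvCoord K i = 1 := by
  rw [awayInvCoord, ← Localization.mk_one_eq_algebraMap, Localization.mk_mul, one_mul, mul_one]
  exact Localization.mk_self (S := Submonoid.powers (X i : MvPolynomial σ K))
    ⟨X i, Submonoid.mem_powers _⟩

/-- The line maps to the chart `X 0 ≠ 0` of `ℙ¹`. Surjectivity of `φ` onto `K[X]` is enough: the map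
is a closed immersion followed by an open one. -/
theorem isQuasiProjective_affineLine (K : Type u) [Field K] :
    IsQuasiProjective K (affineLine K) := by
  let f : MvPolynomial (Fin 2) K := X 0
  have hf : f ∈ homogeneousSubmodule (Fin 2) K 1 := X_mem_homogeneousSubmodule K 0
  let ε : MvPolynomial (Fin 2) K →+* Polynomial K := eval₂Hom Polynomial.C ![1, Polynomial.X]
  have hε : IsUnit (ε f) := by simp [ε, f]
  let φ : Away (homogeneousSubmodule (Fin 2) K) f →+* Polynomial K :=
    (IsLocalization.Away.lift (S := Localization.Away f) f hε).comp
      (algebraMap (Away (homogeneousSubmodule (Fin 2) K) f) (Localization.Away f))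
  have hφC : φ.comp (awayStructureMap K f) = Polynomial.C := by
    refine RingHom.ext fun r => ?_
    change IsLocalization.Away.lift (S := Localization.Away f) f hε
      (algebraMap (MvPolynomial (Fin 2) K) _ (C r)) = _
    rw [IsLocalization.Away.lift_eq]
    exact eval₂_C _ _ _
  have hφX : φ (awayCoord K 0 1) = Polynomial.X := by
    change IsLocalization.Away.lift (S := Localization.Away f) f hε (awayCoord K 0 1).val = _
    have h := congrArg (IsLocalization.Away.lift (S := Localization.Away f) f hε)
      (show algebraMap (MvPolynomial (Fin 2) K) (Localization.Away f) f * (awayCoord K 0 1).val =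
        algebraMap (MvPolynomial (Fin 2) K) (Localization.Away f) (X 1) by
          rw [val_awayCoord, ← mul_assoc]
          exact (congrArg (· * _) (algebraMap_mul_awayInvCoord K (0 : Fin 2))).trans (one_mul _))
    rw [map_mul, IsLocalization.Away.lift_eq, IsLocalization.Away.lift_eq] at h
    simpa [ε, f] using h
  have hsurj : Function.Surjective φ := by
    intro p
    induction p using Polynomial.induction_on' with
    | add p q hp hq =>
      obtain ⟨a, rfl⟩ := hp
      obtain ⟨b, rfl⟩ := hq
      exact ⟨a + b, map_add φ a b⟩
    | monomial m r =>
      refine ⟨awayStructureMap K f r * awayCoord K 0 1 ^ m, ?_⟩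
      rw [map_mul, map_pow, hφX, ← Polynomial.C_mul_X_pow_eq_monomial, ← hφC]
      rfl
  have hcl : IsClosedImmersion (Spec.map (CommRingCat.ofHom φ)) :=
    IsClosedImmersion.spec_of_surjective _ hsurj
  refine ⟨1, Over.homMk (Spec.map (CommRingCat.ofHom φ) ≫ Proj.awayι _ f hf one_pos) ?_, ?_⟩
  · change (Spec.map (CommRingCat.ofHom φ) ≫ Proj.awayι _ f hf one_pos) ≫
      projectiveSpaceStructure 1 K = Spec.map _
    rw [Category.assoc, awayι_comp_projectiveSpaceStructure, ← Spec.map_comp,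
      ← CommRingCat.ofHom_comp, hφC]
  · change IsImmersion (Spec.map (CommRingCat.ofHom φ) ≫ Proj.awayι _ f hf one_pos)
    infer_instance

end QuasiProjective

/-! ### From the affine line to quasi-projective varieties. -/

section Transfer

/-- A clopen étale image separating the values of the function is pulled back to `W` and pushed
forward along the étale map `j`. Since `j` is bijective on `K`-points, the complement is pushed
forward as well and stays open. -/
theorem EtaleTotallySeparated.of_isQuasiProjective {K : Type u} [Field K] (hK : ¬ IsSepClosed K)
    (h : EtaleTotallySeparated K (affineLine K)) (V : Over (base K)) (hV : IsVariety K V)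
    (hq : IsQuasiProjective K V) : EtaleTotallySeparated K V := by
  intro a b hab
  obtain ⟨W, hW, j, g, hj, a', b', hbij, rfl, rfl, hne⟩ :=
    exists_separating_of_isQuasiProjective hK hq hab
  obtain ⟨U, hU, ha, hb⟩ := h _ _ hne
  have hU' := hU.preimage g
  refine ⟨Points.map j '' (Points.map g ⁻¹' U), ⟨hU'.1.image j, ?_⟩, ⟨a', ha, rfl⟩, ?_⟩
  · rw [← isOpen_compl_iff, ← Set.image_compl_eq hbij]
    exact isOpenMap_pointsMap j _ hU'.2.isOpen_compl
  · rintro ⟨c, hc, hcb⟩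
    exact hb (hbij.1 hcb ▸ hc)

theorem totallySeparatedSpace_of_isQuasiProjective {K : Type u} [Field K] (hK : ¬ IsSepClosed K)
    (h : TotallySeparatedSpace (Points K (affineLine K))) (V : Over (base K)) (hV : IsVariety K V)
    (hq : IsQuasiProjective K V) : TotallySeparatedSpace (Points K V) := by
  refine totallySeparatedSpace_iff_exists_isClopen.mpr fun a b hab => ?_
  obtain ⟨W, hW, j, g, hj, a', b', hbij, rfl, rfl, hne⟩ :=
    exists_separating_of_isQuasiProjective hK hq hab
  obtain ⟨U, hU, ha, hb⟩ := totallySeparatedSpace_iff_exists_isClopen.mp h hne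
  have hU' := hU.preimage (continuous_pointsMap g)
  refine ⟨Points.map j '' (Points.map g ⁻¹' U), ⟨?_, ?_⟩, ⟨a', ha, rfl⟩, ?_⟩
  · rw [← isOpen_compl_iff, ← Set.image_compl_eq hbij]
    exact isOpenMap_pointsMap j _ hU'.1.isOpen_compl
  · exact isOpenMap_pointsMap j _ hU'.2
  · rintro ⟨c, hc, hcb⟩
    exact hb (hbij.1 hcb ▸ hc)

end Transfer

/-! ### Affine maps of the line: one nontrivial clopen set separates all points. -/

section PolynomialMap
open Polynomial

/-- The endomorphism of the affine line given by a polynomial. -/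
noncomputable def affineLineMap {K : Type u} [Field K] (p : K[X]) : affineLine K ⟶ affineLine K :=
  Over.homMk (Spec.map (CommRingCat.ofHom (compRingHom p))) (by
    change Spec.map _ ≫ Spec.map _ = Spec.map _
    rw [← Spec.map_comp, ← CommRingCat.ofHom_comp]
    congr 2
    exact RingHom.ext fun r => C_comp)

theorem map_affineLineMap {K : Type u} [Field K] (p : K[X]) (c : K) :
    Points.map (affineLineMap p) (affineLinePoint K c) = affineLinePoint K (p.eval c) := by
  let q : Over.mk (𝟙 (base K)) ⟶ affineLine K := affineLinePoint K c
  let r : Over.mk (𝟙 (base K)) ⟶ affineLine K := affineLinePoint K (p.eval c)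
  change q ≫ affineLineMap p = r
  ext1
  change Spec.map _ ≫ Spec.map _ = Spec.map _
  rw [← Spec.map_comp, ← CommRingCat.ofHom_comp]
  congr 2
  exact Polynomial.ringHom_ext (by simp) (by simp)

/-- An affine-linear polynomial sends `a` to a point `c` of `S` and `b` to a point `d` outside it.
-/
theorem exists_separating_polynomial {K : Type*} [Field K] {S : Set K} (h0 : S.Nonempty)
    (h1 : S ≠ Set.univ) {a b : K} (hab : a ≠ b) :
    ∃ p : K[X], p.eval a ∈ S ∧ p.eval b ∉ S := by
  obtain ⟨c, hc⟩ := h0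
  obtain ⟨d, hd⟩ := (Set.ne_univ_iff_exists_notMem S).mp h1
  have h : a - b ≠ 0 := sub_ne_zero.mpr hab
  refine ⟨C ((c - d) / (a - b)) * (X - C b) + C d, ?_, ?_⟩
  · have : (c - d) / (a - b) * (a - b) + d = c := by rw [div_mul_cancel₀ _ h]; ring
    simpa [this] using hc
  · simpa using hd

theorem exists_separating_affineLineMap {K : Type u} [Field K] {U : Set (Points K (affineLine K))}
    (h0 : U ≠ ∅) (h1 : U ≠ Set.univ) {a b : Points K (affineLine K)} (hab : a ≠ b) :
    ∃ f : affineLine K ⟶ affineLine K, Points.map f a ∈ U ∧ Points.map f b ∉ U := by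
  obtain ⟨a, rfl⟩ := (affineLinePoint K).surjective a
  obtain ⟨b, rfl⟩ := (affineLinePoint K).surjective b
  have h0' : (affineLinePoint K ⁻¹' U).Nonempty :=
    (Set.nonempty_iff_ne_empty.mpr h0).preimage (affineLinePoint K).surjective
  have h1' : affineLinePoint K ⁻¹' U ≠ Set.univ := by
    rw [Ne, Set.preimage_eq_univ_iff, (affineLinePoint K).surjective.range_eq, Set.univ_subset_iff]
    exact h1
  obtain ⟨p, hp⟩ := exists_separating_polynomial h0' h1' (fun h => hab (congrArg _ h))
  refine ⟨affineLineMap p, ?_⟩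
  rw [map_affineLineMap, map_affineLineMap]
  exact hp

theorem etaleTotallySeparated_affineLine {K : Type u} [Field K]
    (h : ¬ EtaleConnected K (affineLine K)) : EtaleTotallySeparated K (affineLine K) := by
  simp only [EtaleConnected, not_forall, not_or] at h
  obtain ⟨U, hU, h0, h1⟩ := h
  intro a b hab
  obtain ⟨f, ha, hb⟩ := exists_separating_affineLineMap h0 h1 hab
  exact ⟨_, hU.preimage f, ha, hb⟩

instance {K : Type u} [Field K] : Nontrivial (Points K (affineLine K)) :=
  (affineLinePoint K).symm.nontrivial

theorem connectedSpace_affineLine_iff (K : Type u) [Field K] :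
    ConnectedSpace (Points K (affineLine K)) ↔
      ∀ U : Set (Points K (affineLine K)), IsClopen U → U = ∅ ∨ U = Set.univ := by
  rw [connectedSpace_iff_clopen]
  exact ⟨fun h => h.2, fun h => ⟨inferInstance, h⟩⟩

theorem totallySeparatedSpace_affineLine {K : Type u} [Field K]
    (h : ¬ ConnectedSpace (Points K (affineLine K))) :
    TotallySeparatedSpace (Points K (affineLine K)) := by
  simp only [connectedSpace_affineLine_iff, not_forall, not_or] at h
  obtain ⟨U, hU, h0, h1⟩ := h
  refine totallySeparatedSpace_iff_exists_isClopen.mpr fun a b hab => ?_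
  obtain ⟨f, ha, hb⟩ := exists_separating_affineLineMap h0 h1 hab
  exact ⟨_, hU.preimage (continuous_pointsMap f), ha, hb⟩

end PolynomialMap

/-! ### Connectedness of the affine line. -/

section AffineLineTopology
open Polynomial

theorem EtaleConnected.eq_univ {K : Type u} [Field K] (h : EtaleConnected K (affineLine K))
    {S : Set K} (hS : IsEtaleImage (affineLinePoint K '' S))
    (hc : ∀ c ∉ S, ∃ T : Set K, IsEtaleImage (affineLinePoint K '' T) ∧ c ∈ T ∧ Disjoint T S)
    (hne : S.Nonempty) : S = Set.univ := by
  have hcl : IsClosed (affineLinePoint K '' S) := by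
    rw [← isOpen_compl_iff, (isTopologicalBasis_isEtaleImage K (affineLine K)).isOpen_iff,
      ← Set.image_compl_eq (affineLinePoint K).bijective]
    rintro _ ⟨c, hcS, rfl⟩
    obtain ⟨T, hT, hcT, hTS⟩ := hc c hcS
    exact ⟨_, hT, Set.mem_image_of_mem _ hcT,
      Set.image_mono (Set.subset_compl_iff_disjoint_right.mpr hTS)⟩
  rcases h _ ⟨hS, hcl⟩ with h0 | h1
  · exact absurd (Set.image_eq_empty.mp h0) hne.ne_empty
  · rw [← Set.preimage_image_eq S (affineLinePoint K).injective, h1, Set.preimage_univ]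

theorem isEtaleImage_simple_root {K L : Type u} [Field K] [Field L] [Algebra K L]
    [FiniteDimensional K L] (G : K[X]) (α β : L) :
    IsEtaleImage (affineLinePoint K '' {c | ∃ y : L, aeval y G = α + algebraMap K L c * β ∧
      aeval y (derivative G) ≠ 0}) := by
  have h := isEtaleImage_image_algebraImage (K := K) (WeilAlgebra (Module.finBasis K L) G α β)
  convert h using 2
  ext c
  exact (exists_ringHom_weilAlgebra_iff (Module.finBasis K L) G α β c).symm

/-- The derivative of `X ^ p - X` is `-1`, so every root is simple. -/
theorem isEtaleImage_artinSchreier {K L : Type u} [Field K] [Field L] [Algebra K L]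
    [FiniteDimensional K L] (p : ℕ) [CharP L p] (α β : L) :
    IsEtaleImage (affineLinePoint K '' {c | ∃ y : L, y ^ p - y = α + algebraMap K L c * β}) := by
  convert isEtaleImage_simple_root (X ^ p - X : K[X]) α β using 5 with c
  funext y
  simp [derivative_X_pow]

/-- For `m ≠ 1` invertible, the derivative of `X ^ m` vanishes exactly at zero, so simple roots are
the nonzero ones; for `m = 1` the root zero would be simple too. -/
theorem isEtaleImage_pow {K L : Type u} [Field K] [Field L] [Algebra K L]
    [FiniteDimensional K L] {m : ℕ} (hm : (m : L) ≠ 0) (hm1 : m ≠ 1) (α β : L) :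
    IsEtaleImage (affineLinePoint K '' {c | ∃ y : L, y ≠ 0 ∧ y ^ m = α + algebraMap K L c * β}) := by
  convert isEtaleImage_simple_root (X ^ m : K[X]) α β using 5 with c
  funext y
  have hm0 : m ≠ 0 := by rintro rfl; simp at hm
  have : m - 1 ≠ 0 := by omega
  simp [derivative_X_pow, hm, this, and_comm]

/-- The values of `y ^ p - y` form an additive group. The set of `c` with `c a` in that group
contains 0, and its translate around a point outside is a disjoint étale image. So it is clopen,
hence all of `K`, and `c = 1` gives the claim. -/
theorem EtaleConnected.exists_pow_sub_self_eq {K L : Type u} [Field K] [Field L] [Algebra K L]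
    [FiniteDimensional K L] (h : EtaleConnected K (affineLine K)) {p : ℕ} (hp : p.Prime)
    (hL : CharP L p) (a : L) : ∃ b, b ^ p - b = a := by
  have : Fact p.Prime := ⟨hp⟩
  have hsub (x y : L) : (x - y) ^ p - (x - y) = (x ^ p - x) - (y ^ p - y) := by
    rw [sub_pow_char]
    ring
  have key := h.eq_univ (isEtaleImage_artinSchreier (K := K) p 0 a) (fun c hc => ?_)
    ⟨0, 0, by simp [hp.ne_zero]⟩
  · have h1 : (1 : K) ∈ {c : K | ∃ y : L, y ^ p - y = 0 + algebraMap K L c * a} := key ▸ trivial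
    simpa using h1
  · refine ⟨_, isEtaleImage_artinSchreier (K := K) p (-(algebraMap K L c * a)) a, ⟨0, ?_⟩, ?_⟩
    · simp [hp.ne_zero]
    · refine Set.disjoint_left.mpr ?_
      rintro d ⟨y, hy⟩ ⟨z, hz⟩
      refine hc ⟨z - y, ?_⟩
      rw [hsub, hy, hz]
      ring

/-- The same coset argument for the multiplicative group of nonzero `m`-th powers, along the line `1
+ c (γ - 1)` through 1 and `γ`. This line avoids 0 exactly because `γ` is not in `K`. -/
theorem EtaleConnected.exists_pow_eq {K L : Type u} [Field K] [Field L] [Algebra K L]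
    [FiniteDimensional K L] (h : EtaleConnected K (affineLine K))
    (hs : ¬ Function.Surjective (algebraMap K L)) {m : ℕ} (hm : (m : L) ≠ 0) (a : L) :
    ∃ b, b ^ m = a := by
  by_cases hm1 : m = 1
  · exact ⟨a, by rw [hm1, pow_one]⟩
  have hm0 : m ≠ 0 := by rintro rfl; simp at hm
  have main (γ : L) (hγ : γ ∉ Set.range (algebraMap K L)) : ∃ b, b ^ m = γ := by
    have key := h.eq_univ (isEtaleImage_pow (K := K) hm hm1 1 (γ - 1)) (fun c hc => ?_)
      ⟨0, 1, by simp⟩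
    · have h1 : (1 : K) ∈ {c : K | ∃ y : L, y ≠ 0 ∧ y ^ m = 1 + algebraMap K L c * (γ - 1)} :=
        key ▸ trivial
      obtain ⟨y, -, hy⟩ := h1
      exact ⟨y, by simpa using hy⟩
    · set w := 1 + algebraMap K L c * (γ - 1) with hw
      have hw0 : w ≠ 0 := by
        intro h0
        have hc0 : algebraMap K L c ≠ 0 := by
          intro h1
          rw [hw, h1, zero_mul, add_zero] at h0
          exact one_ne_zero h0
        refine hγ ⟨1 - c⁻¹, ?_⟩
        rw [map_sub, map_one, map_inv₀]
        field_simp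
        linear_combination -h0
      refine ⟨_, isEtaleImage_pow (K := K) hm hm1 w⁻¹ (w⁻¹ * (γ - 1)), ⟨1, one_ne_zero, ?_⟩, ?_⟩
      · rw [one_pow]
        have : w⁻¹ + algebraMap K L c * (w⁻¹ * (γ - 1)) = w⁻¹ * w := by rw [hw]; ring
        rw [this, inv_mul_cancel₀ hw0]
      · refine Set.disjoint_left.mpr ?_
        rintro d ⟨y, hy0, hy⟩ ⟨z, hz0, hz⟩
        refine hc ⟨z / y, div_ne_zero hz0 hy0, ?_⟩
        have hyz : y ^ m = w⁻¹ * z ^ m := by rw [hy, hz]; ring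
        have hz0' : z ^ m ≠ 0 := pow_ne_zero _ hz0
        rw [div_pow, hyz, ← hw]
        field_simp
  by_cases ha : a ∈ Set.range (algebraMap K L)
  · by_cases ha0 : a = 0
    · exact ⟨0, by rw [ha0, zero_pow hm0]⟩
    -- A nonzero element `a` of `K` is the product of `a * θ` and `θ⁻¹`, both outside `K`.
    obtain ⟨θ, hθ⟩ := not_forall.mp hs
    change θ ∉ Set.range (algebraMap K L) at hθ
    have hrange (x : L) : x ∈ Set.range (algebraMap K L) ↔ x ∈ (algebraMap K L).fieldRange := Iff.rfl
    have hθ0 : θ ≠ 0 := by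
      rintro rfl
      exact hθ ⟨0, map_zero _⟩
    obtain ⟨b, hb⟩ := main (a * θ) fun h1 => hθ <| by
      rw [hrange] at h1 ha ⊢
      simpa [ha0] using mul_mem (inv_mem ha) h1
    obtain ⟨b', hb'⟩ := main θ⁻¹ fun h1 => hθ <| by
      rw [hrange] at h1 ⊢
      simpa using inv_mem h1
    refine ⟨b * b', ?_⟩
    rw [mul_pow, hb, hb', mul_assoc, mul_inv_cancel₀ hθ0, mul_one]
  · exact main a ha

theorem EtaleConnected.isRealClosed {K : Type u} [Field K] (hK : ¬ IsSepClosed K)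
    (h : EtaleConnected K (affineLine K)) : IsRealClosed K :=
  isRealClosed_of_surjective hK (fun _ hp hc a => h.exists_pow_sub_self_eq hp hc a)
    fun _ _ _ _ hs => ⟨fun _ hm a => h.exists_pow_eq hs hm a,
      fun _ hp hc a => h.exists_pow_sub_self_eq hp hc a⟩

/-- Closedness puts each point of the complement in a standard étale image disjoint from `U`, which
is the form in which `eq_empty_or_univ_of_isRealClosed` needs it. -/
theorem etaleConnected_of_isRealClosed {K : Type u} [Field K] [IsRealClosed K] :
    EtaleConnected K (affineLine K) := by
  rintro U ⟨hU, hcl⟩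
  obtain ⟨ι, hι, P, hP⟩ := exists_preimage_eq_iUnion_standardEtaleImage hU
  have hUeq : U = affineLinePoint K '' ⋃ i, standardEtaleImage (P i) := by
    rw [← hP, Set.image_preimage_eq _ (affineLinePoint K).surjective]
  have := eq_empty_or_univ_of_isRealClosed P fun c hc => by
    rw [← hP] at hc
    obtain ⟨W, hW, hcW, hWU⟩ := (isTopologicalBasis_isEtaleImage K _).exists_subset_of_mem_open
      (show affineLinePoint K c ∈ Uᶜ from hc) hcl.isOpen_compl
    obtain ⟨κ, -, Q, hQ⟩ := exists_preimage_eq_iUnion_standardEtaleImage hW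
    have hcW' : c ∈ ⋃ i, standardEtaleImage (Q i) := by
      rw [← hQ]
      exact hcW
    obtain ⟨j, hj⟩ := Set.mem_iUnion.mp hcW'
    refine ⟨Q j, hj, ?_⟩
    rw [← hP]
    refine Set.disjoint_left.mpr fun d hd hdU => hWU ?_ hdU
    have : d ∈ ⋃ i, standardEtaleImage (Q i) := Set.mem_iUnion.mpr ⟨j, hd⟩
    rw [← hQ] at this
    exact this
  rcases this with h | h
  · exact Or.inl (by rw [hUeq, h, Set.image_empty])
  · exact Or.inr (by rw [hUeq, h, Set.image_univ, (affineLinePoint K).surjective.range_eq])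

/-- A linearly ordered field in which every nonempty bounded set has a supremum is isomorphic to
the field of real numbers. -/
theorem nonempty_ringEquiv_real {K : Type*} [Field K] [LinearOrder K] [IsStrictOrderedRing K]
    (h : ∀ S : Set K, S.Nonempty → BddAbove S → ∃ a, IsLUB S a) : Nonempty (K ≃+* ℝ) := by
  classical
  have hInf (S : Set K) (h0 : S.Nonempty) (hb : BddBelow S) : ∃ a, IsGLB S a := by
    obtain ⟨a, ha⟩ := h (lowerBounds S) hb (h0.mono fun x hx y hy => hy hx)
    exact ⟨a, isLUB_lowerBounds.mp ha⟩
  let _ : ConditionallyCompleteLinearOrder K :=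
    { (inferInstance : LinearOrder K), (inferInstance : Lattice K) with
      sSup := fun S => if hS : S.Nonempty ∧ BddAbove S then (h S hS.1 hS.2).choose else 0
      sInf := fun S => if hS : S.Nonempty ∧ BddBelow S then (hInf S hS.1 hS.2).choose else 0
      isLUB_csSup := fun S h0 hb => by
        rw [dif_pos ⟨h0, hb⟩]
        exact (h S h0 hb).choose_spec
      isGLB_csInf := fun S h0 hb => by
        rw [dif_pos ⟨h0, hb⟩]
        exact (hInf S h0 hb).choose_spec
      csSup_of_not_bddAbove := fun S hS => by simp [hS]
      csInf_of_not_bddBelow := fun S hS => by simp [hS] }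
  exact ⟨(ConditionallyCompleteLinearOrderedField.inducedOrderRingIso K ℝ).toRingEquiv⟩

theorem IsEtaleImage.isOpen {K : Type u} [Field K] {V : Over (base K)} {U : Set (Points K V)}
    (hU : IsEtaleImage U) : IsOpen U :=
  TopologicalSpace.isOpen_generateFrom_of_mem hU

/-- In a real closed field `a < c` means that `c - a` is a nonzero square. -/
theorem isOpen_image_Ioi {K : Type u} [Field K] [IsRealClosed K] [LinearOrder K]
    [IsStrictOrderedRing K] (a : K) : IsOpen (affineLinePoint K '' Set.Ioi a) := by
  have h := isEtaleImage_pow (K := K) (L := K) (m := 2) two_ne_zero (by norm_num) (-a) 1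
  convert h.isOpen using 2
  ext c
  simp only [Set.mem_Ioi, Set.mem_ofPred_eq, Algebra.algebraMap_self, RingHom.id_apply, mul_one]
  constructor
  · intro hc
    obtain ⟨y, hy⟩ := IsRealClosed.nonneg_iff_isSquare.mp (sub_pos.mpr hc).le
    refine ⟨y, ?_, by rw [sq, ← hy]; ring⟩
    rintro rfl
    rw [mul_zero] at hy
    exact (sub_pos.mpr hc).ne' hy
  · rintro ⟨y, hy0, hy⟩
    have : 0 < y ^ 2 := by positivity
    linarith

theorem isOpen_image_Iio {K : Type u} [Field K] [IsRealClosed K] [LinearOrder K]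
    [IsStrictOrderedRing K] (a : K) : IsOpen (affineLinePoint K '' Set.Iio a) := by
  have h := (isOpen_image_Ioi (-a)).preimage (continuous_pointsMap (affineLineMap (-X : K[X])))
  convert h using 1
  ext p
  obtain ⟨c, rfl⟩ := (affineLinePoint K).surjective p
  rw [Set.mem_preimage, map_affineLineMap, (affineLinePoint K).injective.mem_set_image,
    (affineLinePoint K).injective.mem_set_image]
  simp

/-- A nonempty bounded set `S` without supremum gives a gap. Its upper bounds form a union of open
rays, because none of them is least; the complement is the union of the rays below elements of `S`.
-/
theorem not_connectedSpace_of_isRealClosed {K : Type u} [Field K] [IsRealClosed K]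
    (hK : ¬ Nonempty (K ≃+* ℝ)) : ¬ ConnectedSpace (Points K (affineLine K)) := by
  obtain ⟨_, _⟩ := exists_linearOrder_of_isRealClosed K
  obtain ⟨S, ⟨s, hs⟩, ⟨b, hb⟩, hlub⟩ : ∃ S : Set K, S.Nonempty ∧ BddAbove S ∧ ∀ a, ¬ IsLUB S a := by
    by_contra! h
    exact hK (nonempty_ringEquiv_real h)
  have hD : ⋃ a ∈ S, Set.Iio a = (upperBounds S)ᶜ := by
    ext x
    simp [upperBounds]
  have hU : ⋃ a ∈ upperBounds S, Set.Ioi a = upperBounds S := by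
    ext x
    simp only [Set.mem_iUnion, Set.mem_Ioi, exists_prop]
    constructor
    · rintro ⟨a, ha, hax⟩ y hy
      exact (ha hy).trans hax.le
    · intro hx
      by_contra! h
      exact hlub x ⟨hx, h⟩
  intro hconn
  rw [connectedSpace_affineLine_iff] at hconn
  have hclopen : IsClopen (affineLinePoint K '' upperBounds S) := by
    constructor
    · rw [← isOpen_compl_iff, ← Set.image_compl_eq (affineLinePoint K).bijective, ← hD]
      simp_rw [Set.image_iUnion]
      exact isOpen_biUnion fun a _ => isOpen_image_Iio a
    · rw [← hU]
      simp_rw [Set.image_iUnion]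
      exact isOpen_biUnion fun a _ => isOpen_image_Ioi a
  rcases hconn _ hclopen with h | h
  · exact (Set.image_eq_empty.mp h ▸ hb : b ∈ (∅ : Set K)).elim
  · have h1 : s - 1 ∈ upperBounds S := by
      rw [← (affineLinePoint K).injective.mem_set_image, h]
      trivial
    linarith [h1 hs]

/-- Étale images are open in the usual topology, so the line is a continuous image of `ℝ`. -/
theorem connectedSpace_of_ringEquiv_real {K : Type u} [Field K] (e : K ≃+* ℝ) :
    ConnectedSpace (Points K (affineLine K)) := by
  have hsurj : Function.Surjective (affineLinePoint K ∘ e.symm) :=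
    (affineLinePoint K).surjective.comp e.symm.surjective
  refine hsurj.connectedSpace (continuous_generateFrom_iff.mpr fun U hU => ?_)
  obtain ⟨ι, -, P, hP⟩ := exists_preimage_eq_iUnion_standardEtaleImage hU
  rw [Set.preimage_comp, hP, Set.preimage_iUnion]
  exact isOpen_iUnion fun i => isOpen_preimage_standardEtaleImage e (P i)

theorem IsEtaleImage.inter_nonempty_of_isSepClosed {K : Type u} [Field K] [Infinite K] [IsSepClosed K]
    {U W : Set (Points K (affineLine K))} (hU : IsEtaleImage U) (hW : IsEtaleImage W)
    (hU0 : U.Nonempty) (hW0 : W.Nonempty) : (U ∩ W).Nonempty := by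
  obtain ⟨ι, -, P, hP⟩ := exists_preimage_eq_iUnion_standardEtaleImage hU
  obtain ⟨κ, -, Q, hQ⟩ := exists_preimage_eq_iUnion_standardEtaleImage hW
  have hP0 := hU0.preimage (affineLinePoint K).surjective
  have hQ0 := hW0.preimage (affineLinePoint K).surjective
  rw [hP, Set.nonempty_iUnion] at hP0
  rw [hQ, Set.nonempty_iUnion] at hQ0
  obtain ⟨i, hi⟩ := hP0
  obtain ⟨j, hj⟩ := hQ0
  obtain ⟨c, hcP, hcQ⟩ := standardEtaleImage_inter_nonempty _ _ hi hj
  have h1 : c ∈ affineLinePoint K ⁻¹' U := hP ▸ Set.mem_iUnion.mpr ⟨i, hcP⟩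
  have h2 : c ∈ affineLinePoint K ⁻¹' W := hQ ▸ Set.mem_iUnion.mpr ⟨j, hcQ⟩
  exact ⟨affineLinePoint K c, h1, h2⟩

theorem connectedSpace_of_isSepClosed {K : Type u} [Field K] [Infinite K] [IsSepClosed K] :
    ConnectedSpace (Points K (affineLine K)) := by
  rw [connectedSpace_affineLine_iff]
  intro U hU
  by_contra! h
  obtain ⟨h0, h1⟩ := h
  obtain ⟨a, ha⟩ := h0
  obtain ⟨b, hb⟩ := (Set.ne_univ_iff_exists_notMem U).mp h1
  have hB := isTopologicalBasis_isEtaleImage K (affineLine K)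
  obtain ⟨W, hW, haW, hWU⟩ := hB.exists_subset_of_mem_open ha hU.2
  obtain ⟨W', hW', hbW', hWU'⟩ := hB.exists_subset_of_mem_open
    (show b ∈ Uᶜ from hb) hU.1.isOpen_compl
  obtain ⟨c, hc, hc'⟩ := IsEtaleImage.inter_nonempty_of_isSepClosed hW hW' ⟨a, haW⟩ ⟨b, hbW'⟩
  exact hWU' hc' (hWU hc)

/-- If `K` is not real closed, the line already fails to be étale connected, which is stronger than
failing to be connected; the real closed case uses a gap. -/
theorem not_connectedSpace_affineLine {K : Type u} [Field K] (hs : ¬ IsSepClosed K)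
    (hK : ¬ Nonempty (K ≃+* ℝ)) : ¬ ConnectedSpace (Points K (affineLine K)) := by
  by_cases hr : IsRealClosed K
  · exact not_connectedSpace_of_isRealClosed hK
  · intro hconn
    rw [connectedSpace_affineLine_iff] at hconn
    exact hr (EtaleConnected.isRealClosed hs fun U hU =>
      hconn U ⟨hU.2, hU.1.isOpen⟩)

theorem EtaleTotallySeparated.not_etaleConnected {K : Type u} [Field K]
    (h : EtaleTotallySeparated K (affineLine K)) : ¬ EtaleConnected K (affineLine K) := by
  intro hc
  obtain ⟨a, b, hab⟩ := exists_pair_ne (Points K (affineLine K))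
  obtain ⟨U, hU, ha, hb⟩ := h a b hab
  rcases hc U hU with rfl | rfl
  · exact ha
  · exact hb trivial

theorem not_connectedSpace_of_totallySeparatedSpace {α : Type*} [TopologicalSpace α] [Nontrivial α]
    (h : TotallySeparatedSpace α) : ¬ ConnectedSpace α := by
  intro hc
  obtain ⟨a, b, hab⟩ := exists_pair_ne α
  obtain ⟨U, hU, ha, hb⟩ := totallySeparatedSpace_iff_exists_isClopen.mp h hab
  rcases (connectedSpace_iff_clopen.mp hc).2 U hU with rfl | rfl
  · exact ha
  · exact hb trivial

end AffineLineTopology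
end EtaleOpen

/-! ### Assembly of the equivalences. -/

theorem mainTheorem7 (K : Type u) [Field K] [Infinite K] :
    (¬ IsSepClosed K →
      [ ¬ EtaleOpen.EtaleConnected K (EtaleOpen.affineLine K),
        EtaleOpen.EtaleTotallySeparated K (EtaleOpen.affineLine K),
        ∀ V : Over (EtaleOpen.base K), EtaleOpen.IsVariety K V →
          EtaleOpen.IsQuasiProjective K V → EtaleOpen.EtaleTotallySeparated K V,
        ¬ IsRealClosed K ].TFAE ∧
      [ ¬ ConnectedSpace (EtaleOpen.Points K (EtaleOpen.affineLine K)),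
        TotallySeparatedSpace (EtaleOpen.Points K (EtaleOpen.affineLine K)),
        ∀ V : Over (EtaleOpen.base K), EtaleOpen.IsVariety K V →
          EtaleOpen.IsQuasiProjective K V → TotallySeparatedSpace (EtaleOpen.Points K V),
        ¬ Nonempty (K ≃+* ℝ) ].TFAE) ∧
    (ConnectedSpace (EtaleOpen.Points K (EtaleOpen.affineLine K)) ↔
      IsSepClosed K ∨ Nonempty (K ≃+* ℝ)) := by

  open EtaleOpen in
  refine ⟨fun hs => ⟨?_, ?_⟩, ?_⟩
  · tfae_have 1 → 2 := etaleTotallySeparated_affineLine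
    tfae_have 2 → 3 := EtaleTotallySeparated.of_isQuasiProjective hs
    tfae_have 3 → 1 := fun h =>
      (h _ (isVariety_affineLine K) (isQuasiProjective_affineLine K)).not_etaleConnected
    tfae_have 4 → 1 := mt (EtaleConnected.isRealClosed hs)
    tfae_have 1 → 4 := fun h _ => h etaleConnected_of_isRealClosed
    tfae_finish
  · tfae_have 1 → 2 := totallySeparatedSpace_affineLine
    tfae_have 2 → 3 := totallySeparatedSpace_of_isQuasiProjective hs
    tfae_have 3 → 1 := fun h => not_connectedSpace_of_totallySeparatedSpace
      (h _ (isVariety_affineLine K) (isQuasiProjective_affineLine K))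
    tfae_have 4 → 1 := not_connectedSpace_affineLine hs
    tfae_have 1 → 4 := fun h ⟨e⟩ => h (connectedSpace_of_ringEquiv_real e)
    tfae_finish
  · constructor
    · intro h
      by_contra! hc
      exact not_connectedSpace_affineLine hc.1 (not_nonempty_iff.mpr hc.2) h
    · rintro (h | ⟨⟨e⟩⟩)
      · exact connectedSpace_of_isSepClosed
      · exact connectedSpace_of_ringEquiv_real e
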